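/- Let $L,M,N\ge 1$ be integers running along a sequence such that $M\to\infty$, $N\to\infty$, $c_N:=\frac{ML}{N}\to c\in(0,\infty)$ and, in addition, $\frac{L^{3/2}}{MN}\to0$. Let $(\mathcal S_m)_{m\ge1}$ be integrable functions on $[0,1]$ with $\inf_{m,\nu}\mathcal S_m(\nu)>0$ and $\sup_{m,\nu}\mathcal S_m(\nu)<\infty$, let $r_m(k)=\int_0^1\mathcal S_m(\nu)e^{2i\pi\nu k}\,d\nu$ for $k\in\mathbb Z$, and assume $\sup_M\sum_{n\in\mathbb Z}\big(\frac1M\sum_{m=1}^M|r_m(n)|^2\big)^{1/2}<\infty$. For each $N$ let $(w_{m,N}(n))_{1\le m\le M,\,1\le n\le N+L-1}$ be a zero mean, circularly symmetric, jointly complex Gaussian family with $\mathbb E[w_{m,N}(k)w_{m',N}(k')^*]=\frac{r_m(k-k')}{N}\mathbf 1_{m=m'}$ (so that the $M$ sequences are independent). Let $W_N$ be the $ML\times N$ matrix whose $m$-th $L\times N$ block row is the Hankel matrix $(w_{m,N}(i+j-1))_{1\le i\le L,\,1\le j\le N}$, and let $Q_N(z)=(W_NW_N^H-zI)^{-1}$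 for $z\in\mathbb C\setminus\mathbb R^+$, where $\mathbb R^+=[0,\infty)$. Put $\delta_z=\mathrm{dist}(z,\mathbb R^+)$. For an $R\times R$ matrix $X$, let $\Psi^{(m)}_K(X)$ be the $K\times K$ Toeplitz matrix with entries $\sum_{l=-R+1}^{R-1}r_m(i-j-l)\,\tau(X)(l)$, where $\tau(X)(l)=\frac1R\mathrm{tr}(XJ_R^l)$, $J_R$ is the $R\times R$ matrix with ones on the first upper diagonal and zeros elsewhere, and $J_R^{-1}$ denotes its transpose. For an $N\times N$ matrix $X$, let $\Psi(X)$ be the $ML\times ML$ block diagonal matrix with diagonal blocks $\Psi^{(m)}_L(X)$, $1\le m\le M$; for an $ML\times ML$ matrix $X$ with $L\times L$ diagonal blocks $X^{m,m}$, let $\overline\Psi(X)=\frac1M\sum_{m=1}^M\Psi_N^{(m)}(X^{m,m})$. Let $\mathcal S_K(\mathbb R^+)$ be the set of functions $z\mapsto\int_{\mathbb R^+}\frac{d\mu(\lambda)}{\lambda-z}$ on $\mathbb C\setminus\mathbb R^+$, with $\mu$ a positive $K\times K$ matrix valued measure carried by $\mathbb R^+$ and $\mu(\mathbb R^+)=I_K$.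 Let $(T_N,\widetilde T_N)\in\mathcal S_{ML}(\mathbb R^+)\times\mathcal S_N(\mathbb R^+)$ be the solution of $$T_N(z)=-\tfrac1z\big(I_{ML}+\Psi(\widetilde T_N(z)^T)\big)^{-1},\qquad \widetilde T_N(z)=-\tfrac1z\big(I_N+c_N\overline\Psi(T_N(z))^T\big)^{-1},\qquad z\in\mathbb C\setminus\mathbb R^+ .$$ Then such a solution exists for every $N$, and there are polynomials $P_1,P_2,Q_1,Q_2$ in one variable with positive coefficients, independent of $L,M,N$, of $z$ and of the matrices $A_N$ below, such that, for every such solution: 1. for every $N$, every $z$ in the set $E_N=\{z\in\mathbb C\setminus\mathbb R^+:\ \frac{L^{3/2}}{MN}Q_1(|z|)Q_2(1/\delta_z)<1\}$ and every deterministic $ML\times ML$ matrix $A_N$, $$\Big|\tfrac1{ML}\mathrm{tr}\big(A_N(\mathbb E Q_N(z)-T_N(z))\big)\Big|\le \|A_N\|\,P_1(|z|)P_2(1/\delta_z)\,\frac{L}{MN},$$ where $\|\cdot\|$ is the spectral norm; 2. for every $z\in\mathbb C\setminus\mathbb R^+$, this inequality holds for all $A_N$ as soon as $N$ is larger than some rank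 that depends only on $z$; 3. consequently, for every $z\in\mathbb C\setminus\mathbb R^+$ and every sequence of deterministic $ML\times ML$ matrices with $\sup_N\|A_N\|<\infty$, $\frac1{ML}\mathrm{tr}\big((\mathbb E Q_N(z)-T_N(z))A_N\big)=\mathcal O\big(\frac{L}{MN}\big)$. -/

import Mathlib

open MeasureTheory ProbabilityTheory Filter Topology
open scoped Matrix ComplexOrder

noncomputable section

namespace BlockHankel

/-- The closed half line `[0, ∞)`, seen inside `ℂ`. -/
def halfLine : Set ℂ := Complex.ofReal '' Set.Ici (0 : ℝ)

/-- `δ_z = dist(z, [0, ∞))`. -/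
def delta (z : ℂ) : ℝ := Metric.infDist z halfLine

/-- The spectral norm of a square complex matrix. -/
def specNorm {ι : Type*} [Fintype ι] [DecidableEq ι] (A : Matrix ι ι ℂ) : ℝ :=
  ‖Matrix.toEuclideanCLM (n := ι) (𝕜 := ℂ) A‖

/-- A real polynomial all of whose coefficients (up to its degree) are positive. -/
def IsNice (p : Polynomial ℝ) : Prop := ∀ i ≤ p.natDegree, 0 < p.coeff i

/-! ### The correlation sequences and the random matrix -/

/-- The correlation coefficients `r(k) = ∫₀¹ S(ν) exp(2iπνk) dν` of the spectral density `S`. -/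
def corr (S : ℝ → ℝ) (k : ℤ) : ℂ :=
  ∫ ν in (0 : ℝ)..1, (S ν : ℂ) * Complex.exp (2 * Real.pi * Complex.I * ν * k)

/-- The family `w m n` (`m < M`, `n < N + L - 1`) is a zero mean, circularly symmetric, jointly
complex Gaussian family with `E[w_m(k) w_{m'}(k')^*] = r_m(k - k') / N` if `m = m'`, and `0`
otherwise. In particular the processes `w m`, `m < M`, are mutually independent. -/
structure IsInputFamily {Ω : Type*} [MeasurableSpace Ω] (P : Measure Ω) (S : ℕ → ℝ → ℝ)
    (M L N : ℕ) (w : Fin M → Fin (N + L - 1) → Ω → ℂ) : Prop where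
  gaussian : HasGaussianLaw (fun ω (p : Fin M × Fin (N + L - 1)) => w p.1 p.2 ω) P
  mean : ∀ m n, ∫ ω, w m n ω ∂P = 0
  cov : ∀ m m' n n', ∫ ω, w m n ω * star (w m' n' ω) ∂P =
    if m = m' then corr (S m) ((n : ℤ) - (n' : ℤ)) / (N : ℂ) else 0
  pseudoCov : ∀ m m' n n', ∫ ω, w m n ω * w m' n' ω ∂P = 0

/-- The `ML × N` block-Hankel matrix. Its rows are indexed by pairs (block, row in the block);
with indices starting from `0`, its entry `((m, i), j)` is `w m (i + j)`. -/
def hankel {M L N : ℕ} (w : Fin M → Fin (N + L - 1) → ℂ) :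
    Matrix (Fin M × Fin L) (Fin N) ℂ :=
  Matrix.of fun p j => w p.1 ⟨p.2.val + j.val, by have h1 := p.2.isLt; have h2 := j.isLt; omega⟩

/-- The resolvent `(W Wᴴ - z I)⁻¹`. -/
def resolvent {M L N : ℕ} (W : Matrix (Fin M × Fin L) (Fin N) ℂ) (z : ℂ) :
    Matrix (Fin M × Fin L) (Fin M × Fin L) ℂ :=
  (W * Wᴴ - z • (1 : Matrix (Fin M × Fin L) (Fin M × Fin L) ℂ))⁻¹

/-- The entrywise expectation of the resolvent of the block-Hankel matrix. -/
def meanResolvent {Ω : Type*} [MeasurableSpace Ω] (P : Measure Ω) {M L N : ℕ}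
    (w : Fin M → Fin (N + L - 1) → Ω → ℂ) (z : ℂ) :
    Matrix (Fin M × Fin L) (Fin M × Fin L) ℂ :=
  Matrix.of fun p q => ∫ ω, resolvent (hankel (L := L) fun m n => w m n ω) z p q ∂P

/-! ### The Toeplitzification operators -/

/-- `J_R^l`: the `l`-th power of the `R × R` shift matrix (ones on the first upper diagonal),
where negative powers are powers of the transpose. -/
def shiftPow (R : ℕ) (l : ℤ) : Matrix (Fin R) (Fin R) ℂ :=
  Matrix.of fun a b => if (b : ℤ) - (a : ℤ) = l then 1 else 0

/-- `τ(X)(l) = (1/R) tr(X J_R^l)`. -/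
def tau {R : ℕ} (X : Matrix (Fin R) (Fin R) ℂ) (l : ℤ) : ℂ :=
  (1 / (R : ℂ)) * (X * shiftPow R l).trace

/-- The `K × K` Toeplitz matrix with entries `∑_{l = -R+1}^{R-1} r(i - j - l) τ(X)(l)`. -/
def toeplitz (r : ℤ → ℂ) (K : ℕ) {R : ℕ} (X : Matrix (Fin R) (Fin R) ℂ) :
    Matrix (Fin K) (Fin K) ℂ :=
  Matrix.of fun i j => ∑ l ∈ Finset.Ioo (-(R : ℤ)) (R : ℤ), r ((i : ℤ) - (j : ℤ) - l) * tau X l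

/-- `Ψ(X)`: the block diagonal matrix whose `m`-th `L × L` block is the Toeplitz matrix built
from `r_m` and the `N × N` matrix `X`. -/
def Psi (S : ℕ → ℝ → ℝ) (M L : ℕ) {N : ℕ} (X : Matrix (Fin N) (Fin N) ℂ) :
    Matrix (Fin M × Fin L) (Fin M × Fin L) ℂ :=
  Matrix.of fun p q =>
    if p.1 = q.1 then toeplitz (corr (S p.1)) L X p.2 q.2 else 0

/-- `Ψ̄(X)`: the average over `m` of the `N × N` Toeplitz matrices built from `r_m` and the `m`-th
`L × L` diagonal block of `X`. -/
def PsiBar (S : ℕ → ℝ → ℝ) {M L : ℕ} (N : ℕ)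
    (X : Matrix (Fin M × Fin L) (Fin M × Fin L) ℂ) : Matrix (Fin N) (Fin N) ℂ :=
  (1 / (M : ℂ)) • ∑ m : Fin M,
    toeplitz (corr (S m)) N (Matrix.of fun i j : Fin L => X (m, i) (m, j))

/-! ### Stieltjes transforms of positive matrix valued measures -/

/-- A positive matrix valued measure on `ℝ`. -/
structure PosMatrixMeasure (ι : Type*) where
  toVectorMeasure : VectorMeasure ℝ (Matrix ι ι ℂ)
  posSemidef : ∀ s, (toVectorMeasure s).PosSemidef

/-- The real part of the quadratic form `X ↦ xᴴ X x`, as an additive map. -/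
def quadForm {ι : Type*} [Fintype ι] (x : ι → ℂ) : Matrix ι ι ℂ →+ ℝ where
  toFun X := (star x ⬝ᵥ (X *ᵥ x)).re
  map_zero' := by simp
  map_add' X Y := by simp [Matrix.add_mulVec]

theorem continuous_quadForm {ι : Type*} [Fintype ι] (x : ι → ℂ) : Continuous (quadForm x) := by
  change Continuous fun X : Matrix ι ι ℂ => (star x ⬝ᵥ (X *ᵥ x)).re
  fun_prop

theorem quadForm_nonneg {ι : Type*} [Fintype ι] (μ : PosMatrixMeasure ι) (x : ι → ℂ) :
    VectorMeasure.restrict 0 Set.univ ≤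
      (μ.toVectorMeasure.mapRange (quadForm x) (continuous_quadForm x)).restrict Set.univ := by
  rw [VectorMeasure.restrict_univ, VectorMeasure.restrict_univ, VectorMeasure.le_iff]
  intro s _
  simpa [quadForm] using (Complex.nonneg_iff.1 ((μ.posSemidef s).dotProduct_mulVec_nonneg x)).1

/-- The positive scalar measure `s ↦ xᴴ μ(s) x`. -/
def PosMatrixMeasure.quad {ι : Type*} [Fintype ι] (μ : PosMatrixMeasure ι) (x : ι → ℂ) :
    Measure ℝ :=
  SignedMeasure.toMeasureOfZeroLE
    (μ.toVectorMeasure.mapRange (quadForm x) (continuous_quadForm x))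
    Set.univ MeasurableSet.univ (quadForm_nonneg μ x)

/-- The class of functions `F(z) = ∫ dμ(λ) / (λ - z)` on `ℂ \ [0, ∞)`, where `μ` is a positive
matrix valued measure carried by `[0, ∞)` of total mass `I`. The matrix identity is expressed
through the quadratic forms of both sides, which determine them. -/
def IsStieltjes {ι : Type*} [Fintype ι] [DecidableEq ι] (F : ℂ → Matrix ι ι ℂ) : Prop :=
  ∃ μ : PosMatrixMeasure ι,
    μ.toVectorMeasure Set.univ = 1 ∧ μ.toVectorMeasure (Set.Iio 0) = 0 ∧
    ∀ z ∉ halfLine, ∀ x : ι → ℂ,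
      star x ⬝ᵥ (F z *ᵥ x) = ∫ t : ℝ, ((t : ℂ) - z)⁻¹ ∂(μ.quad x)

/-! ### The canonical equation -/

/-- `(T, T')` belongs to the classes of Stieltjes transforms above and, on `ℂ \ [0, ∞)`, solves
`T = -z⁻¹ (I + Ψ(T'ᵀ))⁻¹`, `T' = -z⁻¹ (I + c_N Ψ̄(T)ᵀ)⁻¹`, with `c_N = ML/N`. -/
structure IsCanonicalPair (S : ℕ → ℝ → ℝ) (M L N : ℕ)
    (T : ℂ → Matrix (Fin M × Fin L) (Fin M × Fin L) ℂ)
    (T' : ℂ → Matrix (Fin N) (Fin N) ℂ) : Prop where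
  stieltjes : IsStieltjes T
  stieltjes' : IsStieltjes T'
  eq : ∀ z ∉ halfLine, T z = (-z⁻¹) • (1 + Psi S M L (T' z)ᵀ)⁻¹
  eq' : ∀ z ∉ halfLine, T' z =
    (-z⁻¹) • (1 + ((M : ℂ) * (L : ℂ) / (N : ℂ)) • (PsiBar S N (T z))ᵀ)⁻¹

end BlockHankel

end

/-! Write z = ζ² with Im ζ > 0 and let X be the Hermitian matrix with off-diagonal blocks W and Wᴴ.
The upper left block of G = (X - ζ)⁻¹ is ζ Q_N(z) (`resolvent_eq`). X is real linear in a Gaussian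
vector, and G and all its substitutes have norm at most 1/Im ζ, itself at most (1 + |z|)(1 + 1/δ_z)
(`inv_im_le`); this is the origin of the polynomials.

Approximate equation. Gaussian integration by parts gives 1 + ζ E[G] + E[η(G) G] = 0 with η(B) = E[X
B X] (`schwinger_dyson`). The two blocks of η, `etaRow` and `etaCol`, are Ψ and c_N Ψ̄ up to
transposition, and are completely positive. Replacing E[η(G) G] by η(E G) E G produces a sum over
shifts l of covariances of linear statistics of G. The Poincaré inequality bounds the variance of
tr(C G) by a constant times (L/N) hs(C)² / (Im ζ)⁴, and the summability of the quadratic means of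
the r_m makes the sum over l cost a factor L. Let F = ζ E Q_N(z), and let R', R be obtained from F
by applying the two canonical equations in turn. Then |tr B(F - R)| is at most a constant times
(L²/N) ‖B‖, which is the rate L/(MN) after division by ML.

Stability (`norm_trace_mul_sub_le`). With T, T' now denoting ζ T_N(z) and ζ T̃_N(z), resolvent
identities give F - T = (F - R) + R η(R' η(F - T) T') T. Passing to the adjoint map and iterating it
on the test matrix expresses tr B(F - T) as a Neumann series in F - R. The series converges
geometrically because imaginary parts are good weights: Im T = y T Tᴴ + T η(Im T') Tᴴ with y = Im ζ,
so Cauchy–Schwarz makes each half step a contraction with a ratio depending on y and on the norm of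
η only. For R' the corresponding identity contains Im F instead of Im R; half of y absorbs the
difference as soon as the form of η(F - R) is at most y/2. Testing F - R against η(x xᴴ) bounds this
form by a multiple of L^(3/2)/(MN), and this is the condition that defines E_N.

Existence. The iteration B ↦ -(ζ + η(B))⁻¹ for the Hermitized map converges by the same contraction
(`dom_iterM_sub`). By Schur complements each iterate is a compression of the resolvent of a finite
Hermitian matrix (`exists_realization`), hence the Stieltjes transform of a matrix measure of total
mass I with a second moment bounded independently of the iterate. Tightness provides a limit
measure. The symmetry ζ ↦ -ζ̄ allows 1/(λ - ζ) to be replaced by ζ/(λ² - ζ²), and the image of the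
measure under λ ↦ λ² gives the solution on [0, ∞). -/

open MeasureTheory ProbabilityTheory Filter Topology
open scoped Matrix ComplexOrder

noncomputable section

namespace BlockHankel

open scoped Matrix.Norms.L2Operator

/-! ### Hilbert–Schmidt norms, quadratic forms and dissipative matrices -/

section LinearAlgebra

variable {m n p q κ : Type*} [Fintype m] [Fintype n] [Fintype p] [Fintype q] [Fintype κ]

/-- The squared Euclidean norm of a vector. -/
def nsq (x : n → ℂ) : ℝ := ∑ i, ‖x i‖ ^ 2

theorem nsq_nonneg (x : n → ℂ) : 0 ≤ nsq x := Finset.sum_nonneg fun _ _ => by positivity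

theorem norm_toLp_sq (x : n → ℂ) : ‖(WithLp.toLp 2 x : EuclideanSpace ℂ n)‖ ^ 2 = nsq x := by
  rw [EuclideanSpace.norm_eq, Real.sq_sqrt (Finset.sum_nonneg fun _ _ => by positivity)]
  rfl

theorem sqrt_nsq (x : n → ℂ) : √(nsq x) = ‖(WithLp.toLp 2 x : EuclideanSpace ℂ n)‖ := by
  rw [← norm_toLp_sq, Real.sqrt_sq (norm_nonneg _)]

theorem star_dotProduct_self (x : n → ℂ) : star x ⬝ᵥ x = (nsq x : ℂ) := by
  simp [dotProduct, nsq, Complex.conj_mul']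

theorem nsq_eq_zero {x : n → ℂ} (h : nsq x = 0) : x = 0 := by
  have h1 := norm_toLp_sq x
  rw [h, sq_eq_zero_iff, norm_eq_zero] at h1
  exact (WithLp.toLp_eq_zero 2).1 h1

theorem norm_star_dotProduct_le (x y : n → ℂ) : ‖star x ⬝ᵥ y‖ ≤ √(nsq x) * √(nsq y) := by
  rw [sqrt_nsq, sqrt_nsq]
  have := norm_inner_le_norm (𝕜 := ℂ) (WithLp.toLp 2 x : EuclideanSpace ℂ n) (WithLp.toLp 2 y)
  rwa [EuclideanSpace.inner_toLp_toLp, dotProduct_comm] at this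

theorem nsq_mulVec_le [DecidableEq n] (A : Matrix m n ℂ) (x : n → ℂ) :
    nsq (A *ᵥ x) ≤ ‖A‖ ^ 2 * nsq x := by
  have h := Matrix.l2_opNorm_mulVec A (WithLp.toLp 2 x)
  rw [← norm_toLp_sq, ← norm_toLp_sq, ← mul_pow]
  exact pow_le_pow_left₀ (norm_nonneg _) h 2

theorem opNorm_le_of_nsq_le [DecidableEq n] {A : Matrix m n ℂ} {c : ℝ} (hc : 0 ≤ c)
    (h : ∀ x, nsq (A *ᵥ x) ≤ c ^ 2 * nsq x) : ‖A‖ ≤ c := by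
  rw [Matrix.l2_opNorm_def]
  refine ContinuousLinearMap.opNorm_le_bound _ hc fun x => ?_
  have h1 := h x.ofLp
  rw [← norm_toLp_sq, ← norm_toLp_sq, ← mul_pow] at h1
  exact (sq_le_sq₀ (norm_nonneg _) (by positivity)).1 h1

theorem opNorm_le_of_bilin [DecidableEq n] {A : Matrix m n ℂ} {c : ℝ} (hc : 0 ≤ c)
    (h : ∀ x y, ‖star x ⬝ᵥ (A *ᵥ y)‖ ≤ c * √(nsq x) * √(nsq y)) : ‖A‖ ≤ c := by
  refine opNorm_le_of_nsq_le hc fun x => ?_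
  have h1 := h (A *ᵥ x) x
  rw [star_dotProduct_self, Complex.norm_real, Real.norm_of_nonneg (nsq_nonneg _)] at h1
  have h2 := Real.sq_sqrt (nsq_nonneg (A *ᵥ x))
  have h3 := Real.sq_sqrt (nsq_nonneg x)
  have h4 := Real.sqrt_nonneg (nsq (A *ᵥ x))
  have h5 := Real.sqrt_nonneg (nsq x)
  set a := √(nsq (A *ᵥ x))
  set b := √(nsq x)
  rw [← h2, ← h3]
  rw [← h2] at h1
  have h6 : a ≤ c * b := by
    rcases h4.eq_or_lt with h0 | h0
    · rw [← h0]; positivity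
    · nlinarith
  calc a ^ 2 ≤ (c * b) ^ 2 := pow_le_pow_left₀ h4 h6 2
    _ = _ := by ring

theorem norm_bilin_le [DecidableEq n] (A : Matrix m n ℂ) (x : m → ℂ) (y : n → ℂ) :
    ‖star x ⬝ᵥ (A *ᵥ y)‖ ≤ ‖A‖ * √(nsq x) * √(nsq y) := by
  refine (norm_star_dotProduct_le _ _).trans ?_
  have := Real.sqrt_le_sqrt (nsq_mulVec_le A y)
  rw [Real.sqrt_mul (by positivity), Real.sqrt_sq (norm_nonneg _)] at this
  calc _ ≤ √(nsq x) * (‖A‖ * √(nsq y)) := by gcongr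
    _ = _ := by ring

/-- The Hilbert–Schmidt norm of a matrix. -/
def hs (A : Matrix m n ℂ) : ℝ := ‖(WithLp.toLp 2 (fun t : m × n => A t.1 t.2) : EuclideanSpace ℂ (m × n))‖

theorem hs_nonneg (A : Matrix m n ℂ) : 0 ≤ hs A := norm_nonneg _

theorem hs_sq (A : Matrix m n ℂ) : hs A ^ 2 = ∑ i, ∑ j, ‖A i j‖ ^ 2 := by
  rw [hs, norm_toLp_sq, nsq, Fintype.sum_prod_type]

theorem hs_sq_eq_sum_col (A : Matrix m n ℂ) : hs A ^ 2 = ∑ j, nsq (fun i => A i j) := by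
  rw [hs_sq, Finset.sum_comm]; rfl

theorem hs_add_le (A B : Matrix m n ℂ) : hs (A + B) ≤ hs A + hs B :=
  norm_add_le (WithLp.toLp 2 (fun t : m × n => A t.1 t.2) : EuclideanSpace ℂ (m × n))
    (WithLp.toLp 2 (fun t : m × n => B t.1 t.2))

theorem hs_zero : hs (0 : Matrix m n ℂ) = 0 := by
  have h := hs_sq (0 : Matrix m n ℂ)
  simpa using h

theorem hs_sum_le {ι : Type*} (s : Finset ι) (f : ι → Matrix m n ℂ) :
    hs (∑ i ∈ s, f i) ≤ ∑ i ∈ s, hs (f i) :=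
  Finset.le_sum_of_subadditive _ hs_zero.le hs_add_le s f

theorem hs_conjTranspose (A : Matrix m n ℂ) : hs Aᴴ = hs A := by
  rw [← sq_eq_sq₀ (hs_nonneg _) (hs_nonneg _), hs_sq, hs_sq, Finset.sum_comm]
  simp

theorem hs_mul_le_opNorm_mul [DecidableEq n] (A : Matrix m n ℂ) (B : Matrix n p ℂ) :
    hs (A * B) ≤ ‖A‖ * hs B := by
  rw [← sq_le_sq₀ (hs_nonneg _) (mul_nonneg (norm_nonneg _) (hs_nonneg _)), mul_pow,
    hs_sq_eq_sum_col, hs_sq_eq_sum_col, Finset.mul_sum]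
  exact Finset.sum_le_sum fun j _ => nsq_mulVec_le A fun i => B i j

theorem hs_mul_le_mul_opNorm [DecidableEq n] [DecidableEq p] (A : Matrix m n ℂ) (B : Matrix n p ℂ) :
    hs (A * B) ≤ hs A * ‖B‖ := by
  rw [← hs_conjTranspose, Matrix.conjTranspose_mul, ← hs_conjTranspose A,
    ← Matrix.l2_opNorm_conjTranspose, mul_comm]
  exact hs_mul_le_opNorm_mul _ _

theorem hs_one [DecidableEq n] : hs (1 : Matrix n n ℂ) = √(Fintype.card n) := by
  rw [← Real.sqrt_sq (hs_nonneg _), hs_sq]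
  congr 1
  simp [Matrix.one_apply, apply_ite, Finset.sum_ite_eq]

theorem hs_le_opNorm [DecidableEq m] [DecidableEq n] (A : Matrix m n ℂ) :
    hs A ≤ ‖A‖ * √(Fintype.card n) := by
  have := hs_mul_le_opNorm_mul A (1 : Matrix n n ℂ)
  rwa [Matrix.mul_one, hs_one] at this

theorem norm_trace_mul_le (A : Matrix m n ℂ) (B : Matrix n m ℂ) :
    ‖(A * B).trace‖ ≤ hs A * hs B := by
  have h := norm_inner_le_norm (𝕜 := ℂ)
    (WithLp.toLp 2 (fun t : m × n => Aᴴ t.2 t.1) : EuclideanSpace ℂ (m × n))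
    (WithLp.toLp 2 (fun t : m × n => B t.2 t.1))
  have h1 : hs A = ‖(WithLp.toLp 2 (fun t : m × n => Aᴴ t.2 t.1) : EuclideanSpace ℂ (m × n))‖ := by
    rw [← sq_eq_sq₀ (hs_nonneg _) (norm_nonneg _), hs_sq, norm_toLp_sq, nsq, Fintype.sum_prod_type]
    simp
  have h2 : hs B = ‖(WithLp.toLp 2 (fun t : m × n => B t.2 t.1) : EuclideanSpace ℂ (m × n))‖ := by
    rw [← sq_eq_sq₀ (hs_nonneg _) (norm_nonneg _), hs_sq, norm_toLp_sq, nsq, Fintype.sum_prod_type,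
      Finset.sum_comm]
  rw [h1, h2]
  refine le_of_eq_of_le ?_ h
  rw [EuclideanSpace.inner_toLp_toLp]
  congr 1
  simp [Matrix.trace, Matrix.mul_apply, dotProduct, Fintype.sum_prod_type, mul_comm]

theorem norm_trace_mul_le_opNorm [DecidableEq n] (A B : Matrix n n ℂ) :
    ‖(A * B).trace‖ ≤ Fintype.card n * (‖A‖ * ‖B‖) := by
  refine (norm_trace_mul_le A B).trans ?_
  have h := mul_le_mul (hs_le_opNorm A) (hs_le_opNorm B) (hs_nonneg _) (by positivity)
  refine h.trans (le_of_eq ?_)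
  have : √(Fintype.card n : ℝ) * √(Fintype.card n : ℝ) = Fintype.card n :=
    Real.mul_self_sqrt (by positivity)
  calc _ = (√(Fintype.card n : ℝ) * √(Fintype.card n : ℝ)) * (‖A‖ * ‖B‖) := by ring
    _ = _ := by rw [this]

/-- The imaginary part of the quadratic form of a matrix. -/
def imq (A : Matrix n n ℂ) (x : n → ℂ) : ℝ := (star x ⬝ᵥ (A *ᵥ x)).im

theorem imq_add (A B : Matrix n n ℂ) (x : n → ℂ) : imq (A + B) x = imq A x + imq B x := by
  simp [imq, Matrix.add_mulVec]

theorem imq_sum {ι : Type*} (s : Finset ι) (f : ι → Matrix n n ℂ) (x : n → ℂ) :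
    imq (∑ i ∈ s, f i) x = ∑ i ∈ s, imq (f i) x := by
  simp [imq, Matrix.sum_mulVec, dotProduct_sum]

theorem imq_smul_one [DecidableEq n] (ζ : ℂ) (x : n → ℂ) :
    imq (ζ • (1 : Matrix n n ℂ)) x = ζ.im * nsq x := by
  simp [imq, Matrix.smul_mulVec, star_dotProduct_self]

theorem imq_mul_mul_conjTranspose (A : Matrix p q ℂ) (B : Matrix q q ℂ) (x : p → ℂ) :
    imq (A * B * Aᴴ) x = imq B (Aᴴ *ᵥ x) := by
  simp [imq, ← Matrix.mulVec_mulVec, Matrix.star_mulVec, Matrix.dotProduct_mulVec,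
    Matrix.vecMul_vecMul]

theorem imq_le [DecidableEq n] (A : Matrix n n ℂ) (x : n → ℂ) : |imq A x| ≤ ‖A‖ * nsq x := by
  refine (Complex.abs_im_le_norm _).trans ((norm_bilin_le A x x).trans (le_of_eq ?_))
  rw [mul_assoc, Real.mul_self_sqrt (nsq_nonneg x)]

variable [DecidableEq n]

/-- By Cauchy–Schwarz, Im ⟨x, Hx⟩ ≤ ‖x‖ ‖Hx‖. The invertibility of ζ - X and of ζ + η(B), and the
bounds 1/Im ζ on their inverses, all come from this inequality. -/
theorem sqrt_le_of_dissipative {H : Matrix n n ℂ} {y : ℝ} (hy : 0 < y)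
    (h : ∀ x, y * nsq x ≤ imq H x) (x : n → ℂ) : y * √(nsq x) ≤ √(nsq (H *ᵥ x)) := by
  have h1 : imq H x ≤ √(nsq x) * √(nsq (H *ᵥ x)) :=
    ((le_abs_self _).trans (Complex.abs_im_le_norm _)).trans (norm_star_dotProduct_le _ _)
  have h2 := h x
  have h3 := Real.sq_sqrt (nsq_nonneg x)
  have h4 := Real.sqrt_nonneg (nsq x)
  rcases h4.eq_or_lt with h0 | h0
  · rw [← h0]; simp
  · rw [← h3] at h2
    by_contra! hlt
    nlinarith

theorem isUnit_det_of_dissipative {H : Matrix n n ℂ} {y : ℝ} (hy : 0 < y)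
    (h : ∀ x, y * nsq x ≤ imq H x) : IsUnit H.det := by
  rw [isUnit_iff_ne_zero]
  intro h0
  obtain ⟨v, hv, hv0⟩ := Matrix.exists_mulVec_eq_zero_iff.2 h0
  have h1 := sqrt_le_of_dissipative hy h v
  rw [hv0] at h1
  have h2 : √(nsq v) ≤ 0 := by
    have : nsq (0 : n → ℂ) = 0 := by simp [nsq]
    rw [this, Real.sqrt_zero] at h1
    nlinarith
  exact hv (nsq_eq_zero (le_antisymm (Real.sqrt_eq_zero'.1 (le_antisymm h2 (Real.sqrt_nonneg _)))
    (nsq_nonneg v)))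

theorem opNorm_inv_le_of_dissipative {H : Matrix n n ℂ} {y : ℝ} (hy : 0 < y)
    (h : ∀ x, y * nsq x ≤ imq H x) : ‖H⁻¹‖ ≤ 1 / y := by
  have hu := isUnit_det_of_dissipative hy h
  refine opNorm_le_of_nsq_le (by positivity) fun x => ?_
  have h1 := sqrt_le_of_dissipative hy h (H⁻¹ *ᵥ x)
  rw [Matrix.mulVec_mulVec, Matrix.mul_nonsing_inv _ hu, Matrix.one_mulVec] at h1
  have h2 := Real.sq_sqrt (nsq_nonneg x)
  have h3 := Real.sq_sqrt (nsq_nonneg (H⁻¹ *ᵥ x))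
  have h4 := pow_le_pow_left₀ (by positivity) h1 2
  rw [mul_pow, h2, h3] at h4
  rw [div_pow, one_pow, div_mul_eq_mul_div, one_mul, le_div_iff₀ (by positivity)]
  linarith

/-- `-H⁻¹`, for which `Im` is a congruence of `Im H`. -/
theorem imq_neg_inv_left {H : Matrix n n ℂ} (hu : IsUnit H.det) (x : n → ℂ) :
    imq (-H⁻¹) x = imq H ((-H⁻¹)ᴴ *ᵥ x) := by
  have h1 : (-H⁻¹) * H * (-H⁻¹)ᴴ = -(-H⁻¹)ᴴ := by
    rw [Matrix.neg_mul, Matrix.nonsing_inv_mul _ hu, Matrix.neg_mul, Matrix.one_mul]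
  rw [← imq_mul_mul_conjTranspose, h1]
  have h2 : star x ⬝ᵥ ((-(-H⁻¹)ᴴ) *ᵥ x) = - star (star x ⬝ᵥ ((-H⁻¹) *ᵥ x)) := by
    rw [Matrix.star_dotProduct, Matrix.star_mulVec, Matrix.neg_mulVec, dotProduct_neg,
      Matrix.dotProduct_mulVec, dotProduct_comm]
    simp [dotProduct_comm]
  simp only [imq] at *
  rw [h2]
  simp

/-- The mirror congruence of `imq_neg_inv_left`. Both are needed: the contraction sandwiches a
matrix between a left factor, estimated through its adjoint applied to x, and a right factor,
estimated through its own action. -/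
theorem imq_neg_inv_right {H : Matrix n n ℂ} (hu : IsUnit H.det) (x : n → ℂ) :
    imq (-H⁻¹) x = imq H ((-H⁻¹) *ᵥ x) := by
  have h1 : (-H⁻¹)ᴴ * H * (-H⁻¹) = -(-H⁻¹)ᴴ := by
    rw [Matrix.mul_neg, Matrix.mul_assoc, Matrix.mul_nonsing_inv _ hu, Matrix.mul_one]
  have h3 := imq_mul_mul_conjTranspose (-H⁻¹)ᴴ H x
  rw [Matrix.conjTranspose_conjTranspose] at h3
  rw [← h3, h1]
  have h2 : star x ⬝ᵥ ((-(-H⁻¹)ᴴ) *ᵥ x) = - star (star x ⬝ᵥ ((-H⁻¹) *ᵥ x)) := by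
    rw [Matrix.star_dotProduct, Matrix.star_mulVec, Matrix.neg_mulVec, dotProduct_neg,
      Matrix.dotProduct_mulVec, dotProduct_comm]
    simp [dotProduct_comm]
  simp only [imq] at *
  rw [h2]
  simp

end LinearAlgebra

/-! ### Completely positive maps and the weighted contraction estimate -/

section Kraus

variable {p q κ : Type*} [Fintype p] [Fintype q] [Fintype κ]

/-- The completely positive map `B ↦ ∑ₖ Aₖ B Aₖᴴ`. -/
def kmap (A : κ → Matrix p q ℂ) (B : Matrix q q ℂ) : Matrix p p ℂ := ∑ k, A k * B * (A k)ᴴ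

/-- The family of conjugate transposes of a family of matrices. -/
def adj (A : κ → Matrix p q ℂ) : κ → Matrix q p ℂ := fun k => (A k)ᴴ

theorem kmap_add (A : κ → Matrix p q ℂ) (B C : Matrix q q ℂ) :
    kmap A (B + C) = kmap A B + kmap A C := by
  simp [kmap, Matrix.mul_add, Matrix.add_mul, Finset.sum_add_distrib]

theorem kmap_neg (A : κ → Matrix p q ℂ) (B : Matrix q q ℂ) : kmap A (-B) = -kmap A B := by
  simp [kmap]

theorem kmap_sub (A : κ → Matrix p q ℂ) (B C : Matrix q q ℂ) :
    kmap A (B - C) = kmap A B - kmap A C := by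
  rw [sub_eq_add_neg, kmap_add, kmap_neg, sub_eq_add_neg]

theorem imq_kmap (A : κ → Matrix p q ℂ) (B : Matrix q q ℂ) (x : p → ℂ) :
    imq (kmap A B) x = ∑ k, imq B ((A k)ᴴ *ᵥ x) := by
  simp only [kmap, imq_sum, imq_mul_mul_conjTranspose]

/-- For the trace pairing, the adjoint map has the adjoint Kraus operators. This moves the
perturbation series from an unknown difference to the test matrix. -/
theorem trace_mul_kmap (A : κ → Matrix p q ℂ) (C : Matrix p p ℂ) (B : Matrix q q ℂ) :
    (C * kmap A B).trace = (kmap (adj A) C * B).trace := by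
  simp only [kmap, adj, Matrix.mul_sum, Matrix.sum_mul, Matrix.trace_sum,
    Matrix.conjTranspose_conjTranspose]
  refine Finset.sum_congr rfl fun k _ => ?_
  rw [← Matrix.mul_assoc, ← Matrix.mul_assoc, Matrix.trace_mul_comm]
  simp only [Matrix.mul_assoc]

/-- `∑ₖ Aₖ Aₖᴴ ≤ s`, in terms of vectors. -/
def KrausBound (A : κ → Matrix p q ℂ) (s : ℝ) : Prop :=
  ∀ x : p → ℂ, ∑ k, nsq ((A k)ᴴ *ᵥ x) ≤ s * nsq x

theorem sum_norm_mul_le_sqrt {ι : Type*} (t : Finset ι) (f : ι → ℝ) {a b : ι → ℝ} {c : ℝ}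
    (ha : ∀ k, 0 ≤ a k) (hb : ∀ k, 0 ≤ b k) (hc : 0 ≤ c)
    (h : ∀ k, f k ≤ c * √(a k) * √(b k)) :
    ∑ k ∈ t, f k ≤ c * √(∑ k ∈ t, a k) * √(∑ k ∈ t, b k) := by
  calc ∑ k ∈ t, f k ≤ ∑ k ∈ t, c * (√(a k) * √(b k)) :=
        Finset.sum_le_sum fun k _ => (h k).trans (le_of_eq (by ring))
    _ = c * ∑ k ∈ t, √(a k) * √(b k) := by rw [Finset.mul_sum]
    _ ≤ c * (√(∑ k ∈ t, a k) * √(∑ k ∈ t, b k)) := by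
        gcongr
        exact Real.sum_sqrt_mul_sqrt_le t (fun k => ha k) (fun k => hb k)
    _ = _ := by ring

theorem star_dotProduct_mul_mul (A : Matrix p q ℂ) (B : Matrix q q ℂ) (C : Matrix q p ℂ)
    (x y : p → ℂ) :
    star x ⬝ᵥ ((A * B * C) *ᵥ y) = star (Aᴴ *ᵥ x) ⬝ᵥ (B *ᵥ (C *ᵥ y)) := by
  simp [← Matrix.mulVec_mulVec, Matrix.star_mulVec, Matrix.dotProduct_mulVec,
    Matrix.vecMul_vecMul]

/-- A sesquilinear form is dominated by two weights. -/
def Dom (B : Matrix q q ℂ) (v w : (q → ℂ) → ℝ) (c : ℝ) : Prop :=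
  ∀ x y, ‖star x ⬝ᵥ (B *ᵥ y)‖ ≤ c * √(v x) * √(w y)

/-- Cauchy–Schwarz over the Kraus index: the constant is unchanged and each weight is transported by
the map. -/
theorem Dom.kmap {B : Matrix q q ℂ} {v w : (q → ℂ) → ℝ} {c : ℝ} (h : Dom B v w c) (hc : 0 ≤ c)
    (hv : ∀ x, 0 ≤ v x) (hw : ∀ x, 0 ≤ w x) (A : κ → Matrix p q ℂ) :
    Dom (kmap A B) (fun x => ∑ k, v ((A k)ᴴ *ᵥ x)) (fun x => ∑ k, w ((A k)ᴴ *ᵥ x)) c := by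
  intro x y
  have h1 : star x ⬝ᵥ (BlockHankel.kmap A B *ᵥ y) =
      ∑ k, star ((A k)ᴴ *ᵥ x) ⬝ᵥ (B *ᵥ ((A k)ᴴ *ᵥ y)) := by
    simp only [BlockHankel.kmap, Matrix.sum_mulVec, dotProduct_sum, star_dotProduct_mul_mul]
  rw [h1]
  exact (norm_sum_le _ _).trans (sum_norm_mul_le_sqrt _ _ (fun k => hv _) (fun k => hw _) hc
    fun k => h _ _)

/-- The source of the contraction ratio: when a ≤ σ b and the budget c contains both a and θ b, the
share of a in the budget is at most σ/(θ + σ) < 1. -/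
theorem le_div_mul_of_add_le {a b c θ σ : ℝ} (hθ : 0 < θ) (hσ : 0 < σ) (h1 : a ≤ σ * b)
    (h2 : θ * b + a ≤ c) : a ≤ σ / (θ + σ) * c := by
  rw [div_mul_eq_mul_div, le_div_iff₀ (by positivity)]
  nlinarith

/-- The weighted contraction estimate for `B ↦ T (∑ₖ Aₖ B Aₖᴴ) R`. -/
theorem Dom.step [DecidableEq p] {B : Matrix q q ℂ} {v w : (q → ℂ) → ℝ} {c θ σ : ℝ}
    (h : Dom B v w c) (hc : 0 ≤ c) (hv : ∀ x, 0 ≤ v x) (hw : ∀ x, 0 ≤ w x)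
    (A : κ → Matrix p q ℂ) (hθ : 0 < θ) (hσ : 0 < σ)
    (hvσ : ∀ x, ∑ k, v ((A k)ᴴ *ᵥ x) ≤ σ * nsq x) (hwσ : ∀ x, ∑ k, w ((A k)ᴴ *ᵥ x) ≤ σ * nsq x)
    {T R : Matrix p p ℂ} {v' w' : (p → ℂ) → ℝ}
    (hT : ∀ x, θ * nsq (Tᴴ *ᵥ x) + ∑ k, v ((A k)ᴴ *ᵥ (Tᴴ *ᵥ x)) ≤ v' x)
    (hR : ∀ x, θ * nsq (R *ᵥ x) + ∑ k, w ((A k)ᴴ *ᵥ (R *ᵥ x)) ≤ w' x) :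
    Dom (T * BlockHankel.kmap A B * R) v' w' (σ / (θ + σ) * c) := by
  intro x y
  rw [star_dotProduct_mul_mul]
  refine (h.kmap hc hv hw A _ _).trans ?_
  have h1 := Real.sqrt_le_sqrt (le_div_mul_of_add_le hθ hσ (hvσ _) (hT x))
  have h2 := Real.sqrt_le_sqrt (le_div_mul_of_add_le hθ hσ (hwσ _) (hR y))
  have hr : 0 ≤ σ / (θ + σ) := by positivity
  rw [Real.sqrt_mul hr] at h1 h2
  calc _ ≤ c * (√(σ / (θ + σ)) * √(v' x)) * (√(σ / (θ + σ)) * √(w' y)) := by gcongr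
    _ = (√(σ / (θ + σ)) * √(σ / (θ + σ))) * c * √(v' x) * √(w' y) := by ring
    _ = _ := by rw [Real.mul_self_sqrt hr]

variable [DecidableEq q] [DecidableEq p]

theorem opNorm_kmap_le {A : κ → Matrix p q ℂ} {s : ℝ} (hs : 0 ≤ s) (h : KrausBound A s)
    (B : Matrix q q ℂ) : ‖kmap A B‖ ≤ s * ‖B‖ := by
  refine opNorm_le_of_bilin (by positivity) fun x y => ?_
  have hB : Dom B nsq nsq ‖B‖ := fun x y => norm_bilin_le B x y
  refine (hB.kmap (norm_nonneg _) nsq_nonneg nsq_nonneg A x y).trans ?_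
  have h1 := Real.sqrt_le_sqrt (h x)
  have h2 := Real.sqrt_le_sqrt (h y)
  rw [Real.sqrt_mul hs] at h1 h2
  calc _ ≤ ‖B‖ * (√s * √(nsq x)) * (√s * √(nsq y)) := by gcongr
    _ = (√s * √s) * ‖B‖ * √(nsq x) * √(nsq y) := by ring
    _ = _ := by rw [Real.mul_self_sqrt hs]

omit [DecidableEq q] [DecidableEq p] in
theorem sum_hs_mul_sq_le {A : κ → Matrix p q ℂ} {s : ℝ} (h : KrausBound A s) (C : Matrix p p ℂ) :
    ∑ k, hs (C * A k) ^ 2 ≤ s * hs C ^ 2 := by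
  have h1 : ∀ k, hs (C * A k) ^ 2 = ∑ j, nsq ((A k)ᴴ *ᵥ fun i => Cᴴ i j) := fun k => by
    rw [← hs_conjTranspose, Matrix.conjTranspose_mul, hs_sq_eq_sum_col]
    rfl
  rw [Finset.sum_congr rfl fun k _ => h1 k, Finset.sum_comm, ← hs_conjTranspose C,
    hs_sq_eq_sum_col Cᴴ, Finset.mul_sum]
  exact Finset.sum_le_sum fun j _ => h _

omit [DecidableEq q] [DecidableEq p] in
-- Duality: with C the conjugate transpose of the image, the squared norm is the sum of the tr((C
-- Aₖ)(B Aₖᴴ)). Cauchy–Schwarz then uses the Kraus bound on the left factors and the adjoint one on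
-- the right factors, whereas the operator norm needs only the former.
theorem hs_kmap_le {A : κ → Matrix p q ℂ} {s : ℝ} (hs0 : 0 ≤ s) (h : KrausBound A s)
    (h' : KrausBound (adj A) s) (B : Matrix q q ℂ) : hs (kmap A B) ≤ s * hs B := by
  have h0 : ((kmap A B)ᴴ * kmap A B).trace = ((hs (kmap A B) ^ 2 : ℝ) : ℂ) := by
    rw [hs_sq_eq_sum_col]
    simp only [Matrix.trace, Matrix.diag, Matrix.mul_apply, nsq, Matrix.conjTranspose_apply]
    push_cast
    simp [Complex.conj_mul']
  have h1 : ‖((kmap A B)ᴴ * kmap A B).trace‖ ≤ s * hs (kmap A B) * hs B := by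
    set C := (kmap A B)ᴴ with hC
    have : (C * kmap A B).trace = ∑ k, ((C * A k) * (B * adj A k)).trace := by
      simp only [kmap, adj, Matrix.mul_sum, Matrix.trace_sum, Matrix.mul_assoc]
    rw [this]
    refine (norm_sum_le _ _).trans ((Finset.sum_le_sum fun k _ => norm_trace_mul_le _ _).trans ?_)
    have h2 : ∀ k, hs (C * A k) * hs (B * adj A k) ≤
        1 * √(hs (C * A k) ^ 2) * √(hs (B * adj A k) ^ 2) := fun k => by
      rw [Real.sqrt_sq (hs_nonneg _), Real.sqrt_sq (hs_nonneg _), one_mul]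
    refine (sum_norm_mul_le_sqrt _ _ (fun k => by positivity) (fun k => by positivity)
      zero_le_one h2).trans ?_
    have h3 := Real.sqrt_le_sqrt (sum_hs_mul_sq_le h C)
    have h4 := Real.sqrt_le_sqrt (sum_hs_mul_sq_le h' B)
    rw [Real.sqrt_mul hs0, Real.sqrt_sq (hs_nonneg _)] at h3 h4
    rw [show hs (kmap A B) = hs C from (hs_conjTranspose _).symm]
    have h5 := hs_nonneg C
    calc _ ≤ 1 * (√s * hs C) * (√s * hs B) := by gcongr
      _ = (√s * √s) * hs C * hs B := by ring
      _ = _ := by rw [Real.mul_self_sqrt hs0]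
  rw [h0, Complex.norm_real, Real.norm_of_nonneg (by positivity)] at h1
  rcases (hs_nonneg (kmap A B)).eq_or_lt with h5 | h5
  · rw [← h5]
    have := hs_nonneg B
    positivity
  · nlinarith

end Kraus

/-! ### Gaussian integration by parts and the Poincaré inequality -/

section Gaussian

variable {E : Type*} [NormedAddCommGroup E] [NormedSpace ℝ E] [SecondCountableTopology E]
  [CompleteSpace E] [MeasurableSpace E] [BorelSpace E] {μ : Measure E} [IsGaussian μ]

theorem memLp_norm_fst_snd : MemLp (fun p : E × E => ‖p.1‖) 2 (μ.prod μ) ∧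
    MemLp (fun p : E × E => ‖p.2‖) 2 (μ.prod μ) := by
  have h1 : MemLp (fun x : E => ‖x‖) 2 μ := (IsGaussian.memLp_two_id (μ := μ)).norm
  have ha : MemLp (fun p : E × E => ‖p.1‖) 2 (μ.prod μ) := MemLp.comp_fst (f := fun x : E => ‖x‖) h1 μ
  have hb : MemLp (fun p : E × E => ‖p.2‖) 2 (μ.prod μ) := MemLp.comp_snd (f := fun x : E => ‖x‖) h1 μ
  exact ⟨ha, hb⟩
theorem integrable_sq_growth (K : ℝ) :
    Integrable (fun p : E × E => K * (1 + 2 * (‖p.1‖ + ‖p.2‖)) ^ 2) (μ.prod μ) := by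
  obtain ⟨ha, hb⟩ := memLp_norm_fst_snd (μ := μ)
  have hd : MemLp (fun p : E × E => 2 * (‖p.1‖ + ‖p.2‖)) 2 (μ.prod μ) := (ha.add hb).const_mul 2
  have he : MemLp (fun p : E × E => (1 : ℝ)) 2 (μ.prod μ) := memLp_const 1
  have hc : MemLp (fun p : E × E => 1 + 2 * (‖p.1‖ + ‖p.2‖)) 2 (μ.prod μ) := he.add hd
  exact hc.integrable_sq.const_mul K

theorem norm_rotation_le (θ : ℝ) (p : E × E) :
    ‖(ContinuousLinearMap.rotation θ p).1‖ ≤ ‖p.1‖ + ‖p.2‖ ∧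
      ‖(ContinuousLinearMap.rotation θ p).2‖ ≤ ‖p.1‖ + ‖p.2‖ := by
  rw [ContinuousLinearMap.rotation_apply]
  have hc : |Real.cos θ| ≤ 1 := Real.abs_cos_le_one θ
  have hs : |Real.sin θ| ≤ 1 := Real.abs_sin_le_one θ
  have h1 := norm_nonneg p.1
  have h2 := norm_nonneg p.2
  constructor
  · refine (norm_add_le _ _).trans ?_
    rw [norm_smul, norm_smul, Real.norm_eq_abs, Real.norm_eq_abs]
    nlinarith
  · refine (norm_add_le _ _).trans ?_
    rw [norm_smul, norm_smul, Real.norm_eq_abs, Real.norm_eq_abs, abs_neg]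
    nlinarith

theorem continuous_rotation :
    Continuous fun t : (E × E) × ℝ => ContinuousLinearMap.rotation t.2 t.1 := by
  simp only [ContinuousLinearMap.rotation_apply]
  fun_prop

theorem continuous_rotation_left (p : E × E) :
    Continuous fun θ : ℝ => ContinuousLinearMap.rotation θ p := by
  simp only [ContinuousLinearMap.rotation_apply]
  fun_prop

/-- The square of a centered Gaussian measure is invariant under the rotations of pairs, so by
Fubini an average over an arc leaves the integral unchanged. The second moment is what makes
quadratic growth admissible. -/
theorem integral_rotation_average (h0 : μ[id] = 0) {F : Type*} [NormedAddCommGroup F]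
    [NormedSpace ℝ F] [SecondCountableTopology F] [CompleteSpace F] {φ : E × E → F}
    (hφ : Continuous φ) {K : ℝ} (hK : 0 ≤ K)
    (hb : ∀ p, ‖φ p‖ ≤ K * (1 + (‖p.1‖ + ‖p.2‖)) ^ 2) {T : ℝ} (hT : 0 ≤ T) :
    ∫ p, (∫ θ in (0 : ℝ)..T, φ (ContinuousLinearMap.rotation θ p)) ∂(μ.prod μ) =
      T • ∫ p, φ p ∂(μ.prod μ) ∧
    Integrable (fun p => ∫ θ in (0 : ℝ)..T, φ (ContinuousLinearMap.rotation θ p)) (μ.prod μ) := by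
  have hb' : ∀ (p : E × E) (θ : ℝ),
      ‖φ (ContinuousLinearMap.rotation θ p)‖ ≤ K * (1 + 2 * (‖p.1‖ + ‖p.2‖)) ^ 2 := fun p θ => by
    refine (hb _).trans ?_
    obtain ⟨h1, h2⟩ := norm_rotation_le θ p
    have h3 : 1 + (‖(ContinuousLinearMap.rotation θ p).1‖ +
      ‖(ContinuousLinearMap.rotation θ p).2‖) ≤ 1 + 2 * (‖p.1‖ + ‖p.2‖) := by linarith
    gcongr
  have : IsFiniteMeasure (volume.restrict (Set.uIoc 0 T)) := by
    rw [Set.uIoc_of_le hT]; infer_instance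
  have hint : Integrable (fun t : (E × E) × ℝ => φ (ContinuousLinearMap.rotation t.2 t.1))
      ((μ.prod μ).prod (volume.restrict (Set.uIoc 0 T))) := by
    refine Integrable.mono' ((integrable_sq_growth (μ := μ) K).comp_fst
      (volume.restrict (Set.uIoc 0 T))) ?_ (ae_of_all _ fun t => hb' t.1 t.2)
    exact (hφ.comp continuous_rotation).aestronglyMeasurable
  constructor
  · have hint' : Integrable (Function.uncurry fun (θ : ℝ) (p : E × E) =>
        φ (ContinuousLinearMap.rotation θ p))
        ((volume.restrict (Set.uIoc 0 T)).prod (μ.prod μ)) := hint.swap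
    rw [← intervalIntegral_integral_swap hint']
    have h1 : ∀ θ : ℝ, ∫ p, φ (ContinuousLinearMap.rotation θ p) ∂(μ.prod μ) =
        ∫ p, φ p ∂(μ.prod μ) := fun θ => by
      conv_rhs => rw [← IsGaussian.map_rotation_eq_self h0 θ]
      rw [integral_map (by fun_prop) hφ.aestronglyMeasurable]
    simp [h1]
  · have := hint.integral_prod_left
    refine this.congr (ae_of_all _ fun p => ?_)
    simp only [intervalIntegral.integral_of_le hT, Set.uIoc_of_le hT]

omit [SecondCountableTopology E] [CompleteSpace E] [MeasurableSpace E] [BorelSpace E] in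
theorem hasDerivAt_rotation (p : E × E) (θ : ℝ) :
    HasDerivAt (fun θ => (ContinuousLinearMap.rotation θ p).1)
      (ContinuousLinearMap.rotation θ p).2 θ ∧
    HasDerivAt (fun θ => (ContinuousLinearMap.rotation θ p).2)
      (-(ContinuousLinearMap.rotation θ p).1) θ := by
  simp only [ContinuousLinearMap.rotation_apply]
  constructor
  · exact ((Real.hasDerivAt_cos θ).smul_const p.1).add ((Real.hasDerivAt_sin θ).smul_const p.2)
  · exact (((Real.hasDerivAt_sin θ).neg.smul_const p.1).add
      ((Real.hasDerivAt_cos θ).smul_const p.2)).congr_deriv (by module)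

/-- Gaussian integration by parts. -/
theorem gaussian_integral_mul (h0 : μ[id] = 0) {f : E → ℂ} {f' : E → E →L[ℝ] ℂ}
    (hf : ∀ x, HasFDerivAt f (f' x) x) (hf' : Continuous f') {B C : ℝ}
    (hB : ∀ x, ‖f x‖ ≤ B) (hC : ∀ x, ‖f' x‖ ≤ C) (l : E →L[ℝ] ℂ) :
    ∫ x, l x * f x ∂μ = ∫ p, l p.2 * f' p.1 p.2 ∂(μ.prod μ) := by
  have hfc : Continuous f := continuous_iff_continuousAt.2 fun x => (hf x).continuousAt
  have hB0 : 0 ≤ B := (norm_nonneg _).trans (hB 0)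
  have hC0 : 0 ≤ C := (norm_nonneg _).trans (hC 0)
  have hl : ∀ x, ‖l x‖ ≤ ‖l‖ * ‖x‖ := l.le_opNorm
  set K : ℝ := ‖l‖ * B + ‖l‖ * C with hK
  have hK0 : 0 ≤ K := by positivity
  have g1 : ∀ p : E × E, ‖l p.1 * f p.1‖ ≤ (‖l‖ * B) * (1 + (‖p.1‖ + ‖p.2‖)) ^ 2 := fun p => by
    rw [norm_mul]
    have h1 : ‖l p.1‖ * ‖f p.1‖ ≤ (‖l‖ * ‖p.1‖) * B :=
      mul_le_mul (hl _) (hB _) (norm_nonneg _) (by positivity)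
    have h2 := norm_nonneg p.1
    have h3 := norm_nonneg p.2
    calc _ ≤ _ := h1
      _ = (‖l‖ * B) * ‖p.1‖ := by ring
      _ ≤ _ := by gcongr; nlinarith
  have g2 : ∀ p : E × E, ‖l p.2 * f' p.1 p.2‖ ≤ (‖l‖ * C) * (1 + (‖p.1‖ + ‖p.2‖)) ^ 2 := fun p => by
    rw [norm_mul]
    have h1 : ‖l p.2‖ * ‖f' p.1 p.2‖ ≤ (‖l‖ * ‖p.2‖) * (C * ‖p.2‖) :=
      mul_le_mul (hl _) (((f' p.1).le_opNorm _).trans (by gcongr; exact hC _)) (norm_nonneg _)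
        (by positivity)
    have h2 := norm_nonneg p.1
    have h3 := norm_nonneg p.2
    calc _ ≤ _ := h1
      _ = (‖l‖ * C) * ‖p.2‖ ^ 2 := by ring
      _ ≤ _ := by gcongr; linarith
  have hev : Continuous fun p : E × E => f' p.1 p.2 :=
    (hf'.comp continuous_fst).clm_apply continuous_snd
  have hi1 : Integrable (fun p : E × E => l p.1 * f p.1) (μ.prod μ) := by
    refine Integrable.mono' (integrable_sq_growth (‖l‖ * B)) (by fun_prop)
      (ae_of_all _ fun p => (g1 p).trans ?_)
    have h2 := norm_nonneg p.1
    have h3 := norm_nonneg p.2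
    gcongr
    linarith
  have hi2 : Integrable (fun p : E × E => l p.2 * f' p.1 p.2) (μ.prod μ) := by
    refine Integrable.mono' (integrable_sq_growth (‖l‖ * C))
      (Continuous.aestronglyMeasurable (by fun_prop)) (ae_of_all _ fun p => (g2 p).trans ?_)
    have h2 := norm_nonneg p.1
    have h3 := norm_nonneg p.2
    gcongr
    linarith
  -- Along the rotation, φ is the derivative of l(second coordinate) · f(first coordinate). Its
  -- integral over an arc is a difference of two quantities with the same mean, so φ has mean zero,
  -- which is the claim. The arc length 1 plays no role.
  let φ : E × E → ℂ := fun p => -(l p.1 * f p.1) + l p.2 * f' p.1 p.2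
  have hφ : Continuous φ := by fun_prop
  have hφb : ∀ p, ‖φ p‖ ≤ K * (1 + (‖p.1‖ + ‖p.2‖)) ^ 2 := fun p => by
    refine (norm_add_le _ _).trans ?_
    rw [norm_neg, hK, add_mul]
    exact add_le_add (g1 p) (g2 p)
  have hav := (integral_rotation_average (μ := μ) h0 hφ hK0 hφb (T := 1) zero_le_one).1
  let h : E × E → ℂ := fun p => l p.2 * f p.1
  have hcont : Continuous h := by fun_prop
  have hih : Integrable h (μ.prod μ) := by
    have := hi1.swap
    have hb : Integrable (fun p : E × E => ‖l p.2‖ * B) (μ.prod μ) := by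
      have h1 : Integrable (fun x : E => ‖l x‖ * B) μ :=
        ((l.integrable_comp IsGaussian.integrable_id).norm).mul_const B
      exact h1.comp_snd μ
    refine Integrable.mono' hb hcont.aestronglyMeasurable (ae_of_all _ fun p => ?_)
    rw [norm_mul]
    gcongr
    exact hB _
  have hFTC : ∀ p : E × E, ∫ θ in (0 : ℝ)..1, φ (ContinuousLinearMap.rotation θ p) =
      h (ContinuousLinearMap.rotation 1 p) - h p := fun p => by
    have hd : ∀ θ : ℝ, HasDerivAt (fun θ => h (ContinuousLinearMap.rotation θ p))
        (φ (ContinuousLinearMap.rotation θ p)) θ := fun θ => by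
      obtain ⟨r1, r2⟩ := hasDerivAt_rotation p θ
      have d1 := (hf _).comp_hasDerivAt θ r1
      have d2 := l.hasFDerivAt.comp_hasDerivAt θ r2
      have := d2.mul d1
      refine this.congr_deriv ?_
      simp only [φ, Function.comp, map_neg]
      ring
    rw [intervalIntegral.integral_eq_sub_of_hasDerivAt (fun θ _ => hd θ)
      ((hφ.comp (continuous_rotation_left p)).intervalIntegrable _ _)]
    simp [ContinuousLinearMap.rotation_apply, h]
  have hrot : ∫ p, h (ContinuousLinearMap.rotation 1 p) ∂(μ.prod μ) = ∫ p, h p ∂(μ.prod μ) := by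
    conv_rhs => rw [← IsGaussian.map_rotation_eq_self h0 1]
    rw [integral_map (by fun_prop) hcont.aestronglyMeasurable]
  have hirot : Integrable (fun p => h (ContinuousLinearMap.rotation 1 p)) (μ.prod μ) := by
    have := IsGaussian.map_rotation_eq_self h0 1 ▸ hih
    exact (integrable_map_measure hcont.aestronglyMeasurable (by fun_prop)).1
      (by rwa [IsGaussian.map_rotation_eq_self h0 1])
  simp only [hFTC] at hav
  rw [integral_sub hirot hih, hrot, sub_self, one_smul] at hav
  have h5 : ∫ p, φ p ∂(μ.prod μ) =
      -(∫ p, l p.1 * f p.1 ∂(μ.prod μ)) + ∫ p, l p.2 * f' p.1 p.2 ∂(μ.prod μ) := by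
    rw [← integral_neg]
    exact integral_add hi1.neg hi2
  have h6 : ∫ p, l p.1 * f p.1 ∂(μ.prod μ) = ∫ x, l x * f x ∂μ := by
    have := integral_fun_fst (μ := μ) (ν := μ) (f := fun x => l x * f x)
    simpa using this
  rw [h5, h6] at hav
  linear_combination hav

omit [IsGaussian μ] [SecondCountableTopology E] [CompleteSpace E] [NormedSpace ℝ E] in
theorem sq_integral_le [IsProbabilityMeasure μ] {g : E → ℝ} (hg : MemLp g 2 μ) :
    (∫ x, g x ∂μ) ^ 2 ≤ ∫ x, g x ^ 2 ∂μ := by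
  have h := variance_nonneg g μ
  rw [variance_eq_sub hg] at h
  simpa using h

theorem sq_intervalIntegral_le {g : ℝ → ℝ} (hg : Continuous g) {T : ℝ} (hT : 0 < T) :
    (∫ x in (0 : ℝ)..T, g x) ^ 2 ≤ T * ∫ x in (0 : ℝ)..T, g x ^ 2 := by
  set m := (∫ x in (0 : ℝ)..T, g x) / T with hm
  have h1 : 0 ≤ ∫ x in (0 : ℝ)..T, (g x - m) ^ 2 :=
    intervalIntegral.integral_nonneg hT.le fun _ _ => sq_nonneg _
  have h2 : ∫ x in (0 : ℝ)..T, (g x - m) ^ 2 =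
      (∫ x in (0 : ℝ)..T, g x ^ 2) - 2 * m * (∫ x in (0 : ℝ)..T, g x) + m ^ 2 * T := by
    have e : ∀ x, (g x - m) ^ 2 = g x ^ 2 - 2 * m * g x + m ^ 2 := fun x => by ring
    simp only [e]
    rw [intervalIntegral.integral_add, intervalIntegral.integral_sub,
      intervalIntegral.integral_const_mul]
    · simp [mul_comm]
    all_goals exact Continuous.intervalIntegrable (by fun_prop) _ _
  rw [h2] at h1
  have h3 : ∫ x in (0 : ℝ)..T, g x = m * T := by rw [hm]; field_simp
  rw [h3] at h1 ⊢
  nlinarith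

/-- The Gaussian Poincaré inequality. -/
theorem gaussian_poincare (h0 : μ[id] = 0) {f : E → ℂ} {f' : E → E →L[ℝ] ℂ}
    (hf : ∀ x, HasFDerivAt f (f' x) x) (hf' : Continuous f') {B C : ℝ}
    (hB : ∀ x, ‖f x‖ ≤ B) (hC : ∀ x, ‖f' x‖ ≤ C) :
    ∫ x, ‖f x - ∫ y, f y ∂μ‖ ^ 2 ∂μ ≤
      Real.pi ^ 2 / 4 * ∫ p, ‖f' p.1 p.2‖ ^ 2 ∂(μ.prod μ) := by
  have hfc : Continuous f := continuous_iff_continuousAt.2 fun x => (hf x).continuousAt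
  have hC0 : 0 ≤ C := (norm_nonneg _).trans (hC 0)
  have hpi : (0 : ℝ) < Real.pi / 2 := by positivity
  have hint : Integrable f μ :=
    Integrable.of_bound hfc.aestronglyMeasurable B (ae_of_all _ hB)
  have hd : ∀ x y, ‖f x - f y‖ ≤ 2 * B := fun x y =>
    (norm_sub_le _ _).trans (by linarith [hB x, hB y])
  have hi : Integrable (fun p : E × E => ‖f p.1 - f p.2‖ ^ 2) (μ.prod μ) := by
    refine Integrable.of_bound (Continuous.aestronglyMeasurable (by fun_prop)) ((2 * B) ^ 2)
      (ae_of_all _ fun p => ?_)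
    rw [Real.norm_of_nonneg (by positivity)]
    exact pow_le_pow_left₀ (norm_nonneg _) (hd _ _) 2
  -- Jensen in an independent copy; the sharper factor 1/2 is given up.
  have hA : ∫ x, ‖f x - ∫ y, f y ∂μ‖ ^ 2 ∂μ ≤ ∫ p, ‖f p.1 - f p.2‖ ^ 2 ∂(μ.prod μ) := by
    rw [integral_prod _ hi]
    refine integral_mono_of_nonneg (ae_of_all _ fun x => by positivity) hi.integral_prod_left
      (ae_of_all _ fun x => ?_)
    have h1 : f x - ∫ y, f y ∂μ = ∫ y, (f x - f y) ∂μ := by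
      rw [integral_sub (integrable_const _) hint]; simp
    have h2 : MemLp (fun y => ‖f x - f y‖) 2 μ :=
      MemLp.of_bound (Continuous.aestronglyMeasurable (by fun_prop)) (2 * B)
        (ae_of_all _ fun y => by rw [norm_norm]; exact hd x y)
    simp only
    rw [h1]
    exact (pow_le_pow_left₀ (norm_nonneg _) (norm_integral_le_integral_norm _) 2).trans
      (sq_integral_le h2)
  refine hA.trans ?_
  let φ : E × E → ℝ := fun p => ‖f' p.1 p.2‖ ^ 2
  have hev : Continuous fun p : E × E => f' p.1 p.2 :=
    (hf'.comp continuous_fst).clm_apply continuous_snd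
  have hφ : Continuous φ := by fun_prop
  have hφb : ∀ p, ‖φ p‖ ≤ C ^ 2 * (1 + (‖p.1‖ + ‖p.2‖)) ^ 2 := fun p => by
    rw [Real.norm_of_nonneg (by positivity), ← mul_pow]
    refine pow_le_pow_left₀ (norm_nonneg _) (((f' p.1).le_opNorm _).trans ?_) 2
    have h2 := norm_nonneg p.1
    exact mul_le_mul (hC _) (by linarith) (norm_nonneg _) hC0
  obtain ⟨hav, hav'⟩ :=
    integral_rotation_average (μ := μ) h0 hφ (sq_nonneg C) hφb hpi.le
  -- A quarter turn carries the first coordinate from p.1 to p.2. Cauchy–Schwarz on this arc gives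
  -- one factor π/2, and the rotation average gives the other.
  have hpt : ∀ p : E × E, ‖f p.1 - f p.2‖ ^ 2 ≤
      Real.pi / 2 * ∫ θ in (0 : ℝ)..(Real.pi / 2), φ (ContinuousLinearMap.rotation θ p) := fun p => by
    have hrc : Continuous fun θ : ℝ => ContinuousLinearMap.rotation θ p :=
      continuous_rotation_left p
    have hc1 : Continuous fun θ : ℝ => f' (ContinuousLinearMap.rotation θ p).1
      (ContinuousLinearMap.rotation θ p).2 := hev.comp hrc
    have hFTC : ∫ θ in (0 : ℝ)..(Real.pi / 2), f' (ContinuousLinearMap.rotation θ p).1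
        (ContinuousLinearMap.rotation θ p).2 = f p.2 - f p.1 := by
      rw [intervalIntegral.integral_eq_sub_of_hasDerivAt (fun θ _ =>
        (hf _).comp_hasDerivAt θ (hasDerivAt_rotation p θ).1) (hc1.intervalIntegrable _ _)]
      simp [ContinuousLinearMap.rotation_apply]
    rw [norm_sub_rev, ← hFTC]
    refine (pow_le_pow_left₀ (norm_nonneg _)
      (intervalIntegral.norm_integral_le_integral_norm hpi.le) 2).trans ?_
    exact sq_intervalIntegral_le hc1.norm hpi
  refine (integral_mono hi (hav'.const_mul _) hpt).trans (le_of_eq ?_)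
  rw [integral_const_mul, hav, smul_eq_mul]
  ring

end Gaussian

/-! ### The resolvent of a Gaussian Hermitian matrix -/

section GaussianResolvent

variable {n : Type*} [Fintype n] [DecidableEq n]

theorem norm_entry_le (A : Matrix n n ℂ) (i j : n) : ‖A i j‖ ≤ ‖A‖ := by
  have h := norm_bilin_le A (Pi.single i 1) (Pi.single j 1)
  have h1 : ∀ k : n, nsq (Pi.single k (1 : ℂ)) = 1 := fun k => by
    simp [nsq, Pi.single_apply, apply_ite]
  simpa [h1, Matrix.mulVec_single_one, ← Pi.single_star] using h

theorem imq_smul_one_sub_isHermitian {A : Matrix n n ℂ} (hA : A.IsHermitian) (ζ : ℂ) (x : n → ℂ) :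
    imq (ζ • 1 - A) x = ζ.im * nsq x := by
  have h1 : imq A x = 0 := by
    have h := hA.im_star_dotProduct_mulVec_self x
    simpa [imq] using h
  have h2 : imq (-A) x = - imq A x := by simp [imq, Matrix.neg_mulVec]
  rw [sub_eq_add_neg, imq_add, imq_smul_one, h2, h1]
  simp

/-- The resolvent `(A - ζ)⁻¹`. -/
def gres (A : Matrix n n ℂ) (ζ : ℂ) : Matrix n n ℂ := -(ζ • 1 - A)⁻¹

theorem isUnit_det_smul_one_sub {A : Matrix n n ℂ} (hA : A.IsHermitian) {ζ : ℂ} (hζ : 0 < ζ.im) :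
    IsUnit (ζ • 1 - A).det :=
  isUnit_det_of_dissipative hζ fun x => (imq_smul_one_sub_isHermitian hA ζ x).ge

theorem opNorm_gres_le {A : Matrix n n ℂ} (hA : A.IsHermitian) {ζ : ℂ} (hζ : 0 < ζ.im) :
    ‖gres A ζ‖ ≤ 1 / ζ.im := by
  rw [gres, norm_neg]
  exact opNorm_inv_le_of_dissipative hζ fun x => (imq_smul_one_sub_isHermitian hA ζ x).ge

theorem imq_gres_nonneg {A : Matrix n n ℂ} (hA : A.IsHermitian) {ζ : ℂ} (hζ : 0 < ζ.im)
    (x : n → ℂ) : 0 ≤ imq (gres A ζ) x := by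
  rw [gres, imq_neg_inv_left (isUnit_det_smul_one_sub hA hζ), imq_smul_one_sub_isHermitian hA]
  exact mul_nonneg hζ.le (nsq_nonneg _)

theorem sub_smul_mul_gres {A : Matrix n n ℂ} (hA : A.IsHermitian) {ζ : ℂ} (hζ : 0 < ζ.im) :
    (A - ζ • 1) * gres A ζ = 1 := by
  rw [gres, Matrix.mul_neg, ← Matrix.neg_mul, neg_sub,
    Matrix.mul_nonsing_inv _ (isUnit_det_smul_one_sub hA hζ)]

variable {E : Type*} [NormedAddCommGroup E] [NormedSpace ℝ E]

/-- The derivative of the resolvent of a linearly parametrized matrix. -/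
def gresDeriv (X : E →L[ℝ] Matrix n n ℂ) (ζ : ℂ) (x : E) : E →L[ℝ] Matrix n n ℂ :=
  -((ContinuousLinearMap.mulLeftRight ℝ (Matrix n n ℂ) (gres (X x) ζ) (gres (X x) ζ)).comp X)

theorem gresDeriv_apply (X : E →L[ℝ] Matrix n n ℂ) (ζ : ℂ) (x v : E) :
    gresDeriv X ζ x v = -(gres (X x) ζ * X v * gres (X x) ζ) := by
  simp [gresDeriv]

theorem hasFDerivAt_gres {X : E →L[ℝ] Matrix n n ℂ} (hX : ∀ x, (X x).IsHermitian) {ζ : ℂ}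
    (hζ : 0 < ζ.im) (x : E) : HasFDerivAt (fun x => gres (X x) ζ) (gresDeriv X ζ x) x := by
  have hu : IsUnit (ζ • 1 - X x) :=
    (Matrix.isUnit_iff_isUnit_det _).2 (isUnit_det_smul_one_sub (hX x) hζ)
  obtain ⟨u, hu'⟩ := hu
  have h1 : HasFDerivAt (fun x => ζ • (1 : Matrix n n ℂ) - X x) (-X) x := by
    simpa using (X.hasFDerivAt (x := x)).const_sub (ζ • (1 : Matrix n n ℂ))
  have h2 := hasFDerivAt_ringInverse (𝕜 := ℝ) u
  rw [hu'] at h2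
  have h3 := (h2.comp x h1).neg
  have h4 : ((u⁻¹ : (Matrix n n ℂ)ˣ) : Matrix n n ℂ) = (ζ • 1 - X x)⁻¹ := by
    rw [Matrix.nonsing_inv_eq_ringInverse, ← hu', Ring.inverse_unit]
  have h5 : (fun x => gres (X x) ζ) = -(Ring.inverse ∘ fun x => ζ • (1 : Matrix n n ℂ) - X x) := by
    funext x
    simp [gres, Matrix.nonsing_inv_eq_ringInverse]
  rw [h5]
  refine h3.congr_fderiv ?_
  ext1 v
  rw [gresDeriv_apply]
  simp [h4, gres]

theorem continuous_gres {X : E →L[ℝ] Matrix n n ℂ} (hX : ∀ x, (X x).IsHermitian) {ζ : ℂ}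
    (hζ : 0 < ζ.im) : Continuous fun x => gres (X x) ζ :=
  continuous_iff_continuousAt.2 fun x => (hasFDerivAt_gres hX hζ x).continuousAt

theorem continuous_gresDeriv {X : E →L[ℝ] Matrix n n ℂ} (hX : ∀ x, (X x).IsHermitian) {ζ : ℂ}
    (hζ : 0 < ζ.im) : Continuous fun x => gresDeriv X ζ x := by
  have h := continuous_gres hX hζ
  unfold gresDeriv
  fun_prop

theorem norm_gresDeriv_le {X : E →L[ℝ] Matrix n n ℂ} (hX : ∀ x, (X x).IsHermitian) {ζ : ℂ}
    (hζ : 0 < ζ.im) (x : E) : ‖gresDeriv X ζ x‖ ≤ 1 / ζ.im * ‖X‖ * (1 / ζ.im) := by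
  refine ContinuousLinearMap.opNorm_le_bound _ (by positivity) fun v => ?_
  rw [gresDeriv_apply, norm_neg]
  have h1 := opNorm_gres_le (hX x) hζ
  calc ‖gres (X x) ζ * X v * gres (X x) ζ‖ ≤ ‖gres (X x) ζ‖ * ‖X v‖ * ‖gres (X x) ζ‖ :=
        (norm_mul_le _ _).trans (by gcongr; exact norm_mul_le _ _)
    _ ≤ (1 / ζ.im) * (‖X‖ * ‖v‖) * (1 / ζ.im) := by
        gcongr
        exact X.le_opNorm v
    _ = _ := by ring

variable [SecondCountableTopology E]
  [CompleteSpace E] [MeasurableSpace E] [BorelSpace E] {μ : Measure E} [IsGaussian μ]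

/-- The functional `B ↦ tr (C B)`. -/
def traceCLM (C : Matrix n n ℂ) : Matrix n n ℂ →L[ℂ] ℂ :=
  LinearMap.toContinuousLinearMap
    ((Matrix.traceLinearMap n ℂ ℂ).comp (LinearMap.mulLeft ℂ C))

/-- The functional `B ↦ Bᵢⱼ`. -/
def entryCLM (i j : n) : Matrix n n ℂ →L[ℂ] ℂ :=
  LinearMap.toContinuousLinearMap (Matrix.entryLinearMap ℂ ℂ i j)

/-- The derivative of tr(C G) in the direction y is -tr(G C G X(y)). Poincaré therefore reduces the
variance to the second moment `hv` at D = G C G, and hs(G C G) ≤ hs(C)/(Im ζ)². -/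
theorem variance_trace_gres_le (h0 : μ[id] = 0) {X : E →L[ℝ] Matrix n n ℂ}
    (hX : ∀ x, (X x).IsHermitian) {ζ : ℂ} (hζ : 0 < ζ.im) {v : ℝ} (hv0 : 0 ≤ v)
    (hv : ∀ D : Matrix n n ℂ, ∫ x, ‖(D * X x).trace‖ ^ 2 ∂μ ≤ v * hs D ^ 2) (C : Matrix n n ℂ) :
    ∫ x, ‖(C * gres (X x) ζ).trace - ∫ y, (C * gres (X y) ζ).trace ∂μ‖ ^ 2 ∂μ ≤
      Real.pi ^ 2 / 4 * (v * (1 / ζ.im) ^ 4 * hs C ^ 2) := by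
  let Λ := (traceCLM C).restrictScalars ℝ
  have hf : ∀ x, HasFDerivAt (fun x => Λ (gres (X x) ζ)) (Λ.comp (gresDeriv X ζ x)) x := fun x =>
    Λ.hasFDerivAt.comp x (hasFDerivAt_gres hX hζ x)
  have hf' : Continuous fun x => Λ.comp (gresDeriv X ζ x) :=
    continuous_const.clm_comp (continuous_gresDeriv hX hζ)
  have hB : ∀ x, ‖Λ (gres (X x) ζ)‖ ≤ ‖Λ‖ * (1 / ζ.im) := fun x =>
    (Λ.le_opNorm _).trans (by gcongr; exact opNorm_gres_le (hX x) hζ)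
  have hC : ∀ x, ‖Λ.comp (gresDeriv X ζ x)‖ ≤ ‖Λ‖ * (1 / ζ.im * ‖X‖ * (1 / ζ.im)) := fun x =>
    (ContinuousLinearMap.opNorm_comp_le _ _).trans
      (by gcongr; exact norm_gresDeriv_le hX hζ x)
  refine (gaussian_poincare h0 hf hf' hB hC).trans ?_
  gcongr
  have hev : Continuous fun p : E × E => (Λ.comp (gresDeriv X ζ p.1)) p.2 :=
    (hf'.comp continuous_fst).clm_apply continuous_snd
  have hi : Integrable (fun p : E × E => ‖(Λ.comp (gresDeriv X ζ p.1)) p.2‖ ^ 2) (μ.prod μ) := by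
    refine Integrable.mono' (integrable_sq_growth ((‖Λ‖ * (1 / ζ.im * ‖X‖ * (1 / ζ.im))) ^ 2))
      (Continuous.aestronglyMeasurable (by fun_prop)) (ae_of_all _ fun p => ?_)
    rw [Real.norm_of_nonneg (by positivity), ← mul_pow]
    refine pow_le_pow_left₀ (norm_nonneg _) ((ContinuousLinearMap.le_opNorm _ _).trans ?_) 2
    have h2 := norm_nonneg p.1
    have h3 := norm_nonneg p.2
    exact mul_le_mul (hC _) (by linarith) (norm_nonneg _) ((norm_nonneg _).trans (hC 0))
  rw [integral_prod _ hi]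
  have hpt : ∀ x, ∫ y, ‖(Λ.comp (gresDeriv X ζ x)) y‖ ^ 2 ∂μ ≤ v * (1 / ζ.im) ^ 4 * hs C ^ 2 := by
    intro x
    set G := gres (X x) ζ with hG
    have hGn : ‖G‖ ≤ 1 / ζ.im := opNorm_gres_le (hX x) hζ
    have h1 : ∀ y, (Λ.comp (gresDeriv X ζ x)) y = -((G * C * G) * X y).trace := fun y => by
      have e : (Λ.comp (gresDeriv X ζ x)) y = (C * gresDeriv X ζ x y).trace := rfl
      rw [e, gresDeriv_apply, Matrix.mul_neg, Matrix.trace_neg, neg_inj, ← hG,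
        Matrix.mul_assoc G (X y) G, ← Matrix.mul_assoc, Matrix.trace_mul_comm,
        Matrix.mul_assoc, Matrix.trace_mul_comm, ← Matrix.mul_assoc]
    simp only [h1, norm_neg]
    refine (hv _).trans ?_
    have h2 : hs (G * C * G) ≤ (1 / ζ.im) ^ 2 * hs C := by
      calc hs (G * C * G) ≤ hs (G * C) * ‖G‖ := hs_mul_le_mul_opNorm _ _
        _ ≤ (‖G‖ * hs C) * ‖G‖ := by gcongr; exact hs_mul_le_opNorm_mul _ _
        _ ≤ ((1 / ζ.im) * hs C) * (1 / ζ.im) := by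
            have := hs_nonneg C
            gcongr
        _ = _ := by ring
    have h3 := pow_le_pow_left₀ (hs_nonneg _) h2 2
    calc v * hs (G * C * G) ^ 2 ≤ v * ((1 / ζ.im) ^ 2 * hs C) ^ 2 := by gcongr
      _ = _ := by ring
  refine (integral_mono_of_nonneg (ae_of_all _ fun x => integral_nonneg fun y => by positivity)
    (integrable_const _) (ae_of_all _ hpt)).trans ?_
  simp

theorem integrable_gres_entry {X : E →L[ℝ] Matrix n n ℂ}
    (hX : ∀ x, (X x).IsHermitian) {ζ : ℂ} (hζ : 0 < ζ.im) (i j : n) :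
    Integrable (fun x => gres (X x) ζ i j) μ := by
  refine Integrable.of_bound ?_ (1 / ζ.im)
    (ae_of_all _ fun x => (norm_entry_le _ i j).trans (opNorm_gres_le (hX x) hζ))
  exact ((entryCLM i j).continuous.comp (continuous_gres hX hζ)).aestronglyMeasurable

/-- The Schwinger–Dyson equation for the resolvent of a Gaussian Hermitian matrix. -/
theorem schwinger_dyson (h0 : μ[id] = 0) {X : E →L[ℝ] Matrix n n ℂ}
    (hX : ∀ x, (X x).IsHermitian) {ζ : ℂ} (hζ : 0 < ζ.im)
    {η : Matrix n n ℂ → Matrix n n ℂ}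
    (hη : ∀ B i j, ∫ x, (X x * B * X x) i j ∂μ = η B i j) (i j : n) :
    (1 : Matrix n n ℂ) i j + ζ * ∫ x, gres (X x) ζ i j ∂μ +
      ∫ x, (η (gres (X x) ζ) * gres (X x) ζ) i j ∂μ = 0 := by
  have hXn : ∀ v i j, ‖X v i j‖ ≤ ‖X‖ * ‖v‖ := fun v i j =>
    (norm_entry_le _ i j).trans (X.le_opNorm v)
  have hXc : ∀ i j, Continuous fun v => X v i j := fun i j =>
    (entryCLM i j).continuous.comp X.continuous
  have hGc := continuous_gres hX hζ
  -- Integration by parts, one term of the product X G at a time; the second coordinate p.2 is an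
  -- independent copy giving the direction of differentiation.
  have hl : ∀ k, ∫ x, X x i k * gres (X x) ζ k j ∂μ =
      ∫ p : E × E, X p.2 i k * gresDeriv X ζ p.1 p.2 k j ∂(μ.prod μ) := fun k => by
    let Λ := (entryCLM k j).restrictScalars ℝ
    have hf : ∀ x, HasFDerivAt (fun x => Λ (gres (X x) ζ)) (Λ.comp (gresDeriv X ζ x)) x :=
      fun x => Λ.hasFDerivAt.comp x (hasFDerivAt_gres hX hζ x)
    have hf' : Continuous fun x => Λ.comp (gresDeriv X ζ x) :=
      continuous_const.clm_comp (continuous_gresDeriv hX hζ)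
    have hB : ∀ x, ‖Λ (gres (X x) ζ)‖ ≤ ‖Λ‖ * (1 / ζ.im) := fun x =>
      (Λ.le_opNorm _).trans (by gcongr; exact opNorm_gres_le (hX x) hζ)
    have hC : ∀ x, ‖Λ.comp (gresDeriv X ζ x)‖ ≤ ‖Λ‖ * (1 / ζ.im * ‖X‖ * (1 / ζ.im)) := fun x =>
      (ContinuousLinearMap.opNorm_comp_le _ _).trans
        (by gcongr; exact norm_gresDeriv_le hX hζ x)
    exact gaussian_integral_mul h0 hf hf' hB hC
      (((entryCLM i k).restrictScalars ℝ).comp X)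
  have hgd : Continuous fun p : E × E => gresDeriv X ζ p.1 p.2 :=
    ((continuous_gresDeriv hX hζ).comp continuous_fst).clm_apply continuous_snd
  have hi2 : ∀ k, Integrable (fun p : E × E => X p.2 i k * gresDeriv X ζ p.1 p.2 k j)
      (μ.prod μ) := fun k => by
    refine Integrable.mono' (integrable_sq_growth (‖X‖ * (1 / ζ.im * ‖X‖ * (1 / ζ.im))))
      (Continuous.aestronglyMeasurable ?_) (ae_of_all _ fun p => ?_)
    · exact ((hXc i k).comp continuous_snd).mul ((entryCLM k j).continuous.comp hgd)
    · rw [norm_mul]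
      have h1 : ‖gresDeriv X ζ p.1 p.2 k j‖ ≤ (1 / ζ.im * ‖X‖ * (1 / ζ.im)) * ‖p.2‖ :=
        (norm_entry_le _ k j).trans ((ContinuousLinearMap.le_opNorm _ _).trans
          (by gcongr; exact norm_gresDeriv_le hX hζ _))
      have h2 := norm_nonneg p.1
      have h3 := norm_nonneg p.2
      calc _ ≤ (‖X‖ * ‖p.2‖) * ((1 / ζ.im * ‖X‖ * (1 / ζ.im)) * ‖p.2‖) :=
            mul_le_mul (hXn _ _ _) h1 (norm_nonneg _) (by positivity)
        _ = (‖X‖ * (1 / ζ.im * ‖X‖ * (1 / ζ.im))) * ‖p.2‖ ^ 2 := by ring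
        _ ≤ _ := by gcongr; linarith
  have hi1 : ∀ k, Integrable (fun x => X x i k * gres (X x) ζ k j) μ := fun k => by
    have h1 : Integrable (fun x : E => ‖X‖ * ‖x‖ * (1 / ζ.im)) μ :=
      ((IsGaussian.integrable_id (μ := μ)).norm.const_mul _).mul_const _
    refine Integrable.mono' h1 (Continuous.aestronglyMeasurable ?_) (ae_of_all _ fun x => ?_)
    · exact (hXc i k).mul ((entryCLM k j).continuous.comp hGc)
    · rw [norm_mul]
      exact mul_le_mul (hXn _ _ _) ((norm_entry_le _ k j).trans (opNorm_gres_le (hX x) hζ))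
        (norm_nonneg _) (by positivity)
  have hmain : ∫ x, (X x * gres (X x) ζ) i j ∂μ =
      -∫ x, (η (gres (X x) ζ) * gres (X x) ζ) i j ∂μ := by
    simp only [Matrix.mul_apply (M := X _)]
    rw [integral_finsetSum _ fun k _ => hi1 k, Finset.sum_congr rfl fun k _ => hl k,
      ← integral_finsetSum _ fun k _ => hi2 k,
      integral_prod _ (integrable_finsetSum _ fun k _ => hi2 k), ← integral_neg]
    congr 1
    funext x
    -- With x frozen, the independent copy y enters only through X(y) G X(y), whose mean is η(G).
    have e1 : ∀ y, ∑ k, X y i k * gresDeriv X ζ x y k j =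
        -∑ b, (X y * gres (X x) ζ * X y) i b * gres (X x) ζ b j := fun y => by
      have : ∑ k, X y i k * gresDeriv X ζ x y k j = (X y * gresDeriv X ζ x y) i j :=
        (Matrix.mul_apply).symm
      rw [this, gresDeriv_apply, Matrix.mul_neg, Matrix.neg_apply, neg_inj, ← Matrix.mul_apply]
      simp only [Matrix.mul_assoc]
    simp only [e1]
    rw [integral_neg, integral_finsetSum, Matrix.mul_apply]
    · simp only [integral_mul_const, hη]
    · intro b _
      refine Integrable.mul_const ?_ _
      have h1 : Integrable (fun y : E => (‖X‖ * ‖gres (X x) ζ‖ * ‖X‖) * ‖y‖ ^ 2) μ :=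
        (IsGaussian.memLp_two_id (μ := μ)).norm.integrable_sq.const_mul _
      refine Integrable.mono' h1 (Continuous.aestronglyMeasurable ?_) (ae_of_all _ fun y => ?_)
      · have hc : Continuous fun y => X y * gres (X x) ζ * X y :=
          (X.continuous.mul continuous_const).mul X.continuous
        exact (entryCLM i b).continuous.comp hc
      · refine (norm_entry_le _ i b).trans ?_
        calc ‖X y * gres (X x) ζ * X y‖ ≤ ‖X y‖ * ‖gres (X x) ζ‖ * ‖X y‖ :=
              (norm_mul_le _ _).trans (by gcongr; exact norm_mul_le _ _)
          _ ≤ (‖X‖ * ‖y‖) * ‖gres (X x) ζ‖ * (‖X‖ * ‖y‖) := by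
              have := X.le_opNorm y
              gcongr
          _ = _ := by ring
  have hres : ∀ x, (X x * gres (X x) ζ) i j = (1 : Matrix n n ℂ) i j + ζ * gres (X x) ζ i j :=
    fun x => by
      have h := congrFun (congrFun (sub_smul_mul_gres (hX x) hζ) i) j
      rw [Matrix.sub_mul, Matrix.smul_mul, Matrix.one_mul] at h
      simp only [Matrix.sub_apply, Matrix.smul_apply, smul_eq_mul] at h
      linear_combination h
  simp only [hres] at hmain
  rw [integral_add (integrable_const _) ((integrable_gres_entry hX hζ i j).const_mul ζ),
    integral_const_mul] at hmain
  simp only [integral_const, probReal_univ, one_smul] at hmain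
  linear_combination hmain

end GaussianResolvent

/-! ### Stability of the canonical equation -/

section Stability

variable {p q κ : Type*} [Fintype p] [Fintype q] [Fintype κ] [DecidableEq p] [DecidableEq q]

/-- `-(ζ + B)⁻¹`. -/
def negInv (ζ : ℂ) (B : Matrix p p ℂ) : Matrix p p ℂ := -(ζ • 1 + B)⁻¹

theorem le_imq_smul_one_add {ζ : ℂ} {B : Matrix p p ℂ} (hB : ∀ x, 0 ≤ imq B x) (x : p → ℂ) :
    ζ.im * nsq x ≤ imq (ζ • 1 + B) x := by
  rw [imq_add, imq_smul_one]
  linarith [hB x]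

theorem isUnit_det_smul_one_add {ζ : ℂ} (hζ : 0 < ζ.im) {B : Matrix p p ℂ}
    (hB : ∀ x, 0 ≤ imq B x) : IsUnit (ζ • 1 + B).det :=
  isUnit_det_of_dissipative hζ (le_imq_smul_one_add hB)

theorem opNorm_negInv_le {ζ : ℂ} (hζ : 0 < ζ.im) {B : Matrix p p ℂ} (hB : ∀ x, 0 ≤ imq B x) :
    ‖negInv ζ B‖ ≤ 1 / ζ.im := by
  rw [negInv, norm_neg]
  exact opNorm_inv_le_of_dissipative hζ (le_imq_smul_one_add hB)

theorem imq_negInv_left {ζ : ℂ} (hζ : 0 < ζ.im) {B : Matrix p p ℂ} (hB : ∀ x, 0 ≤ imq B x)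
    (x : p → ℂ) : imq (negInv ζ B) x =
      ζ.im * nsq ((negInv ζ B)ᴴ *ᵥ x) + imq B ((negInv ζ B)ᴴ *ᵥ x) := by
  rw [negInv, imq_neg_inv_left (isUnit_det_smul_one_add hζ hB), imq_add, imq_smul_one]

theorem imq_negInv_right {ζ : ℂ} (hζ : 0 < ζ.im) {B : Matrix p p ℂ} (hB : ∀ x, 0 ≤ imq B x)
    (x : p → ℂ) : imq (negInv ζ B) x =
      ζ.im * nsq (negInv ζ B *ᵥ x) + imq B (negInv ζ B *ᵥ x) := by
  rw [negInv, imq_neg_inv_right (isUnit_det_smul_one_add hζ hB), imq_add, imq_smul_one]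

theorem imq_negInv_nonneg {ζ : ℂ} (hζ : 0 < ζ.im) {B : Matrix p p ℂ} (hB : ∀ x, 0 ≤ imq B x)
    (x : p → ℂ) : 0 ≤ imq (negInv ζ B) x := by
  rw [imq_negInv_left hζ hB]
  exact add_nonneg (mul_nonneg hζ.le (nsq_nonneg _)) (hB _)

theorem smul_one_add_mul_negInv {ζ : ℂ} (hζ : 0 < ζ.im) {B : Matrix p p ℂ}
    (hB : ∀ x, 0 ≤ imq B x) : (ζ • 1 + B) * negInv ζ B = -1 := by
  rw [negInv, Matrix.mul_neg, Matrix.mul_nonsing_inv _ (isUnit_det_smul_one_add hζ hB)]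

theorem negInv_mul_smul_one_add {ζ : ℂ} (hζ : 0 < ζ.im) {B : Matrix p p ℂ}
    (hB : ∀ x, 0 ≤ imq B x) : negInv ζ B * (ζ • 1 + B) = -1 := by
  rw [negInv, Matrix.neg_mul, Matrix.nonsing_inv_mul _ (isUnit_det_smul_one_add hζ hB)]

theorem negInv_sub_negInv {ζ : ℂ} (hζ : 0 < ζ.im) {B C : Matrix p p ℂ}
    (hB : ∀ x, 0 ≤ imq B x) (hC : ∀ x, 0 ≤ imq C x) :
    negInv ζ B - negInv ζ C = negInv ζ B * (B - C) * negInv ζ C := by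
  have h1 := negInv_mul_smul_one_add hζ hB
  have h2 := smul_one_add_mul_negInv hζ hC
  have h3 : B - C = (ζ • 1 + B) - (ζ • 1 + C) := by abel
  rw [h3, Matrix.mul_sub, Matrix.sub_mul, h1, Matrix.mul_assoc, h2]
  simp [add_comm, sub_eq_add_neg]

omit [DecidableEq p] [DecidableEq q] in
theorem imq_kmap_nonneg (A : κ → Matrix p q ℂ) {B : Matrix q q ℂ} (hB : ∀ x, 0 ≤ imq B x)
    (x : p → ℂ) : 0 ≤ imq (kmap A B) x := by
  rw [imq_kmap]
  exact Finset.sum_nonneg fun _ _ => hB _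

omit [DecidableEq p] in
theorem sum_imq_le {A : κ → Matrix p q ℂ} {s : ℝ} (hA : KrausBound A s) {B : Matrix q q ℂ}
    {c : ℝ} (hc : 0 ≤ c) (hB : ‖B‖ ≤ c) (x : p → ℂ) :
    ∑ k, imq B ((A k)ᴴ *ᵥ x) ≤ s * c * nsq x := by
  calc ∑ k, imq B ((A k)ᴴ *ᵥ x) ≤ ∑ k, c * nsq ((A k)ᴴ *ᵥ x) :=
        Finset.sum_le_sum fun k _ => ((le_abs_self _).trans (imq_le _ _)).trans
          (mul_le_mul_of_nonneg_right hB (nsq_nonneg _))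
    _ = c * ∑ k, nsq ((A k)ᴴ *ᵥ x) := by rw [Finset.mul_sum]
    _ ≤ c * (s * nsq x) := by gcongr; exact hA x
    _ = _ := by ring

theorem le_of_forall_pow_le {a b c ρ : ℝ} (h0 : 0 ≤ ρ) (h1 : ρ < 1)
    (h : ∀ n : ℕ, a ≤ b + c * ρ ^ n) : a ≤ b := by
  have h2 : Tendsto (fun n : ℕ => b + c * ρ ^ n) atTop (𝓝 (b + c * 0)) :=
    ((tendsto_pow_atTop_nhds_zero_of_lt_one h0 h1).const_mul c).const_add b
  have := ge_of_tendsto' h2 h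
  simpa using this

/-- Stability of the canonical equation: if `F` is close enough to the image `R` of `F` under the
two steps of the equation, then it is close to any solution `T`, in the weak sense in which it is
close to `R`. -/
theorem norm_trace_mul_sub_le {A : κ → Matrix p q ℂ} {s : ℝ} (hs : 0 < s) (hA : KrausBound A s)
    (hA' : KrausBound (adj A) s) {ζ : ℂ} (hζ : 0 < ζ.im) {T F R : Matrix p p ℂ}
    {T' R' : Matrix q q ℂ} (hT0 : ∀ x, 0 ≤ imq T x) (hT0' : ∀ x, 0 ≤ imq T' x)
    (hF0 : ∀ x, 0 ≤ imq F x) (hT : T = negInv ζ (kmap A T')) (hT' : T' = negInv ζ (kmap (adj A) T))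
    (hR' : R' = negInv ζ (kmap (adj A) F)) (hR : R = negInv ζ (kmap A R'))
    (hsmall : ∀ x, |imq (kmap (adj A) (F - R)) x| ≤ ζ.im / 2 * nsq x)
    {ε : ℝ} (hε : 0 ≤ ε) (hE : ∀ C : Matrix p p ℂ, ‖(C * (F - R)).trace‖ ≤ ε * ‖C‖)
    (B : Matrix p p ℂ) :
    ‖(B * (F - T)).trace‖ ≤ ε * ‖B‖ * (1 + 2 * s ^ 2 / ζ.im ^ 4) := by
  set y := ζ.im with hy
  -- Only half of Im ζ is kept for the contraction; the other half pays for the presence of F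
  -- instead of R in the equation defining R'.
  set θ := y / 2 with hθ
  set σ := s * (1 / y) with hσ
  have hθ0 : 0 < θ := by positivity
  have hσ0 : 0 < σ := by positivity
  set ρ := σ / (θ + σ) with hρ
  have hρ0 : 0 ≤ ρ := by positivity
  have hρ1 : ρ < 1 := by rw [hρ, div_lt_one (by positivity)]; linarith
  have hR0' : ∀ x, 0 ≤ imq R' x := fun x => by
    rw [hR']; exact imq_negInv_nonneg hζ (imq_kmap_nonneg _ hF0) x
  have hR0 : ∀ x, 0 ≤ imq R x := fun x => by
    rw [hR]; exact imq_negInv_nonneg hζ (imq_kmap_nonneg _ hR0') x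
  have hTn : ‖T‖ ≤ 1 / y := by rw [hT]; exact opNorm_negInv_le hζ (imq_kmap_nonneg _ hT0')
  have hTn' : ‖T'‖ ≤ 1 / y := by rw [hT']; exact opNorm_negInv_le hζ (imq_kmap_nonneg _ hT0)
  have hRn : ‖R‖ ≤ 1 / y := by rw [hR]; exact opNorm_negInv_le hζ (imq_kmap_nonneg _ hR0')
  have hRn' : ‖R'‖ ≤ 1 / y := by rw [hR']; exact opNorm_negInv_le hζ (imq_kmap_nonneg _ hF0)
  have hy0 : 0 ≤ 1 / y := by positivity
  -- Composed with `kmap A`, this is the adjoint of the linear map that sends F - T to R - T. Its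
  -- iterates on B are the coefficients of the Neumann series.
  let Φ : Matrix p p ℂ → Matrix q q ℂ := fun C => T' * kmap (adj A) (T * C * R) * R'
  let a : ℕ → Matrix p p ℂ := fun n => (fun C => kmap A (Φ C))^[n] B
  have ha : ∀ n, a (n + 1) = kmap A (Φ (a n)) := fun n => Function.iterate_succ_apply' _ _ _
  have st1 : ∀ C c, 0 ≤ c → Dom (T * C * R) (imq T) (imq R) c →
      Dom (Φ C) (imq T') (imq R') (ρ * c) := fun C c hc h => by
    refine h.step hc hT0 hR0 (adj A) hθ0 hσ0 (sum_imq_le hA' hy0 hTn) (sum_imq_le hA' hy0 hRn)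
      (fun x => ?_) (fun x => ?_)
    · rw [← imq_kmap]
      have h1 := imq_negInv_left hζ (imq_kmap_nonneg (adj A) hT0) x
      rw [← hT'] at h1
      have h2 := mul_nonneg hθ0.le (nsq_nonneg (T'ᴴ *ᵥ x))
      have h3 : y = θ + θ := by rw [hθ]; ring
      rw [h1, ← hy, h3]
      linarith
    · rw [← imq_kmap]
      have h1 := imq_negInv_right hζ (imq_kmap_nonneg (adj A) hF0) x
      rw [← hR'] at h1
      -- The identity for Im R' involves Im F, but the weight carried by the iteration is Im R. The
      -- exchange costs at most θ times the squared norm of R' x.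
      have h2 := hsmall (R' *ᵥ x)
      have h4 : imq (kmap (adj A) F) (R' *ᵥ x) =
          imq (kmap (adj A) (F - R)) (R' *ᵥ x) + imq (kmap (adj A) R) (R' *ᵥ x) := by
        rw [← imq_add, ← kmap_add, sub_add_cancel]
      have h3 : y = θ + θ := by rw [hθ]; ring
      have h5 := (abs_le.1 h2).1
      rw [h1, h4, ← hy, h3]
      linarith
  have st2 : ∀ D c, 0 ≤ c → Dom D (imq T') (imq R') c →
      Dom (T * kmap A D * R) (imq T) (imq R) (ρ * c) := fun D c hc h => by
    refine h.step hc hT0' hR0' A hθ0 hσ0 (sum_imq_le hA hy0 hTn') (sum_imq_le hA hy0 hRn')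
      (fun x => ?_) (fun x => ?_)
    · rw [← imq_kmap]
      have h1 := imq_negInv_left hζ (imq_kmap_nonneg A hT0') x
      rw [← hT] at h1
      have h2 := mul_nonneg hθ0.le (nsq_nonneg (Tᴴ *ᵥ x))
      have h3 : y = θ + θ := by rw [hθ]; ring
      rw [h1, ← hy, h3]
      linarith
    · rw [← imq_kmap]
      have h1 := imq_negInv_right hζ (imq_kmap_nonneg A hR0') x
      rw [← hR] at h1
      have h2 := mul_nonneg hθ0.le (nsq_nonneg (R *ᵥ x))
      have h3 : y = θ + θ := by rw [hθ]; ring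
      rw [h1, ← hy, h3]
      linarith
  -- Initial bound: as forms, Im T dominates y T Tᴴ and Im R dominates y Rᴴ R.
  have st0 : Dom (T * B * R) (imq T) (imq R) (‖B‖ * (1 / y)) := fun x z => by
    rw [star_dotProduct_mul_mul]
    refine (norm_bilin_le _ _ _).trans ?_
    have h1 := imq_negInv_left hζ (imq_kmap_nonneg A hT0') x
    rw [← hT] at h1
    have h2 := imq_negInv_right hζ (imq_kmap_nonneg A hR0') z
    rw [← hR] at h2
    have h3 : nsq (Tᴴ *ᵥ x) ≤ 1 / y * imq T x := by
      rw [h1, one_div, inv_mul_eq_div, le_div_iff₀ hζ]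
      linarith [imq_kmap_nonneg A hT0' (Tᴴ *ᵥ x), mul_comm y (nsq (Tᴴ *ᵥ x))]
    have h4 : nsq (R *ᵥ z) ≤ 1 / y * imq R z := by
      rw [h2, one_div, inv_mul_eq_div, le_div_iff₀ hζ]
      linarith [imq_kmap_nonneg A hR0' (R *ᵥ z), mul_comm y (nsq (R *ᵥ z))]
    have h5 := Real.sqrt_le_sqrt h3
    have h6 := Real.sqrt_le_sqrt h4
    rw [Real.sqrt_mul hy0] at h5 h6
    calc _ ≤ ‖B‖ * (√(1 / y) * √(imq T x)) * (√(1 / y) * √(imq R z)) := by gcongr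
      _ = ‖B‖ * (√(1 / y) * √(1 / y)) * √(imq T x) * √(imq R z) := by ring
      _ = _ := by rw [Real.mul_self_sqrt hy0]
  -- A full step gains ρ²; keeping only one factor ρ suffices for summability.
  have hdom : ∀ n, Dom (T * a n * R) (imq T) (imq R) (‖B‖ * (1 / y) * ρ ^ n) := fun n => by
    induction n with
    | zero => simpa [a] using st0
    | succ n ih =>
      rw [ha]
      have h1 := st2 _ _ (by positivity) (st1 _ _ (by positivity) ih)
      intro x z
      refine (h1 x z).trans ?_
      have : ρ * (ρ * (‖B‖ * (1 / y) * ρ ^ n)) ≤ ‖B‖ * (1 / y) * ρ ^ (n + 1) := by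
        rw [pow_succ]
        have h2 : 0 ≤ ‖B‖ * (1 / y) * ρ ^ n * ρ := by positivity
        calc _ = ρ * (‖B‖ * (1 / y) * ρ ^ n * ρ) := by ring
          _ ≤ 1 * (‖B‖ * (1 / y) * ρ ^ n * ρ) := by gcongr
          _ = _ := by ring
      gcongr
  have hnorm : ∀ n, ‖a (n + 1)‖ ≤ σ * ρ * (‖B‖ * (1 / y)) * ρ ^ n := fun n => by
    have h1 := st1 _ _ (by positivity) (hdom n)
    rw [ha]
    refine opNorm_le_of_bilin (by positivity) fun x z => ?_
    refine (h1.kmap (by positivity) hT0' hR0' A x z).trans ?_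
    have h2 := Real.sqrt_le_sqrt (sum_imq_le hA hy0 hTn' x)
    have h3 := Real.sqrt_le_sqrt (sum_imq_le hA hy0 hRn' z)
    rw [← hσ, Real.sqrt_mul hσ0.le] at h2 h3
    calc _ ≤ (ρ * (‖B‖ * (1 / y) * ρ ^ n)) * (√σ * √(nsq x)) * (√σ * √(nsq z)) := by gcongr
      _ = (√σ * √σ) * (ρ * (‖B‖ * (1 / y) * ρ ^ n)) * √(nsq x) * √(nsq z) := by ring
      _ = _ := by rw [Real.mul_self_sqrt hσ0.le]; ring
  -- R - T is linear in F - T through two resolvent identities, one for R' - T' and one for R - T.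
  -- Moving these maps onto the test matrix replaces a n by a (n + 1).
  have hid : ∀ n, (a n * (F - T)).trace = (a n * (F - R)).trace + (a (n + 1) * (F - T)).trace := by
    intro n
    have h1 : F - T = (F - R) + R * kmap A (R' * kmap (adj A) (F - T) * T') * T := by
      have e1 : R' - T' = R' * kmap (adj A) (F - T) * T' := by
        have := negInv_sub_negInv hζ (imq_kmap_nonneg (adj A) hF0) (imq_kmap_nonneg (adj A) hT0)
        rwa [← hR', ← hT', ← kmap_sub] at this
      have e2 : R - T = R * kmap A (R' - T') * T := by
        have := negInv_sub_negInv hζ (imq_kmap_nonneg A hR0') (imq_kmap_nonneg A hT0')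
        rwa [← hR, ← hT, ← kmap_sub] at this
      rw [← e1, ← e2]
      abel
    have h2 : (a (n + 1) * (F - T)).trace =
        (a n * (R * kmap A (R' * kmap (adj A) (F - T) * T') * T)).trace := by
      have e3 : (a n * (R * kmap A (R' * kmap (adj A) (F - T) * T') * T)).trace =
          ((T * a n * R) * kmap A (R' * kmap (adj A) (F - T) * T')).trace := by
        rw [← Matrix.mul_assoc, Matrix.trace_mul_comm]
        simp only [Matrix.mul_assoc]
      have e4 : (kmap (adj A) (T * a n * R) * (R' * kmap (adj A) (F - T) * T')).trace =
          (Φ (a n) * kmap (adj A) (F - T)).trace := by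
        rw [← Matrix.mul_assoc, Matrix.trace_mul_comm]
        simp only [Φ, Matrix.mul_assoc]
      have e5 := trace_mul_kmap (adj A) (Φ (a n)) (F - T)
      have e6 : adj (adj A) = A := by funext k; simp [adj]
      rw [e3, trace_mul_kmap, e4, e5, e6, ha]
    conv_lhs => rw [h1]
    rw [h2, Matrix.mul_add, Matrix.trace_add]
  have hsum : ∀ n, (B * (F - T)).trace =
      (∑ j ∈ Finset.range n, (a j * (F - R)).trace) + (a n * (F - T)).trace := fun n => by
    induction n with
    | zero => simp [a]
    | succ n ih => rw [ih, hid n, Finset.sum_range_succ]; ring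
  -- The right-hand side is 1/(1 - ρ). Multiplied by σρ/y it equals σ²/(yθ) = 2s²/y⁴, the second
  -- term of the final constant.
  have hgeo : ∀ n : ℕ, ∑ j ∈ Finset.range n, ρ ^ j ≤ (θ + σ) / θ := fun n => by
    have h1 : (1 - ρ) * ∑ j ∈ Finset.range n, ρ ^ j = 1 - ρ ^ n := mul_neg_geom_sum ρ n
    have h2 : 1 - ρ = θ / (θ + σ) := by rw [hρ]; field_simp; ring
    rw [h2, div_mul_eq_mul_div, div_eq_iff (by positivity)] at h1
    rw [le_div_iff₀ hθ0]
    have h3 : (1 - ρ ^ n) * (θ + σ) ≤ 1 * (θ + σ) := by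
      have : 0 ≤ ρ ^ n := by positivity
      gcongr
      linarith
    linarith
  -- The remainder carries a factor depending on the dimension, which is harmless because it is
  -- multiplied by ρⁿ and n is sent to infinity.
  refine le_of_forall_pow_le (c := Fintype.card p * ((σ * ρ * (‖B‖ * (1 / y))) * ‖F - T‖))
    hρ0 hρ1 fun n => ?_
  rw [hsum (n + 1)]
  refine (norm_add_le _ _).trans (add_le_add ?_ ?_)
  · rw [Finset.sum_range_succ']
    calc ‖(∑ j ∈ Finset.range n, (a (j + 1) * (F - R)).trace) + (a 0 * (F - R)).trace‖
        ≤ (∑ j ∈ Finset.range n, ε * (σ * ρ * (‖B‖ * (1 / y)) * ρ ^ j)) + ε * ‖B‖ := by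
          refine (norm_add_le _ _).trans (add_le_add ((norm_sum_le _ _).trans
            (Finset.sum_le_sum fun j _ => (hE _).trans ?_)) (hE _))
          gcongr
          exact hnorm j
      _ = ε * (σ * ρ * (‖B‖ * (1 / y))) * (∑ j ∈ Finset.range n, ρ ^ j) + ε * ‖B‖ := by
          rw [Finset.mul_sum]
          congr 1
          exact Finset.sum_congr rfl fun j _ => by ring
      _ ≤ ε * (σ * ρ * (‖B‖ * (1 / y))) * ((θ + σ) / θ) + ε * ‖B‖ := by
          gcongr
          exact hgeo n
      _ = ε * ‖B‖ * (1 + 2 * s ^ 2 / y ^ 4) := by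
          rw [hρ, hσ, hθ]
          field_simp
          ring
  · refine (norm_trace_mul_le_opNorm _ _).trans ?_
    calc _ ≤ (Fintype.card p : ℝ) * ((σ * ρ * (‖B‖ * (1 / y)) * ρ ^ n) * ‖F - T‖) := by
          gcongr
          exact hnorm n
      _ = _ := by ring

end Stability

/-! ### Toeplitz matrices of correlation sequences -/

section Toeplitz

/-- The Toeplitz matrix with entries `r (i - j)`. -/
def toep (r : ℤ → ℂ) (K : ℕ) : Matrix (Fin K) (Fin K) ℂ :=
  Matrix.of fun i j => r ((i : ℤ) - (j : ℤ))

/-- The form is the integral of S against the squared modulus of a trigonometric polynomial. Bounds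
on the density thus become bounds on Toeplitz forms that do not depend on the size. -/
theorem toep_quad {S : ℝ → ℝ} (hS : IntervalIntegrable S volume 0 1) {K : ℕ} (x : Fin K → ℂ) :
    star x ⬝ᵥ (toep (corr S) K *ᵥ x) =
      ((∫ ν in (0 : ℝ)..1, S ν *
        ‖∑ i, star (x i) * Complex.exp (2 * Real.pi * Complex.I * ν * (i : ℕ))‖ ^ 2 : ℝ) : ℂ) := by
  have hSc : IntervalIntegrable (fun ν => (S ν : ℂ)) volume 0 1 := ⟨hS.1.ofReal, hS.2.ofReal⟩
  have hi : ∀ i j : Fin K, IntervalIntegrable (fun ν : ℝ => star (x i) *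
      ((S ν : ℂ) * Complex.exp (2 * Real.pi * Complex.I * ν * (((i : ℤ) - (j : ℤ) : ℤ) : ℂ))) * x j)
      volume 0 1 := fun i j => by
    refine IntervalIntegrable.mul_const (IntervalIntegrable.const_mul ?_ _) _
    exact hSc.mul_continuousOn (Continuous.continuousOn (by fun_prop))
  rw [← intervalIntegral.integral_ofReal]
  have h1 : star x ⬝ᵥ (toep (corr S) K *ᵥ x) = ∫ ν in (0 : ℝ)..1, ∑ i : Fin K, ∑ j : Fin K, star (x i) *
      ((S ν : ℂ) * Complex.exp (2 * Real.pi * Complex.I * ν * (((i : ℤ) - (j : ℤ) : ℤ) : ℂ))) *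
        x j := by
    rw [intervalIntegral.integral_finsetSum fun i _ => by
      have := IntervalIntegrable.sum Finset.univ fun j _ => hi i j
      refine this.congr fun ν _ => ?_
      simp only [Finset.sum_apply]]
    simp only [dotProduct, Matrix.mulVec, toep, Matrix.of_apply, corr, Pi.star_apply,
      Finset.mul_sum]
    refine Finset.sum_congr rfl fun i _ => ?_
    rw [intervalIntegral.integral_finsetSum fun j _ => hi i j]
    refine Finset.sum_congr rfl fun j _ => ?_
    rw [intervalIntegral.integral_mul_const, intervalIntegral.integral_const_mul,
      ← mul_assoc (star (x i))]
  rw [h1]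
  congr 1
  funext ν
  push_cast
  rw [← Complex.mul_conj', map_sum, Finset.sum_mul_sum, Finset.mul_sum]
  refine Finset.sum_congr rfl fun i _ => ?_
  rw [Finset.mul_sum]
  refine Finset.sum_congr rfl fun j _ => ?_
  have h2 : Complex.exp (2 * Real.pi * Complex.I * ν * ((i : ℂ) - (j : ℂ))) =
      Complex.exp (2 * Real.pi * Complex.I * ν * (i : ℕ)) *
        (starRingEnd ℂ) (Complex.exp (2 * Real.pi * Complex.I * ν * (j : ℕ))) := by
    rw [← Complex.exp_conj, ← Complex.exp_add]
    congr 1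
    simp only [map_mul, Complex.conj_ofReal, Complex.conj_I, Complex.conj_natCast, map_ofNat]
    ring
  simp only [Int.cast_natCast, h2, map_mul, RCLike.star_def, Complex.conj_conj]
  ring

theorem corr_one (k : ℤ) : corr (fun _ => 1) k = if k = 0 then 1 else 0 := by
  unfold corr
  split_ifs with hk
  · simp [hk]
  · have h1 : ∀ ν : ℝ, ((1 : ℝ) : ℂ) * Complex.exp (2 * Real.pi * Complex.I * ν * k) =
        Complex.exp ((2 * Real.pi * Complex.I * k) * ν) := fun ν => by
      rw [Complex.ofReal_one, one_mul]; congr 1; ring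
    have h2 : (2 * Real.pi * Complex.I * k : ℂ) ≠ 0 := by
      simp [Real.pi_ne_zero, Complex.I_ne_zero, hk]
    simp only [h1]
    rw [integral_exp_mul_complex h2]
    have h3 : Complex.exp (2 * Real.pi * Complex.I * k * ((1 : ℝ) : ℂ)) = 1 := by
      rw [Complex.ofReal_one, mul_one, show (2 * Real.pi * Complex.I * k : ℂ) =
        k * (2 * Real.pi * Complex.I) by ring]
      exact Complex.exp_int_mul_two_pi_mul_I k
    rw [h3]
    simp

theorem toep_corr_one (K : ℕ) : toep (corr fun _ => 1) K = 1 := by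
  ext i j
  simp only [toep, Matrix.of_apply, corr_one, Matrix.one_apply]
  congr 1
  rw [sub_eq_zero, Fin.ext_iff]
  norm_cast

/-- Parseval, read off from the constant density 1, whose Toeplitz matrix is the identity. -/
theorem integral_norm_sq_trig {K : ℕ} (x : Fin K → ℂ) : ∫ ν in (0 : ℝ)..1,
    ‖∑ i, star (x i) * Complex.exp (2 * Real.pi * Complex.I * ν * (i : ℕ))‖ ^ 2 = nsq x := by
  have h := toep_quad (S := fun _ => 1) intervalIntegrable_const x
  rw [toep_corr_one, Matrix.one_mulVec, star_dotProduct_self] at h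
  simp only [one_mul] at h
  exact (Complex.ofReal_injective h).symm

variable {S : ℝ → ℝ} {b : ℝ}

theorem toep_quad_le (hS : IntervalIntegrable S volume 0 1)
    (hb : ∀ ν ∈ Set.Icc (0 : ℝ) 1, S ν ≤ b) {K : ℕ} (x : Fin K → ℂ) :
    (star x ⬝ᵥ (toep (corr S) K *ᵥ x)).re ≤ b * nsq x := by
  rw [toep_quad hS, Complex.ofReal_re, ← integral_norm_sq_trig x,
    ← intervalIntegral.integral_const_mul]
  have hc : Continuous fun ν : ℝ =>
      ‖∑ i, star (x i) * Complex.exp (2 * Real.pi * Complex.I * ν * (i : ℕ))‖ ^ 2 := by fun_prop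
  refine intervalIntegral.integral_mono_on zero_le_one (hS.mul_continuousOn hc.continuousOn)
    ((hc.const_mul b).intervalIntegrable _ _) fun ν hν => ?_
  exact mul_le_mul_of_nonneg_right (hb ν hν) (by positivity)

theorem toep_quad_nonneg (hS : IntervalIntegrable S volume 0 1)
    (ha : ∀ ν ∈ Set.Icc (0 : ℝ) 1, 0 ≤ S ν) {K : ℕ} (x : Fin K → ℂ) :
    0 ≤ star x ⬝ᵥ (toep (corr S) K *ᵥ x) := by
  rw [toep_quad hS, Complex.zero_le_real]
  exact intervalIntegral.integral_nonneg zero_le_one fun ν hν =>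
    mul_nonneg (ha ν hν) (by positivity)

theorem star_corr (S : ℝ → ℝ) (k : ℤ) : star (corr S k) = corr S (-k) := by
  unfold corr
  rw [RCLike.star_def, intervalIntegral.integral_of_le zero_le_one,
    intervalIntegral.integral_of_le zero_le_one, ← integral_conj]
  congr 1
  funext ν
  rw [map_mul, Complex.conj_ofReal, ← Complex.exp_conj]
  congr 2
  simp only [map_mul, Complex.conj_ofReal, Complex.conj_I, map_intCast, map_ofNat]
  push_cast
  ring

theorem toep_posSemidef (hS : IntervalIntegrable S volume 0 1)
    (ha : ∀ ν ∈ Set.Icc (0 : ℝ) 1, 0 ≤ S ν) (K : ℕ) : (toep (corr S) K).PosSemidef := by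
  refine Matrix.PosSemidef.of_dotProduct_mulVec_nonneg ?_ (toep_quad_nonneg hS ha)
  ext i j
  simp only [toep, Matrix.conjTranspose_apply, Matrix.of_apply, star_corr]
  congr 1
  ring

end Toeplitz

/-! ### The covariance maps of the block-Hankel model -/

section Model

variable {M L N : ℕ}

/-- The index `i + j` of the entry `(i, j)` of a Hankel matrix. -/
def hidx (i : Fin L) (j : Fin N) : Fin (N + L - 1) := ⟨i.val + j.val, by omega⟩

/-- The covariance map `B ↦ E[W B Wᴴ]`. -/
def etaRow (S : ℕ → ℝ → ℝ) (M L : ℕ) {N : ℕ} (B : Matrix (Fin N) (Fin N) ℂ) :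
    Matrix (Fin M × Fin L) (Fin M × Fin L) ℂ :=
  Matrix.of fun p q => if p.1 = q.1 then
    (1 / (N : ℂ)) * ∑ j, ∑ j', B j j' * corr (S p.1) ((p.2 : ℤ) - q.2 + ((j : ℤ) - j')) else 0

/-- The covariance map `C ↦ E[Wᴴ C W]`. -/
def etaCol (S : ℕ → ℝ → ℝ) (N : ℕ) (C : Matrix (Fin M × Fin L) (Fin M × Fin L) ℂ) :
    Matrix (Fin N) (Fin N) ℂ :=
  Matrix.of fun j j' => (1 / (N : ℂ)) * ∑ m, ∑ i, ∑ i', C (m, i) (m, i') *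
    corr (S m) ((i' : ℤ) - i + ((j' : ℤ) - j))

/-- The block diagonal matrix with the shifted Toeplitz blocks `r_m (i - j + l)`. -/
def shiftToep (S : ℕ → ℝ → ℝ) (M L : ℕ) (l : ℤ) :
    Matrix (Fin M × Fin L) (Fin M × Fin L) ℂ :=
  Matrix.of fun p q => if p.1 = q.1 then corr (S p.1) ((p.2 : ℤ) - q.2 + l) else 0

theorem trace_mul_shiftPow {R : ℕ} (X : Matrix (Fin R) (Fin R) ℂ) (l : ℤ) :
    (X * shiftPow R l).trace =
      ∑ i : Fin R, ∑ i' : Fin R, if (i : ℤ) - (i' : ℤ) = l then X i i' else 0 := by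
  simp [Matrix.trace, Matrix.mul_apply, shiftPow]

/-- The entries of X are grouped by diagonals; the range -R < l < R contains all of them. -/
theorem sum_mul_trace_shiftPow {R : ℕ} (X : Matrix (Fin R) (Fin R) ℂ) (f : ℤ → ℂ) :
    ∑ l ∈ Finset.Ioo (-(R : ℤ)) R, f l * (X * shiftPow R l).trace =
      ∑ i : Fin R, ∑ i' : Fin R, X i i' * f ((i : ℤ) - i') := by
  simp only [trace_mul_shiftPow, Finset.mul_sum]
  rw [Finset.sum_comm]
  refine Finset.sum_congr rfl fun i _ => ?_
  rw [Finset.sum_comm]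
  refine Finset.sum_congr rfl fun i' _ => ?_
  have hm : (i : ℤ) - i' ∈ Finset.Ioo (-(R : ℤ)) R := by
    rw [Finset.mem_Ioo]; omega
  simp only [mul_ite, mul_zero]
  rw [Finset.sum_ite_eq, if_pos hm, mul_comm]

/-- In this separated form, the trace of η(G₂₂) G₁₁ against a matrix is a sum of products of two
linear statistics of the resolvent, so that the gap between the mean and the product of means is a
sum of covariances. -/
theorem etaRow_eq_sum (S : ℕ → ℝ → ℝ) (B : Matrix (Fin N) (Fin N) ℂ) :
    etaRow S M L B = ∑ l ∈ Finset.Ioo (-(N : ℤ)) N,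
      ((1 / (N : ℂ)) * (B * shiftPow N l).trace) • shiftToep S M L l := by
  ext p q
  simp only [etaRow, shiftToep, Matrix.of_apply, Matrix.sum_apply, Matrix.smul_apply, smul_eq_mul]
  split_ifs with h
  · rw [← sum_mul_trace_shiftPow B fun l => corr (S p.1) ((p.2 : ℤ) - q.2 + l), Finset.mul_sum]
    exact Finset.sum_congr rfl fun l _ => by ring
  · simp

theorem trace_mul_shiftToep (S : ℕ → ℝ → ℝ) (C : Matrix (Fin M × Fin L) (Fin M × Fin L) ℂ)
    (l : ℤ) : (C * shiftToep S M L l).trace =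
      ∑ m, ∑ i, ∑ i', C (m, i) (m, i') * corr (S m) ((i' : ℤ) - i + l) := by
  simp [Matrix.trace, Matrix.mul_apply, shiftToep, Fintype.sum_prod_type]

theorem etaCol_eq_sum (S : ℕ → ℝ → ℝ) (C : Matrix (Fin M × Fin L) (Fin M × Fin L) ℂ) :
    etaCol S N C = ∑ l ∈ Finset.Ioo (-(N : ℤ)) N,
      ((1 / (N : ℂ)) * (C * shiftToep S M L l).trace) • shiftPow N l := by
  ext j j'
  have hm : (j' : ℤ) - j ∈ Finset.Ioo (-(N : ℤ)) N := by
    rw [Finset.mem_Ioo]; omega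
  simp only [etaCol, shiftPow, Matrix.of_apply, Matrix.sum_apply, Matrix.smul_apply, smul_eq_mul,
    mul_ite, mul_one, mul_zero]
  rw [Finset.sum_ite_eq, if_pos hm, trace_mul_shiftToep]

/-- The transpose in the canonical equation compensates for orientation: `toeplitz` subtracts the
index difference read by `tau`, while E[W B Wᴴ] adds it. -/
theorem Psi_transpose (S : ℕ → ℝ → ℝ) (B : Matrix (Fin N) (Fin N) ℂ) :
    Psi S M L Bᵀ = etaRow S M L B := by
  ext p q
  simp only [Psi, etaRow, Matrix.of_apply]
  split_ifs with h
  · simp only [toeplitz, tau, Matrix.of_apply]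
    have h1 := sum_mul_trace_shiftPow Bᵀ fun l =>
      (1 / (N : ℂ)) * corr (S p.1) ((p.2 : ℤ) - q.2 - l)
    rw [Finset.sum_congr rfl fun l _ => show _ = (1 / (N : ℂ)) * corr (S p.1) ((p.2 : ℤ) - q.2 - l) *
      (Bᵀ * shiftPow N l).trace by ring, h1, Finset.sum_comm, Finset.mul_sum]
    refine Finset.sum_congr rfl fun j _ => ?_
    rw [Finset.mul_sum]
    refine Finset.sum_congr rfl fun j' _ => ?_
    rw [Matrix.transpose_apply, show (p.2 : ℤ) - q.2 - ((j' : ℤ) - j) =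
      (p.2 : ℤ) - q.2 + ((j : ℤ) - j') by ring]
    ring
  · rfl

/-- The prefactor c_N cancels the averages 1/M and 1/L and leaves the 1/N of the covariance, which
requires M and L to be nonzero. -/
theorem smul_PsiBar_transpose (hM : M ≠ 0) (hL : L ≠ 0) (S : ℕ → ℝ → ℝ)
    (C : Matrix (Fin M × Fin L) (Fin M × Fin L) ℂ) :
    ((M : ℂ) * (L : ℂ) / (N : ℂ)) • (PsiBar S N C)ᵀ = etaCol S N C := by
  have hM' : (M : ℂ) ≠ 0 := by exact_mod_cast hM
  have hL' : (L : ℂ) ≠ 0 := by exact_mod_cast hL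
  ext j j'
  simp only [PsiBar, etaCol, Matrix.of_apply, Matrix.smul_apply, Matrix.transpose_apply,
    Matrix.sum_apply, smul_eq_mul, toeplitz, tau]
  have h1 : ∀ m : Fin M, ∑ l ∈ Finset.Ioo (-(L : ℤ)) L, corr (S m) ((j' : ℤ) - j - l) *
      ((1 / (L : ℂ)) * ((Matrix.of fun i i' : Fin L => C (m, i) (m, i')) * shiftPow L l).trace) =
      (1 / (L : ℂ)) * ∑ i, ∑ i', C (m, i) (m, i') * corr (S m) ((i' : ℤ) - i + ((j' : ℤ) - j)) := by
    intro m
    have h2 := sum_mul_trace_shiftPow (Matrix.of fun i i' : Fin L => C (m, i) (m, i')) fun l =>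
      corr (S m) ((j' : ℤ) - j - l)
    rw [Finset.sum_congr rfl fun l _ => show _ = (1 / (L : ℂ)) * (corr (S m) ((j' : ℤ) - j - l) *
      ((Matrix.of fun i i' : Fin L => C (m, i) (m, i')) * shiftPow L l).trace) by ring,
      ← Finset.mul_sum, h2]
    congr 1
    refine Finset.sum_congr rfl fun i _ => Finset.sum_congr rfl fun i' _ => ?_
    rw [Matrix.of_apply, show (j' : ℤ) - j - ((i : ℤ) - i') = (i' : ℤ) - i + ((j' : ℤ) - j) by ring]
  rw [Finset.sum_congr rfl fun m _ => h1 m, ← Finset.mul_sum, ← mul_assoc, ← mul_assoc]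
  congr 1
  field_simp

open scoped MatrixOrder in
theorem exists_eq_conjTranspose_mul_self {n : Type*} [Fintype n] [DecidableEq n]
    {A : Matrix n n ℂ} (hA : A.PosSemidef) : ∃ R : Matrix n n ℂ, A = Rᴴ * R := by
  obtain ⟨R, hR⟩ := CStarAlgebra.nonneg_iff_eq_star_mul_self.1 (Matrix.nonneg_iff_posSemidef.2 hA)
  exact ⟨R, hR⟩

/-- The covariance maps are completely positive. -/
theorem exists_kraus {S : ℕ → ℝ → ℝ} (hS : ∀ m, IntervalIntegrable (S m) volume 0 1)
    (ha : ∀ m, ∀ ν ∈ Set.Icc (0 : ℝ) 1, 0 ≤ S m ν) (M L N : ℕ) :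
    ∃ A : Fin M × Fin (N + L - 1) → Matrix (Fin M × Fin L) (Fin N) ℂ,
      (∀ B, kmap A B = etaRow S M L B) ∧ ∀ C, kmap (adj A) C = etaCol S N C := by
  -- The covariance of each whole sequence, of length N + L - 1, is factored as Rᴴ R. Each row of R,
  -- conjugated, spread along the antidiagonals of one block and scaled by 1/√N, is a Kraus
  -- operator.
  have h1 : ∀ m, ∃ R : Matrix (Fin (N + L - 1)) (Fin (N + L - 1)) ℂ,
      toep (corr (S m)) (N + L - 1) = Rᴴ * R := fun m =>
    exists_eq_conjTranspose_mul_self (toep_posSemidef (hS m) (ha m) _)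
  choose R hR using h1
  have hR' : ∀ (m : ℕ) (n n' : Fin (N + L - 1)), corr (S m) ((n : ℤ) - (n' : ℤ)) = ∑ k, star (R m k n) * R m k n' :=
    fun m n n' => by
      have := congrFun (congrFun (hR m) n) n'
      simpa [toep, Matrix.mul_apply] using this
  have hN' : ((1 / √(N : ℝ) : ℝ) : ℂ) * ((1 / √(N : ℝ) : ℝ) : ℂ) = 1 / (N : ℂ) := by
    rw [← Complex.ofReal_mul, div_mul_div_comm, Real.mul_self_sqrt (by positivity)]
    simp
  refine ⟨fun t => Matrix.of fun p j =>
    if p.1 = t.1 then ((1 / √(N : ℝ) : ℝ) : ℂ) * star (R t.1 t.2 (hidx p.2 j)) else 0, ?_, ?_⟩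
  · intro B
    ext p q
    simp only [kmap, etaRow, Matrix.sum_apply, Matrix.mul_apply, Matrix.of_apply,
      Matrix.conjTranspose_apply, Fintype.sum_prod_type]
    split_ifs with h
    · rw [Finset.sum_eq_single p.1]
      · simp only [h, if_true]
        simp only [Finset.sum_mul, Finset.mul_sum]
        rw [Finset.sum_comm, Finset.sum_congr rfl fun j' _ => Finset.sum_comm, Finset.sum_comm]
        refine Finset.sum_congr rfl fun j _ => Finset.sum_congr rfl fun j' _ => ?_
        have h2 := hR' q.1 (hidx p.2 j) (hidx q.2 j')
        have h3 : ((hidx p.2 j : Fin (N + L - 1)) : ℤ) - (hidx q.2 j' : Fin (N + L - 1)) =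
            (p.2 : ℤ) - q.2 + ((j : ℤ) - j') := by
          simp [hidx]; ring
        rw [h3] at h2
        rw [h2, Finset.mul_sum, Finset.mul_sum, ← hN']
        refine Finset.sum_congr rfl fun k _ => ?_
        simp
        ring
      · intro m _ hm
        simp [Ne.symm hm]
      · simp
    · refine Finset.sum_eq_zero fun m _ => Finset.sum_eq_zero fun k _ =>
        Finset.sum_eq_zero fun j' _ => ?_
      by_cases h1 : p.1 = m
      · have : ¬ q.1 = m := fun h2 => h (h1.trans h2.symm)
        simp [this]
      · simp [h1]
  · intro C
    ext j j'
    simp only [kmap, adj, etaCol, Matrix.sum_apply, Matrix.mul_apply, Matrix.of_apply,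
      Matrix.conjTranspose_apply, Fintype.sum_prod_type]
    rw [Finset.mul_sum]
    refine Finset.sum_congr rfl fun m _ => ?_
    have h4 : ∀ k, (∑ m', ∑ i', (∑ m'', ∑ i, star (if m'' = m then
        ((1 / √(N : ℝ) : ℝ) : ℂ) * star (R m k (hidx i j)) else 0) * C (m'', i) (m', i')) *
        star (star (if m' = m then ((1 / √(N : ℝ) : ℝ) : ℂ) * star (R m k (hidx i' j')) else 0))) =
        ∑ i', ∑ i, (1 / (N : ℂ)) * (C (m, i) (m, i') *
          (star (R m k (hidx i' j')) * R m k (hidx i j))) := fun k => by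
      rw [Finset.sum_eq_single m]
      · refine Finset.sum_congr rfl fun i' _ => ?_
        rw [Finset.sum_eq_single m]
        · rw [Finset.sum_mul]
          refine Finset.sum_congr rfl fun i _ => ?_
          rw [← hN']
          simp
          ring
        · intro m'' _ h
          simp [h]
        · simp
      · intro m' _ h
        simp [h]
      · simp
    rw [Finset.sum_congr rfl fun k _ => h4 k, Finset.sum_comm,
      Finset.sum_congr rfl fun i' _ => Finset.sum_comm, Finset.sum_comm, Finset.mul_sum]
    refine Finset.sum_congr rfl fun i _ => ?_
    rw [Finset.mul_sum]
    refine Finset.sum_congr rfl fun i' _ => ?_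
    have h2 := hR' m (hidx i' j') (hidx i j)
    have h3 : ((hidx i' j' : Fin (N + L - 1)) : ℤ) - (hidx i j : Fin (N + L - 1)) =
        (i' : ℤ) - i + ((j' : ℤ) - j) := by
      simp [hidx]; ring
    rw [h3] at h2
    rw [h2, Finset.mul_sum, Finset.mul_sum]

theorem sum_nsq_eq_re {p q κ : Type*} [Fintype p] [Fintype q] [Fintype κ] [DecidableEq q]
    (A : κ → Matrix p q ℂ) (x : p → ℂ) :
    ∑ k, nsq ((A k)ᴴ *ᵥ x) = (star x ⬝ᵥ (kmap A 1 *ᵥ x)).re := by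
  simp only [kmap, Matrix.sum_mulVec, dotProduct_sum, star_dotProduct_mul_mul, Matrix.one_mulVec,
    star_dotProduct_self, Complex.re_sum, Complex.ofReal_re]

/-- A Kraus bound is a bound on the image of the identity, here the block diagonal matrix of the
Toeplitz covariances. -/
theorem krausBound_etaRow {S : ℕ → ℝ → ℝ} (hS : ∀ m, IntervalIntegrable (S m) volume 0 1) {b : ℝ}
    (hb : ∀ m, ∀ ν ∈ Set.Icc (0 : ℝ) 1, S m ν ≤ b) (hN : N ≠ 0)
    {A : Fin M × Fin (N + L - 1) → Matrix (Fin M × Fin L) (Fin N) ℂ}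
    (hA : ∀ B, kmap A B = etaRow S M L B) : KrausBound A b := fun x => by
  have hN' : (N : ℂ) ≠ 0 := by exact_mod_cast hN
  rw [sum_nsq_eq_re, hA]
  have h1 : star x ⬝ᵥ (etaRow S M L (1 : Matrix (Fin N) (Fin N) ℂ) *ᵥ x) =
      ∑ m, star (fun i => x (m, i)) ⬝ᵥ (toep (corr (S m)) L *ᵥ fun i => x (m, i)) := by
    simp [dotProduct, Matrix.mulVec, etaRow, toep, Fintype.sum_prod_type, Matrix.one_apply, hN']
  have h2 : nsq x = ∑ m, nsq fun i => x (m, i) := by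
    simp only [nsq, Fintype.sum_prod_type]
  rw [h1, h2, Complex.re_sum, Finset.mul_sum]
  exact Finset.sum_le_sum fun m _ => toep_quad_le (hS m) (hb m) _

/-- The image of the identity is L/N times the sum of M transposed Toeplitz matrices, hence the
constant c_N b. -/
theorem krausBound_etaCol {S : ℕ → ℝ → ℝ} (hS : ∀ m, IntervalIntegrable (S m) volume 0 1) {b : ℝ}
    (hb : ∀ m, ∀ ν ∈ Set.Icc (0 : ℝ) 1, S m ν ≤ b)
    {A : Fin M × Fin (N + L - 1) → Matrix (Fin M × Fin L) (Fin N) ℂ}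
    (hA : ∀ C, kmap (adj A) C = etaCol S N C) :
    KrausBound (adj A) ((M : ℝ) * L / N * b) := fun x => by
  rw [sum_nsq_eq_re, hA]
  have h1 : star x ⬝ᵥ (etaCol S N (1 : Matrix (Fin M × Fin L) (Fin M × Fin L) ℂ) *ᵥ x) =
      ((L / N : ℝ) : ℂ) * ∑ m : Fin M, star (star x) ⬝ᵥ (toep (corr (S m)) N *ᵥ star x) := by
    have e : ∀ j j' : Fin N, etaCol S N (1 : Matrix (Fin M × Fin L) (Fin M × Fin L) ℂ) j j' =
        ((L / N : ℝ) : ℂ) * ∑ m : Fin M, corr (S m) ((j' : ℤ) - j) := fun j j' => by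
      simp [etaCol, Matrix.one_apply, Finset.mul_sum]
      refine Finset.sum_congr rfl fun m _ => ?_
      ring
    simp only [dotProduct, Matrix.mulVec, e, toep, Matrix.of_apply, star_star, Pi.star_apply,
      Finset.mul_sum, Finset.sum_mul]
    rw [Finset.sum_comm]
    rw [Finset.sum_congr rfl fun j _ => Finset.sum_comm, Finset.sum_comm]
    refine Finset.sum_congr rfl fun m _ => Finset.sum_congr rfl fun j _ =>
      Finset.sum_congr rfl fun j' _ => ?_
    ring
  have h2 : nsq (star x) = nsq x := by simp [nsq]
  rw [h1, Complex.re_ofReal_mul, Complex.re_sum]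
  calc (L / N : ℝ) * ∑ m : Fin M, (star (star x) ⬝ᵥ (toep (corr (S m)) N *ᵥ star x)).re
      ≤ (L / N : ℝ) * ∑ m : Fin M, b * nsq x := by
        gcongr with m
        rw [← h2]
        exact toep_quad_le (hS m) (hb m) _
    _ = _ := by simp; ring

end Model

/-! ### The Gaussian block-Hankel model -/

section Noise

variable {M L N : ℕ}

/-- A centered circularly symmetric Gaussian measure with the covariance of the model. -/
structure IsNoise (μ : Measure (Fin M × Fin (N + L - 1) → ℂ)) (S : ℕ → ℝ → ℝ) : Prop where
  gaussian : IsGaussian μ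
  mean : μ[id] = 0
  cov : ∀ a b, ∫ x, x a * star (x b) ∂μ =
    if a.1 = b.1 then corr (S a.1) ((a.2 : ℤ) - (b.2 : ℤ)) / (N : ℂ) else 0
  pseudoCov : ∀ a b, ∫ x, x a * x b ∂μ = 0

/-- The block-Hankel matrix built from a vector. -/
def hank (x : Fin M × Fin (N + L - 1) → ℂ) : Matrix (Fin M × Fin L) (Fin N) ℂ :=
  Matrix.of fun p j => x (p.1, hidx p.2 j)

/-- The Hermitian matrix with off-diagonal blocks `W`, `Wᴴ`. -/
def herm (x : Fin M × Fin (N + L - 1) → ℂ) :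
    Matrix ((Fin M × Fin L) ⊕ Fin N) ((Fin M × Fin L) ⊕ Fin N) ℂ :=
  Matrix.fromBlocks 0 (hank x) (hank x)ᴴ 0

theorem herm_isHermitian (x : Fin M × Fin (N + L - 1) → ℂ) :
    (herm (L := L) x).IsHermitian := by
  simp [Matrix.IsHermitian, herm, Matrix.fromBlocks_conjTranspose]

/-- The Hermitization as a continuous real linear map. -/
def hermCLM (M L N : ℕ) : (Fin M × Fin (N + L - 1) → ℂ) →L[ℝ]
    Matrix ((Fin M × Fin L) ⊕ Fin N) ((Fin M × Fin L) ⊕ Fin N) ℂ :=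
  LinearMap.toContinuousLinearMap
    { toFun := herm
      map_add' := fun x y => by
        ext (i | i) (j | j) <;> simp [herm, hank]
      map_smul' := fun c x => by
        ext (i | i) (j | j) <;> simp [herm, hank] }

theorem hermCLM_apply (x : Fin M × Fin (N + L - 1) → ℂ) : hermCLM M L N x = herm x := rfl

variable {μ : Measure (Fin M × Fin (N + L - 1) → ℂ)} {S : ℕ → ℝ → ℝ}

theorem memLp_coord [IsGaussian μ] (a : Fin M × Fin (N + L - 1)) :
    MemLp (fun x => x a) 2 μ :=
  (IsGaussian.memLp_two_id (μ := μ)).of_le (Continuous.aestronglyMeasurable (by fun_prop))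
    (ae_of_all _ fun x => norm_le_pi_norm x a)

theorem memLp_star_coord [IsGaussian μ] (a : Fin M × Fin (N + L - 1)) :
    MemLp (fun x => star (x a)) 2 μ :=
  (IsGaussian.memLp_two_id (μ := μ)).of_le (Continuous.aestronglyMeasurable (by fun_prop))
    (ae_of_all _ fun x => by rw [norm_star]; exact norm_le_pi_norm x a)

theorem integrable_coord_mul_star [IsGaussian μ] (a b : Fin M × Fin (N + L - 1)) :
    Integrable (fun x => x a * star (x b)) μ :=
  (memLp_coord a).integrable_mul (memLp_star_coord b)

theorem integrable_coord_mul [IsGaussian μ] (a b : Fin M × Fin (N + L - 1)) :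
    Integrable (fun x => x a * x b) μ :=
  (memLp_coord a).integrable_mul (memLp_coord b)

/-- The covariance map of the Hermitization. -/
def etaHerm (S : ℕ → ℝ → ℝ)
    (B : Matrix ((Fin M × Fin L) ⊕ Fin N) ((Fin M × Fin L) ⊕ Fin N) ℂ) :
    Matrix ((Fin M × Fin L) ⊕ Fin N) ((Fin M × Fin L) ⊕ Fin N) ℂ :=
  Matrix.fromBlocks (etaRow S M L B.toBlocks₂₂) 0 0 (etaCol S N B.toBlocks₁₁)

/-- The off-diagonal blocks of X B X contain products of two entries of W or of two conjugates,
whose means vanish by circular symmetry; the diagonal blocks average to the two covariance maps. -/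
theorem IsNoise.integral_herm_mul_mul (h : IsNoise μ S)
    (B : Matrix ((Fin M × Fin L) ⊕ Fin N) ((Fin M × Fin L) ⊕ Fin N) ℂ)
    (i j : (Fin M × Fin L) ⊕ Fin N) :
    ∫ x, (hermCLM M L N x * B * hermCLM M L N x) i j ∂μ = etaHerm S B i j := by
  have := h.gaussian
  rw [← Matrix.fromBlocks_toBlocks B]
  simp only [hermCLM_apply, herm, Matrix.fromBlocks_multiply, Matrix.zero_mul, Matrix.mul_zero,
    zero_add, add_zero, etaHerm, Matrix.toBlocks_fromBlocks₂₂, Matrix.toBlocks_fromBlocks₁₁]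
  have hsum : ∀ {α β : Type} [Fintype α] [Fintype β]
      (f : α → β → (Fin M × Fin (N + L - 1) → ℂ) → ℂ), (∀ a b, Integrable (f a b) μ) →
      ∫ x, ∑ a, ∑ b, f a b x ∂μ = ∑ a, ∑ b, ∫ x, f a b x ∂μ := fun f hf => by
    rw [integral_finsetSum _ fun a _ => integrable_finsetSum _ fun b _ => hf a b]
    exact Finset.sum_congr rfl fun a _ => integral_finsetSum _ fun b _ => hf a b
  rcases i with i | i <;> rcases j with j | j
  · simp only [Matrix.fromBlocks_apply₁₁, etaRow, Matrix.of_apply, Matrix.mul_apply,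
      Matrix.conjTranspose_apply, hank, Finset.sum_mul]
    rw [hsum _ fun a b => by
      have := (integrable_coord_mul_star (μ := μ) (i.1, hidx i.2 b) (j.1, hidx j.2 a)).const_mul
        (B.toBlocks₂₂ b a)
      refine this.congr (ae_of_all _ fun x => ?_)
      simp only
      ring]
    have e : ∀ a b, ∫ x : Fin M × Fin (N + L - 1) → ℂ, x (i.1, hidx i.2 b) * B.toBlocks₂₂ b a *
        star (x (j.1, hidx j.2 a)) ∂μ = B.toBlocks₂₂ b a * if i.1 = j.1 then
          corr (S i.1) ((i.2 : ℤ) - j.2 + ((b : ℤ) - a)) / N else 0 := fun a b => by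
      have h1 : ∀ x : Fin M × Fin (N + L - 1) → ℂ, x (i.1, hidx i.2 b) * B.toBlocks₂₂ b a *
        star (x (j.1, hidx j.2 a)) = B.toBlocks₂₂ b a *
          (x (i.1, hidx i.2 b) * star (x (j.1, hidx j.2 a))) := fun x => by ring
      simp only [h1]
      rw [integral_const_mul, h.cov]
      simp only [hidx]
      congr 3
      push_cast
      ring_nf
    simp only [e]
    split_ifs
    · rw [Finset.sum_comm, Finset.mul_sum]
      refine Finset.sum_congr rfl fun b _ => ?_
      rw [Finset.mul_sum]
      exact Finset.sum_congr rfl fun a _ => by ring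
    · simp
  · simp only [Matrix.fromBlocks_apply₁₂, Matrix.mul_apply, hank, Matrix.of_apply, Finset.sum_mul]
    have e : ∀ a b, Integrable (fun x : Fin M × Fin (N + L - 1) → ℂ =>
        x (i.1, hidx i.2 b) * B.toBlocks₂₁ b a * x (a.1, hidx a.2 j)) μ := fun a b => by
      have := (integrable_coord_mul (μ := μ) (i.1, hidx i.2 b) (a.1, hidx a.2 j)).const_mul
        (B.toBlocks₂₁ b a)
      refine this.congr (ae_of_all _ fun x => ?_)
      simp only
      ring
    rw [hsum _ e]
    refine Finset.sum_eq_zero fun a _ => Finset.sum_eq_zero fun b _ => ?_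
    have h1 : ∀ x : Fin M × Fin (N + L - 1) → ℂ,
        x (i.1, hidx i.2 b) * B.toBlocks₂₁ b a * x (a.1, hidx a.2 j) =
        B.toBlocks₂₁ b a * (x (i.1, hidx i.2 b) * x (a.1, hidx a.2 j)) := fun x => by ring
    simp only [h1]
    rw [integral_const_mul, h.pseudoCov, mul_zero]
  · simp only [Matrix.fromBlocks_apply₂₁, Matrix.mul_apply, hank, Matrix.of_apply,
      Matrix.conjTranspose_apply, Finset.sum_mul]
    have h1 : ∀ a b (x : Fin M × Fin (N + L - 1) → ℂ),
        star (x (b.1, hidx b.2 i)) * B.toBlocks₁₂ b a * star (x (j.1, hidx j.2 a)) =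
        B.toBlocks₁₂ b a * star (x (b.1, hidx b.2 i) * x (j.1, hidx j.2 a)) := fun a b x => by
      rw [star_mul]; ring
    simp only [h1]
    have e : ∀ a b, Integrable (fun x : Fin M × Fin (N + L - 1) → ℂ =>
        B.toBlocks₁₂ b a * star (x (b.1, hidx b.2 i) * x (j.1, hidx j.2 a))) μ := fun a b => by
      refine Integrable.const_mul ?_ _
      have := (integrable_coord_mul (μ := μ) (b.1, hidx b.2 i) (j.1, hidx j.2 a))
      exact (Complex.conjCLE.toContinuousLinearMap.integrable_comp this)
    rw [hsum _ e]
    refine Finset.sum_eq_zero fun a _ => Finset.sum_eq_zero fun b _ => ?_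
    rw [integral_const_mul]
    have h2 : ∫ x : Fin M × Fin (N + L - 1) → ℂ,
        star (x (b.1, hidx b.2 i) * x (j.1, hidx j.2 a)) ∂μ = 0 := by
      have := integral_conj (μ := μ) (𝕜 := ℂ)
        (f := fun x => x (b.1, hidx b.2 i) * x (j.1, hidx j.2 a))
      rw [h.pseudoCov, map_zero] at this
      exact this
    rw [h2, mul_zero]
  · simp only [Matrix.fromBlocks_apply₂₂, etaCol, Matrix.of_apply, Matrix.mul_apply,
      Matrix.conjTranspose_apply, hank, Finset.sum_mul]
    have h1 : ∀ a b (x : Fin M × Fin (N + L - 1) → ℂ),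
        star (x (b.1, hidx b.2 i)) * B.toBlocks₁₁ b a * x (a.1, hidx a.2 j) =
        B.toBlocks₁₁ b a * (x (a.1, hidx a.2 j) * star (x (b.1, hidx b.2 i))) := fun a b x => by
      ring
    simp only [h1]
    rw [hsum _ fun a b => (integrable_coord_mul_star _ _).const_mul _]
    simp only [integral_const_mul, h.cov, hidx, Fintype.sum_prod_type]
    rw [Finset.mul_sum]
    refine Finset.sum_congr rfl fun m _ => ?_
    rw [Finset.sum_congr rfl fun i' _ => Finset.sum_eq_single m
      (fun m' _ hm' => by simp [Ne.symm hm']) (by simp), Finset.sum_comm, Finset.mul_sum]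
    refine Finset.sum_congr rfl fun i1 _ => ?_
    rw [Finset.mul_sum]
    refine Finset.sum_congr rfl fun i2 _ => ?_
    simp only [if_true]
    rw [show (((i2.val + j.val : ℕ) : ℤ) - ((i1.val + i.val : ℕ) : ℤ)) =
      (i2 : ℤ) - i1 + ((j : ℤ) - i) by push_cast; ring]
    ring

theorem IsNoise.integral_norm_sq_linear_le (h : IsNoise μ S)
    (hS : ∀ m, IntervalIntegrable (S m) volume 0 1) {b : ℝ}
    (hb : ∀ m, ∀ ν ∈ Set.Icc (0 : ℝ) 1, S m ν ≤ b) (d : Fin M × Fin (N + L - 1) → ℂ) :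
    ∫ x, ‖∑ a, d a * x a‖ ^ 2 ∂μ ≤ b / N * nsq d := by
  have := h.gaussian
  have h1 : ((∫ x, ‖∑ a, d a * x a‖ ^ 2 ∂μ : ℝ) : ℂ) =
      (1 / (N : ℂ)) * ∑ m, star (star fun n => d (m, n)) ⬝ᵥ
        (toep (corr (S m)) (N + L - 1) *ᵥ star fun n => d (m, n)) := by
    rw [← integral_complex_ofReal]
    have e1 : ∀ x : Fin M × Fin (N + L - 1) → ℂ, (((‖∑ a, d a * x a‖ ^ 2 : ℝ)) : ℂ) =
        ∑ a, ∑ a', (d a * star (d a')) * (x a * star (x a')) := fun x => by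
      rw [Complex.ofReal_pow, ← Complex.mul_conj', map_sum, Finset.sum_mul_sum]
      refine Finset.sum_congr rfl fun a _ => Finset.sum_congr rfl fun a' _ => ?_
      simp
      ring
    simp only [e1]
    rw [integral_finsetSum _ fun a _ => integrable_finsetSum _ fun a' _ =>
      (integrable_coord_mul_star a a').const_mul _]
    rw [Finset.sum_congr rfl fun a _ => integral_finsetSum _ fun a' _ =>
      (integrable_coord_mul_star a a').const_mul _]
    simp only [integral_const_mul, h.cov, Fintype.sum_prod_type]
    rw [Finset.mul_sum]
    refine Finset.sum_congr rfl fun m _ => ?_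
    simp only [dotProduct, Matrix.mulVec, toep, Matrix.of_apply, Pi.star_apply, star_star,
      Finset.mul_sum]
    refine Finset.sum_congr rfl fun n _ => ?_
    rw [Finset.sum_eq_single m]
    · refine Finset.sum_congr rfl fun n' _ => ?_
      simp only [if_true]
      ring
    · intro m' _ hm'
      simp [Ne.symm hm']
    · simp
  have h2 : ∫ x, ‖∑ a, d a * x a‖ ^ 2 ∂μ = (1 / (N : ℝ)) * ∑ m, (star (star fun n => d (m, n)) ⬝ᵥ
        (toep (corr (S m)) (N + L - 1) *ᵥ star fun n => d (m, n))).re := by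
    have := congrArg Complex.re h1
    rw [Complex.ofReal_re] at this
    rw [this, ← Complex.re_sum, show (1 / (N : ℂ)) = ((1 / (N : ℝ) : ℝ) : ℂ) by simp,
      Complex.re_ofReal_mul]
  have h3 : nsq d = ∑ m, nsq (star fun n => d (m, n)) := by
    simp [nsq, Fintype.sum_prod_type]
  rw [h2, h3]
  calc _ ≤ (1 / (N : ℝ)) * ∑ m, b * nsq (star fun n => d (m, n)) := by
        gcongr with m
        exact toep_quad_le (hS m) (hb m) _
    _ = _ := by rw [← Finset.mul_sum]; ring

/-- A coordinate n sits at the positions with i + j = n, at most one for each of the L rows of a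
block. Cauchy–Schwarz over these rows gives the factor L, the price of the Hankel structure. -/
theorem sum_hankel_sq_le (D : Matrix (Fin N) (Fin M × Fin L) ℂ) :
    ∃ d : Fin M × Fin (N + L - 1) → ℂ, (∀ x, (D * (hank x : Matrix (Fin M × Fin L) (Fin N) ℂ)).trace = ∑ a, d a * x a) ∧
      nsq d ≤ L * hs D ^ 2 := by
  refine ⟨fun a => ∑ i : Fin L, ∑ j : Fin N, if hidx i j = a.2 then D j (a.1, i) else 0,
    fun x => ?_, ?_⟩
  · simp only [Matrix.trace, Matrix.diag, Matrix.mul_apply, hank, Matrix.of_apply,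
      Fintype.sum_prod_type, Finset.sum_mul]
    rw [Finset.sum_comm]
    refine Finset.sum_congr rfl fun m _ => ?_
    rw [Finset.sum_comm]
    conv_rhs => rw [Finset.sum_comm]
    refine Finset.sum_congr rfl fun i _ => ?_
    conv_rhs => rw [Finset.sum_comm]
    refine Finset.sum_congr rfl fun j _ => ?_
    simp [ite_mul]
  · have h1 : ∀ (m : Fin M) (n : Fin (N + L - 1)),
        ‖∑ i, ∑ j, if hidx i j = n then D j (m, i) else 0‖ ^ 2 ≤
          L * ∑ i, ∑ j, if hidx i j = n then ‖D j (m, i)‖ ^ 2 else 0 := fun m n => by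
      have h2 : ∀ i : Fin L, ‖∑ j, if hidx i j = n then D j (m, i) else 0‖ ^ 2 ≤
          ∑ j, if hidx i j = n then ‖D j (m, i)‖ ^ 2 else 0 := fun i => by
        by_cases hj : ∃ j : Fin N, hidx i j = n
        · obtain ⟨j0, hj0⟩ := hj
          have h3 : ∀ j : Fin N, hidx i j = n ↔ j0 = j := fun j => by
            rw [← hj0]
            simp only [hidx, Fin.ext_iff]
            omega
          simp [h3]
        · push Not at hj
          simp [hj]
      calc _ ≤ (∑ i, ‖∑ j, if hidx i j = n then D j (m, i) else 0‖) ^ 2 :=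
            pow_le_pow_left₀ (norm_nonneg _) (norm_sum_le _ _) 2
        _ ≤ L * ∑ i, ‖∑ j, if hidx i j = n then D j (m, i) else 0‖ ^ 2 := by
            have := sq_sum_le_card_mul_sum_sq (s := (Finset.univ : Finset (Fin L)))
              (f := fun i => ‖∑ j, if hidx i j = n then D j (m, i) else 0‖)
            simpa using this
        _ ≤ _ := by
            gcongr with i
            exact h2 i
    calc _ ≤ ∑ m : Fin M, ∑ n, L * ∑ i, ∑ j, (if hidx i j = n then ‖D j (m, i)‖ ^ 2 else 0) := by
          rw [nsq, Fintype.sum_prod_type]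
          exact Finset.sum_le_sum fun m _ => Finset.sum_le_sum fun n _ => h1 m n
      _ = _ := by
          rw [hs_sq, Finset.sum_comm (f := fun j p => ‖D j p‖ ^ 2), Fintype.sum_prod_type,
            Finset.mul_sum]
          refine Finset.sum_congr rfl fun m _ => ?_
          rw [← Finset.mul_sum, Finset.sum_comm]
          congr 1
          refine Finset.sum_congr rfl fun i _ => ?_
          rw [Finset.sum_comm]
          refine Finset.sum_congr rfl fun j _ => ?_
          simp

theorem hs_fromBlocks_sq {p q r s : Type*} [Fintype p] [Fintype q] [Fintype r] [Fintype s]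
    (A : Matrix p r ℂ) (B : Matrix p s ℂ) (C : Matrix q r ℂ) (D : Matrix q s ℂ) :
    hs (Matrix.fromBlocks A B C D) ^ 2 = hs A ^ 2 + hs B ^ 2 + hs C ^ 2 + hs D ^ 2 := by
  simp only [hs_sq, Fintype.sum_sum_type, Matrix.fromBlocks_apply₁₁, Matrix.fromBlocks_apply₁₂,
    Matrix.fromBlocks_apply₂₁, Matrix.fromBlocks_apply₂₂, Finset.sum_add_distrib]
  ring

theorem trace_fromBlocks {p q : Type*} [Fintype p] [Fintype q]
    (A : Matrix p p ℂ) (B : Matrix p q ℂ) (C : Matrix q p ℂ) (D : Matrix q q ℂ) :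
    (Matrix.fromBlocks A B C D).trace = A.trace + D.trace := by
  simp [Matrix.trace]

/-- Only the off-diagonal blocks of D meet X: one gives a linear form in the noise, the other the
conjugate of such a form. The factor 2 comes from separating the two. -/
theorem IsNoise.integral_norm_trace_mul_sq_le (h : IsNoise μ S)
    (hS : ∀ m, IntervalIntegrable (S m) volume 0 1) {b : ℝ} (hb0 : 0 ≤ b)
    (hb : ∀ m, ∀ ν ∈ Set.Icc (0 : ℝ) 1, S m ν ≤ b)
    (D : Matrix ((Fin M × Fin L) ⊕ Fin N) ((Fin M × Fin L) ⊕ Fin N) ℂ) :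
    ∫ x, ‖(D * hermCLM M L N x).trace‖ ^ 2 ∂μ ≤ 2 * b * L / N * hs D ^ 2 := by
  have := h.gaussian
  obtain ⟨d1, hd1, hn1⟩ := sum_hankel_sq_le D.toBlocks₂₁
  obtain ⟨d2, hd2, hn2⟩ := sum_hankel_sq_le (D.toBlocks₁₂)ᴴ
  have h1 : ∀ x, (D * hermCLM M L N x).trace = (∑ a, d1 a * x a) + star (∑ a, d2 a * x a) := by
    intro x
    rw [← hd1, ← hd2]
    conv_lhs => rw [← Matrix.fromBlocks_toBlocks D]
    rw [hermCLM_apply, herm, Matrix.fromBlocks_multiply, trace_fromBlocks,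
      ← Matrix.trace_conjTranspose ((D.toBlocks₁₂)ᴴ * (hank x : Matrix (Fin M × Fin L) (Fin N) ℂ)), Matrix.conjTranspose_mul, Matrix.conjTranspose_conjTranspose,
      Matrix.trace_mul_comm (hank x)ᴴ]
    simp only [Matrix.mul_zero, zero_add, add_zero]
    ring
  have hi : ∀ d : Fin M × Fin (N + L - 1) → ℂ, Integrable (fun x => ‖∑ a, d a * x a‖ ^ 2) μ :=
    fun d => by
      have h2 : MemLp (fun x : Fin M × Fin (N + L - 1) → ℂ => ∑ a, d a * x a) 2 μ :=
        memLp_finsetSum _ fun a _ => (memLp_coord a).const_mul (d a)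
      exact h2.norm.integrable_sq
  have h2 : ∀ x, ‖(D * hermCLM M L N x).trace‖ ^ 2 ≤
      2 * ‖∑ a, d1 a * x a‖ ^ 2 + 2 * ‖∑ a, d2 a * x a‖ ^ 2 := fun x => by
    rw [h1]
    have h3 := norm_add_le (∑ a, d1 a * x a) (star (∑ a, d2 a * x a))
    rw [norm_star] at h3
    have h4 := pow_le_pow_left₀ (norm_nonneg _) h3 2
    nlinarith [sq_nonneg (‖∑ a, d1 a * x a‖ - ‖∑ a, d2 a * x a‖)]
  refine (integral_mono_of_nonneg (ae_of_all _ fun x => by positivity)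
    (((hi d1).const_mul 2).add ((hi d2).const_mul 2)) (ae_of_all _ h2)).trans ?_
  rw [show ((fun x : Fin M × Fin (N + L - 1) → ℂ => 2 * ‖∑ a, d1 a * x a‖ ^ 2) +
    fun x => 2 * ‖∑ a, d2 a * x a‖ ^ 2) =
    fun x => 2 * ‖∑ a, d1 a * x a‖ ^ 2 + 2 * ‖∑ a, d2 a * x a‖ ^ 2 from rfl,
    integral_add ((hi d1).const_mul 2) ((hi d2).const_mul 2), integral_const_mul,
    integral_const_mul]
  have h5 := h.integral_norm_sq_linear_le hS hb d1
  have h6 := h.integral_norm_sq_linear_le hS hb d2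
  have h7 : hs D ^ 2 = hs D.toBlocks₁₁ ^ 2 + hs D.toBlocks₁₂ ^ 2 + hs D.toBlocks₂₁ ^ 2 +
      hs D.toBlocks₂₂ ^ 2 := by
    conv_lhs => rw [← Matrix.fromBlocks_toBlocks D]
    exact hs_fromBlocks_sq _ _ _ _
  rw [hs_conjTranspose] at hn2
  have h8 : 0 ≤ b / N := by positivity
  calc _ ≤ 2 * (b / N * (L * hs D.toBlocks₂₁ ^ 2)) + 2 * (b / N * (L * hs D.toBlocks₁₂ ^ 2)) := by
        have h9 := mul_le_mul_of_nonneg_left hn1 h8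
        have h10 := mul_le_mul_of_nonneg_left hn2 h8
        linarith
    _ = 2 * b * L / N * (hs D.toBlocks₂₁ ^ 2 + hs D.toBlocks₁₂ ^ 2) := by ring
    _ ≤ _ := by
        have := sq_nonneg (hs D.toBlocks₁₁)
        have := sq_nonneg (hs D.toBlocks₂₂)
        gcongr
        linarith

end Noise

/-! ### The mean resolvent satisfies the canonical equation up to a small error -/

section MeanEquation

theorem norm_covariance_le {E : Type*} [MeasurableSpace E] {μ : Measure E} [IsProbabilityMeasure μ]
    {f g : E → ℂ} (hf : MemLp f 2 μ) (hg : MemLp g 2 μ) {a b : ℝ} (ha : 0 ≤ a) (hb : 0 ≤ b)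
    (hfa : ∫ x, ‖f x - ∫ y, f y ∂μ‖ ^ 2 ∂μ ≤ a ^ 2)
    (hgb : ∫ x, ‖g x - ∫ y, g y ∂μ‖ ^ 2 ∂μ ≤ b ^ 2) :
    ‖∫ x, f x * g x ∂μ - (∫ x, f x ∂μ) * ∫ x, g x ∂μ‖ ≤ a * b := by
  set c := ∫ y, f y ∂μ
  set d := ∫ y, g y ∂μ
  have h1f : Integrable f μ := hf.integrable (by norm_num)
  have h1g : Integrable g μ := hg.integrable (by norm_num)
  have hf' : MemLp (fun x => f x - c) 2 μ := hf.sub (memLp_const c)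
  have hg' : MemLp (fun x => g x - d) 2 μ := hg.sub (memLp_const d)
  have h1 : ∫ x, (f x - c) * (g x - d) ∂μ = ∫ x, f x * g x ∂μ - c * d := by
    have e : ∀ x, (f x - c) * (g x - d) = f x * g x - d * f x - c * g x + c * d := fun x => by ring
    simp only [e]
    have i1 : Integrable (fun x => f x * g x) μ := hf.integrable_mul hg
    have i4 : Integrable (fun x => d * f x) μ := h1f.const_mul d
    have i5 : Integrable (fun x => c * g x) μ := h1g.const_mul c
    have i2 : Integrable (fun x => f x * g x - d * f x) μ := i1.sub i4
    have i3 : Integrable (fun x => f x * g x - d * f x - c * g x) μ := i2.sub i5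
    rw [integral_add i3 (integrable_const _), integral_sub i2 i5, integral_sub i1 i4,
      integral_const_mul, integral_const_mul]
    simp only [integral_const, probReal_univ, one_smul]
    change _ - d * c - c * d + c * d = _
    ring
  rw [← h1]
  refine (norm_integral_le_integral_norm _).trans ?_
  simp only [norm_mul]
  have h2 := integral_mul_le_Lp_mul_Lq_of_nonneg (μ := μ) (p := 2) (q := 2)
    Real.HolderConjugate.two_two (f := fun x => ‖f x - c‖) (g := fun x => ‖g x - d‖)
    (ae_of_all _ fun x => norm_nonneg _) (ae_of_all _ fun x => norm_nonneg _)
    (by simpa using hf'.norm) (by simpa using hg'.norm)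
  refine h2.trans ?_
  simp only [Real.rpow_two]
  rw [← Real.sqrt_eq_rpow, ← Real.sqrt_eq_rpow]
  have h3 := Real.sqrt_le_sqrt hfa
  have h4 := Real.sqrt_le_sqrt hgb
  rw [Real.sqrt_sq ha] at h3
  rw [Real.sqrt_sq hb] at h4
  exact mul_le_mul h3 h4 (Real.sqrt_nonneg _) ha

variable {M L N : ℕ} {μ : Measure (Fin M × Fin (N + L - 1) → ℂ)} {S : ℕ → ℝ → ℝ}

/-- The mean of the upper left block of the resolvent of the Hermitization. -/
def meanRow (μ : Measure (Fin M × Fin (N + L - 1) → ℂ)) (ζ : ℂ) :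
    Matrix (Fin M × Fin L) (Fin M × Fin L) ℂ :=
  Matrix.of fun p q => ∫ x, gres (hermCLM M L N x) ζ (Sum.inl p) (Sum.inl q) ∂μ

/-- The mean of the lower right block of the resolvent of the Hermitization. -/
def meanCol (μ : Measure (Fin M × Fin (N + L - 1) → ℂ)) (ζ : ℂ) : Matrix (Fin N) (Fin N) ℂ :=
  Matrix.of fun i j => ∫ x, gres (hermCLM M L N x) ζ (Sum.inr i) (Sum.inr j) ∂μ

theorem hermCLM_isHermitian (x : Fin M × Fin (N + L - 1) → ℂ) :
    (hermCLM M L N x).IsHermitian := herm_isHermitian x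

theorem integral_trace_mul {E : Type*} [MeasurableSpace E] {μ : Measure E} {n : Type*} [Fintype n]
    (B : Matrix n n ℂ) {f : E → Matrix n n ℂ} (hf : ∀ i j, Integrable (fun x => f x i j) μ) :
    ∫ x, (B * f x).trace ∂μ = (B * Matrix.of fun i j => ∫ x, f x i j ∂μ).trace := by
  simp only [Matrix.trace, Matrix.diag, Matrix.mul_apply, Matrix.of_apply]
  have h : ∀ i j, Integrable (fun x => B i j * f x j i) μ := fun i j => (hf j i).const_mul _
  rw [integral_finsetSum _ fun i _ => integrable_finsetSum _ fun j _ => h i j]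
  refine Finset.sum_congr rfl fun i _ => ?_
  rw [integral_finsetSum _ fun j _ => h i j]
  simp only [integral_const_mul]

theorem trace_mul_toBlocks₁₁ {p q : Type*} [Fintype p] [Fintype q] (B : Matrix p p ℂ)
    (G : Matrix (p ⊕ q) (p ⊕ q) ℂ) :
    (B * G.toBlocks₁₁).trace = (Matrix.fromBlocks B 0 0 0 * G).trace := by
  conv_rhs => rw [← Matrix.fromBlocks_toBlocks G]
  simp [Matrix.fromBlocks_multiply, trace_fromBlocks]

theorem trace_mul_toBlocks₂₂ {p q : Type*} [Fintype p] [Fintype q] (B : Matrix q q ℂ)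
    (G : Matrix (p ⊕ q) (p ⊕ q) ℂ) :
    (B * G.toBlocks₂₂).trace = (Matrix.fromBlocks 0 0 0 B * G).trace := by
  conv_rhs => rw [← Matrix.fromBlocks_toBlocks G]
  simp [Matrix.fromBlocks_multiply, trace_fromBlocks]

theorem hs_fromBlocks_left {p q : Type*} [Fintype p] [Fintype q] (B : Matrix p p ℂ) :
    hs (Matrix.fromBlocks B (0 : Matrix p q ℂ) 0 (0 : Matrix q q ℂ)) = hs B := by
  rw [← sq_eq_sq₀ (hs_nonneg _) (hs_nonneg _), hs_fromBlocks_sq]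
  simp [hs_zero]

theorem hs_fromBlocks_right {p q : Type*} [Fintype p] [Fintype q] (B : Matrix q q ℂ) :
    hs (Matrix.fromBlocks (0 : Matrix p p ℂ) (0 : Matrix p q ℂ) 0 B) = hs B := by
  rw [← sq_eq_sq₀ (hs_nonneg _) (hs_nonneg _), hs_fromBlocks_sq]
  simp [hs_zero]

/-- The error in the equation of the rows. -/
def errRow (μ : Measure (Fin M × Fin (N + L - 1) → ℂ)) (S : ℕ → ℝ → ℝ) (ζ : ℂ) :
    Matrix (Fin M × Fin L) (Fin M × Fin L) ℂ :=
  -(1 + (ζ • 1 + etaRow S M L (meanCol (L := L) μ ζ)) * meanRow μ ζ)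

/-- The error in the equation of the columns. -/
def errCol (μ : Measure (Fin M × Fin (N + L - 1) → ℂ)) (S : ℕ → ℝ → ℝ) (ζ : ℂ) :
    Matrix (Fin N) (Fin N) ℂ :=
  -(1 + (ζ • 1 + etaCol S N (meanRow (L := L) μ ζ)) * meanCol (L := L) μ ζ)

theorem trace_mul_etaRow_mul (B Z : Matrix (Fin M × Fin L) (Fin M × Fin L) ℂ)
    (Y : Matrix (Fin N) (Fin N) ℂ) :
    (B * (etaRow S M L Y * Z)).trace = ∑ l ∈ Finset.Ioo (-(N : ℤ)) N,
      (1 / (N : ℂ)) * ((shiftPow N l * Y).trace * (B * shiftToep S M L l * Z).trace) := by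
  rw [etaRow_eq_sum, Matrix.sum_mul, Matrix.mul_sum, Matrix.trace_sum]
  refine Finset.sum_congr rfl fun l _ => ?_
  rw [Matrix.smul_mul, Matrix.mul_smul, Matrix.trace_smul, smul_eq_mul,
    Matrix.trace_mul_comm Y, ← Matrix.mul_assoc B]
  ring

theorem trace_mul_etaCol_mul (B Z : Matrix (Fin N) (Fin N) ℂ)
    (Y : Matrix (Fin M × Fin L) (Fin M × Fin L) ℂ) :
    (B * (etaCol S N Y * Z)).trace = ∑ l ∈ Finset.Ioo (-(N : ℤ)) N,
      (1 / (N : ℂ)) * ((shiftToep S M L l * Y).trace * (B * shiftPow N l * Z).trace) := by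
  rw [etaCol_eq_sum, Matrix.sum_mul, Matrix.mul_sum, Matrix.trace_sum]
  refine Finset.sum_congr rfl fun l _ => ?_
  rw [Matrix.smul_mul, Matrix.mul_smul, Matrix.trace_smul, smul_eq_mul,
    Matrix.trace_mul_comm Y, ← Matrix.mul_assoc B]
  ring

variable {ζ : ℂ} {b : ℝ}

theorem IsNoise.integrable_entry (h : IsNoise μ S) (hζ : 0 < ζ.im)
    (i j : (Fin M × Fin L) ⊕ Fin N) :
    Integrable (fun x => gres (hermCLM M L N x) ζ i j) μ := by
  have := h.gaussian
  exact integrable_gres_entry hermCLM_isHermitian hζ i j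

theorem continuous_trace_mul_gres (hζ : 0 < ζ.im)
    (C : Matrix ((Fin M × Fin L) ⊕ Fin N) ((Fin M × Fin L) ⊕ Fin N) ℂ) :
    Continuous fun x => (C * gres (hermCLM M L N x) ζ).trace :=
  (traceCLM C).continuous.comp (continuous_gres hermCLM_isHermitian hζ)

theorem norm_trace_mul_gres_le (hζ : 0 < ζ.im)
    (C : Matrix ((Fin M × Fin L) ⊕ Fin N) ((Fin M × Fin L) ⊕ Fin N) ℂ)
    (x : Fin M × Fin (N + L - 1) → ℂ) :
    ‖(C * gres (hermCLM M L N x) ζ).trace‖ ≤ ‖traceCLM C‖ * (1 / ζ.im) :=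
  ((traceCLM C).le_opNorm _).trans
    (by gcongr; exact opNorm_gres_le (hermCLM_isHermitian x) hζ)

theorem memLp_trace_mul_gres [IsFiniteMeasure μ] (hζ : 0 < ζ.im)
    (C : Matrix ((Fin M × Fin L) ⊕ Fin N) ((Fin M × Fin L) ⊕ Fin N) ℂ) :
    MemLp (fun x => (C * gres (hermCLM M L N x) ζ).trace) 2 μ :=
  MemLp.of_bound (continuous_trace_mul_gres hζ C).aestronglyMeasurable _
    (ae_of_all _ (norm_trace_mul_gres_le hζ C))

theorem IsNoise.norm_covariance_trace_le (h : IsNoise μ S)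
    (hS : ∀ m, IntervalIntegrable (S m) volume 0 1) (hb0 : 0 ≤ b)
    (hb : ∀ m, ∀ ν ∈ Set.Icc (0 : ℝ) 1, S m ν ≤ b) (hζ : 0 < ζ.im)
    (C D : Matrix ((Fin M × Fin L) ⊕ Fin N) ((Fin M × Fin L) ⊕ Fin N) ℂ) :
    ‖∫ x, (C * gres (hermCLM M L N x) ζ).trace * (D * gres (hermCLM M L N x) ζ).trace ∂μ -
      (∫ x, (C * gres (hermCLM M L N x) ζ).trace ∂μ) *
        ∫ x, (D * gres (hermCLM M L N x) ζ).trace ∂μ‖ ≤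
      Real.pi ^ 2 / 4 * (2 * b * L / N) * (1 / ζ.im) ^ 4 * (hs C * hs D) := by
  have := h.gaussian
  set V := Real.pi ^ 2 / 4 * (2 * b * L / N) * (1 / ζ.im) ^ 4 with hV
  have hV0 : 0 ≤ V := by positivity
  have hvar : ∀ C, ∫ x, ‖(C * gres (hermCLM M L N x) ζ).trace -
      ∫ y, (C * gres (hermCLM M L N y) ζ).trace ∂μ‖ ^ 2 ∂μ ≤ (√V * hs C) ^ 2 := fun C => by
    refine (variance_trace_gres_le h.mean hermCLM_isHermitian hζ (v := 2 * b * L / N)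
      (by positivity) (h.integral_norm_trace_mul_sq_le hS hb0 hb) C).trans (le_of_eq ?_)
    rw [mul_pow, Real.sq_sqrt hV0, hV]
    ring
  have h1 := norm_covariance_le (memLp_trace_mul_gres (μ := μ) hζ C)
    (memLp_trace_mul_gres (μ := μ) hζ D)
    (mul_nonneg (Real.sqrt_nonneg V) (hs_nonneg C)) (mul_nonneg (Real.sqrt_nonneg V) (hs_nonneg D))
    (hvar C) (hvar D)
  refine h1.trans (le_of_eq ?_)
  calc _ = (√V * √V) * (hs C * hs D) := by ring
    _ = _ := by rw [Real.mul_self_sqrt hV0]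

theorem IsNoise.schwinger_dyson_row (h : IsNoise μ S) (hζ : 0 < ζ.im)
    (p q : Fin M × Fin L) :
    (1 : Matrix (Fin M × Fin L) (Fin M × Fin L) ℂ) p q + ζ * meanRow μ ζ p q +
      ∫ x, (etaRow S M L (gres (hermCLM M L N x) ζ).toBlocks₂₂ *
        (gres (hermCLM M L N x) ζ).toBlocks₁₁) p q ∂μ = 0 := by
  have := h.gaussian
  have h1 := schwinger_dyson h.mean hermCLM_isHermitian hζ h.integral_herm_mul_mul
    (Sum.inl p) (Sum.inl q)
  have h2 : ∀ G : Matrix ((Fin M × Fin L) ⊕ Fin N) ((Fin M × Fin L) ⊕ Fin N) ℂ,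
      (etaHerm S G * G) (Sum.inl p) (Sum.inl q) =
        (etaRow S M L G.toBlocks₂₂ * G.toBlocks₁₁) p q := fun G => by
    simp [Matrix.mul_apply, etaHerm, Matrix.toBlocks₁₁]
  simp only [h2] at h1
  rw [← h1]
  simp [meanRow, Matrix.one_apply]

theorem IsNoise.schwinger_dyson_col (h : IsNoise μ S) (hζ : 0 < ζ.im)
    (i j : Fin N) :
    (1 : Matrix (Fin N) (Fin N) ℂ) i j + ζ * meanCol (L := L) μ ζ i j +
      ∫ x, (etaCol S N (gres (hermCLM M L N x) ζ).toBlocks₁₁ *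
        (gres (hermCLM M L N x) ζ).toBlocks₂₂) i j ∂μ = 0 := by
  have := h.gaussian
  have h1 := schwinger_dyson h.mean hermCLM_isHermitian hζ h.integral_herm_mul_mul
    (Sum.inr i) (Sum.inr j)
  have h2 : ∀ G : Matrix ((Fin M × Fin L) ⊕ Fin N) ((Fin M × Fin L) ⊕ Fin N) ℂ,
      (etaHerm S G * G) (Sum.inr i) (Sum.inr j) =
        (etaCol S N G.toBlocks₁₁ * G.toBlocks₂₂) i j := fun G => by
    simp [Matrix.mul_apply, etaHerm, Matrix.toBlocks₂₂]
  simp only [h2] at h1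
  rw [← h1]
  simp [meanCol, Matrix.one_apply]

theorem IsNoise.integral_trace_row (h : IsNoise μ S) (hζ : 0 < ζ.im)
    (B : Matrix (Fin M × Fin L) (Fin M × Fin L) ℂ) :
    ∫ x, (B * (gres (hermCLM M L N x) ζ).toBlocks₁₁).trace ∂μ = (B * meanRow μ ζ).trace :=
  integral_trace_mul B fun _ _ => h.integrable_entry hζ _ _

theorem IsNoise.integral_trace_col (h : IsNoise μ S) (hζ : 0 < ζ.im)
    (B : Matrix (Fin N) (Fin N) ℂ) :
    ∫ x, (B * (gres (hermCLM M L N x) ζ).toBlocks₂₂).trace ∂μ =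
      (B * meanCol (L := L) μ ζ).trace :=
  integral_trace_mul B fun _ _ => h.integrable_entry hζ _ _

theorem integrable_trace_mul_trace [IsFiniteMeasure μ] (hζ : 0 < ζ.im)
    (C D : Matrix ((Fin M × Fin L) ⊕ Fin N) ((Fin M × Fin L) ⊕ Fin N) ℂ) :
    Integrable (fun x => (C * gres (hermCLM M L N x) ζ).trace *
      (D * gres (hermCLM M L N x) ζ).trace) μ :=
  (memLp_trace_mul_gres hζ C).integrable_mul (memLp_trace_mul_gres hζ D)

/-- By the Schwinger–Dyson equation the error is E[η(G₂₂) G₁₁] - η(E G₂₂) E G₁₁. Against B, the term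
of index l is 1/N times the covariance of tr(Jˡ G₂₂) and of the trace of B times the l-shifted
Toeplitz matrix times G₁₁. -/
theorem IsNoise.norm_trace_mul_errRow_le (h : IsNoise μ S)
    (hS : ∀ m, IntervalIntegrable (S m) volume 0 1) (hb0 : 0 ≤ b)
    (hb : ∀ m, ∀ ν ∈ Set.Icc (0 : ℝ) 1, S m ν ≤ b) (hζ : 0 < ζ.im)
    (B : Matrix (Fin M × Fin L) (Fin M × Fin L) ℂ) :
    ‖(B * errRow μ S ζ).trace‖ ≤ Real.pi ^ 2 / 4 * (2 * b * L / N) * (1 / ζ.im) ^ 4 * (1 / N) *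
      ∑ l ∈ Finset.Ioo (-(N : ℤ)) N, hs (shiftPow N l) * hs (B * shiftToep S M L l) := by
  have := h.gaussian
  have e0 : ∀ (B : Matrix (Fin M × Fin L) (Fin M × Fin L) ℂ) x,
      (B * (etaRow S M L (gres (hermCLM M L N x) ζ).toBlocks₂₂ *
        (gres (hermCLM M L N x) ζ).toBlocks₁₁)).trace = ∑ l ∈ Finset.Ioo (-(N : ℤ)) N,
      (1 / (N : ℂ)) * ((Matrix.fromBlocks 0 0 0 (shiftPow N l) * gres (hermCLM M L N x) ζ).trace *
        (Matrix.fromBlocks (B * shiftToep S M L l) 0 0 0 * gres (hermCLM M L N x) ζ).trace) :=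
    fun B x => by
      rw [trace_mul_etaRow_mul]
      simp only [trace_mul_toBlocks₁₁, trace_mul_toBlocks₂₂]
  have i0 : ∀ B, Integrable (fun x => (B * (etaRow S M L (gres (hermCLM M L N x) ζ).toBlocks₂₂ *
        (gres (hermCLM M L N x) ζ).toBlocks₁₁)).trace) μ := fun B => by
    simp only [e0]
    exact integrable_finsetSum _ fun l _ => (integrable_trace_mul_trace hζ _ _).const_mul _
  have e1 : ∫ x, (B * (etaRow S M L (gres (hermCLM M L N x) ζ).toBlocks₂₂ *
        (gres (hermCLM M L N x) ζ).toBlocks₁₁)).trace ∂μ =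
      -(B * (1 + ζ • meanRow μ ζ)).trace := by
    have i1 : ∀ p q, Integrable (fun x => (etaRow S M L (gres (hermCLM M L N x) ζ).toBlocks₂₂ *
        (gres (hermCLM M L N x) ζ).toBlocks₁₁) p q) μ := fun p q => by
      -- Entries are traces against matrix units, so the integrability of traces covers them.
      have := i0 (Matrix.single q p 1)
      simpa [Matrix.trace_single_mul] using this
    rw [integral_trace_mul B i1, ← Matrix.trace_neg, ← Matrix.mul_neg]
    congr 2
    ext p q
    have := h.schwinger_dyson_row hζ p q
    simp only [Matrix.of_apply, Matrix.neg_apply, Matrix.add_apply, Matrix.smul_apply, smul_eq_mul]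
    linear_combination this
  have e2 : (B * errRow μ S ζ).trace = ∑ l ∈ Finset.Ioo (-(N : ℤ)) N, (1 / (N : ℂ)) *
      (∫ x, (Matrix.fromBlocks 0 0 0 (shiftPow N l) * gres (hermCLM M L N x) ζ).trace *
        (Matrix.fromBlocks (B * shiftToep S M L l) 0 0 0 * gres (hermCLM M L N x) ζ).trace ∂μ -
      (∫ x, (Matrix.fromBlocks 0 0 0 (shiftPow N l) * gres (hermCLM M L N x) ζ).trace ∂μ) *
        ∫ x, (Matrix.fromBlocks (B * shiftToep S M L l) 0 0 0 *
          gres (hermCLM M L N x) ζ).trace ∂μ) := by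
    have e3 : (B * errRow μ S ζ).trace = -(B * (1 + ζ • meanRow μ ζ)).trace -
        (B * (etaRow S M L (meanCol (L := L) μ ζ) * meanRow μ ζ)).trace := by
      rw [errRow, Matrix.add_mul, Matrix.smul_mul, Matrix.one_mul, ← add_assoc, Matrix.mul_neg,
        Matrix.mul_add, Matrix.trace_neg, Matrix.trace_add]
      ring
    rw [e3, ← e1, trace_mul_etaRow_mul]
    simp only [e0]
    rw [integral_finsetSum _ fun l _ => (integrable_trace_mul_trace hζ _ _).const_mul _,
      ← Finset.sum_sub_distrib]
    refine Finset.sum_congr rfl fun l _ => ?_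
    rw [integral_const_mul, ← h.integral_trace_col hζ, ← h.integral_trace_row hζ]
    simp only [trace_mul_toBlocks₁₁, trace_mul_toBlocks₂₂]
    ring
  rw [e2, Finset.mul_sum]
  refine (norm_sum_le _ _).trans (Finset.sum_le_sum fun l _ => ?_)
  rw [norm_mul]
  have h5 := h.norm_covariance_trace_le hS hb0 hb hζ
    (Matrix.fromBlocks 0 0 0 (shiftPow N l)) (Matrix.fromBlocks (B * shiftToep S M L l) 0 0 0)
  rw [hs_fromBlocks_left, hs_fromBlocks_right] at h5
  have h6 : ‖(1 / (N : ℂ))‖ = 1 / N := by simp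
  rw [h6]
  exact (mul_le_mul_of_nonneg_left h5 (by positivity)).trans (le_of_eq (by ring))

theorem IsNoise.norm_trace_mul_errCol_le (h : IsNoise μ S)
    (hS : ∀ m, IntervalIntegrable (S m) volume 0 1) (hb0 : 0 ≤ b)
    (hb : ∀ m, ∀ ν ∈ Set.Icc (0 : ℝ) 1, S m ν ≤ b) (hζ : 0 < ζ.im)
    (B : Matrix (Fin N) (Fin N) ℂ) :
    ‖(B * errCol (L := L) μ S ζ).trace‖ ≤
      Real.pi ^ 2 / 4 * (2 * b * L / N) * (1 / ζ.im) ^ 4 * (1 / N) *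
      ∑ l ∈ Finset.Ioo (-(N : ℤ)) N, hs (shiftToep S M L l) * hs (B * shiftPow N l) := by
  have := h.gaussian
  have e0 : ∀ (B : Matrix (Fin N) (Fin N) ℂ) x,
      (B * (etaCol S N (gres (hermCLM M L N x) ζ).toBlocks₁₁ *
        (gres (hermCLM M L N x) ζ).toBlocks₂₂)).trace = ∑ l ∈ Finset.Ioo (-(N : ℤ)) N,
      (1 / (N : ℂ)) * ((Matrix.fromBlocks (shiftToep S M L l) 0 0 0 *
        gres (hermCLM M L N x) ζ).trace *
        (Matrix.fromBlocks 0 0 0 (B * shiftPow N l) * gres (hermCLM M L N x) ζ).trace) :=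
    fun B x => by
      rw [trace_mul_etaCol_mul]
      simp only [trace_mul_toBlocks₁₁, trace_mul_toBlocks₂₂]
  have i0 : ∀ B, Integrable (fun x => (B * (etaCol S N (gres (hermCLM M L N x) ζ).toBlocks₁₁ *
        (gres (hermCLM M L N x) ζ).toBlocks₂₂)).trace) μ := fun B => by
    simp only [e0]
    exact integrable_finsetSum _ fun l _ => (integrable_trace_mul_trace hζ _ _).const_mul _
  have e1 : ∫ x, (B * (etaCol S N (gres (hermCLM M L N x) ζ).toBlocks₁₁ *
        (gres (hermCLM M L N x) ζ).toBlocks₂₂)).trace ∂μ =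
      -(B * (1 + ζ • meanCol (L := L) μ ζ)).trace := by
    have i1 : ∀ p q, Integrable (fun x => (etaCol S N (gres (hermCLM M L N x) ζ).toBlocks₁₁ *
        (gres (hermCLM M L N x) ζ).toBlocks₂₂) p q) μ := fun p q => by
      have := i0 (Matrix.single q p 1)
      simpa [Matrix.trace_single_mul] using this
    rw [integral_trace_mul B i1, ← Matrix.trace_neg, ← Matrix.mul_neg]
    congr 2
    ext p q
    have := h.schwinger_dyson_col hζ p q
    simp only [Matrix.of_apply, Matrix.neg_apply, Matrix.add_apply, Matrix.smul_apply, smul_eq_mul]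
    linear_combination this
  have e2 : (B * errCol (L := L) μ S ζ).trace = ∑ l ∈ Finset.Ioo (-(N : ℤ)) N, (1 / (N : ℂ)) *
      (∫ x, (Matrix.fromBlocks (shiftToep S M L l) 0 0 0 * gres (hermCLM M L N x) ζ).trace *
        (Matrix.fromBlocks 0 0 0 (B * shiftPow N l) * gres (hermCLM M L N x) ζ).trace ∂μ -
      (∫ x, (Matrix.fromBlocks (shiftToep S M L l) 0 0 0 * gres (hermCLM M L N x) ζ).trace ∂μ) *
        ∫ x, (Matrix.fromBlocks 0 0 0 (B * shiftPow N l) *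
          gres (hermCLM M L N x) ζ).trace ∂μ) := by
    have e3 : (B * errCol (L := L) μ S ζ).trace = -(B * (1 + ζ • meanCol (L := L) μ ζ)).trace -
        (B * (etaCol S N (meanRow (L := L) μ ζ) * meanCol (L := L) μ ζ)).trace := by
      rw [errCol, Matrix.add_mul, Matrix.smul_mul, Matrix.one_mul, ← add_assoc, Matrix.mul_neg,
        Matrix.mul_add, Matrix.trace_neg, Matrix.trace_add]
      ring
    rw [e3, ← e1, trace_mul_etaCol_mul]
    simp only [e0]
    rw [integral_finsetSum _ fun l _ => (integrable_trace_mul_trace hζ _ _).const_mul _,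
      ← Finset.sum_sub_distrib]
    refine Finset.sum_congr rfl fun l _ => ?_
    rw [integral_const_mul, ← h.integral_trace_col hζ, ← h.integral_trace_row hζ]
    simp only [trace_mul_toBlocks₁₁, trace_mul_toBlocks₂₂]
    ring
  rw [e2, Finset.mul_sum]
  refine (norm_sum_le _ _).trans (Finset.sum_le_sum fun l _ => ?_)
  rw [norm_mul]
  have h5 := h.norm_covariance_trace_le hS hb0 hb hζ
    (Matrix.fromBlocks (shiftToep S M L l) 0 0 0) (Matrix.fromBlocks 0 0 0 (B * shiftPow N l))
  rw [hs_fromBlocks_left, hs_fromBlocks_right] at h5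
  have h6 : ‖(1 / (N : ℂ))‖ = 1 / N := by simp
  rw [h6]
  exact (mul_le_mul_of_nonneg_left h5 (by positivity)).trans (le_of_eq (by ring))

end MeanEquation

/-! ### Size of the errors -/

section ErrorSize

variable {M L N : ℕ} {S : ℕ → ℝ → ℝ}

theorem sum_ite_shift_le_one {R : ℕ} (b : Fin R) (l : ℤ) :
    ∑ a : Fin R, (if (b : ℤ) - (a : ℤ) = l then (1 : ℝ) else 0) ≤ 1 := by
  rw [Finset.sum_boole, Nat.cast_le_one, Finset.card_le_one]
  intro a ha a' ha'
  simp only [Finset.mem_filter, Finset.mem_univ, true_and] at ha ha'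
  exact Fin.ext (by omega)

theorem sum_ite_shift_le_one' {R : ℕ} (a : Fin R) (l : ℤ) :
    ∑ b : Fin R, (if (b : ℤ) - (a : ℤ) = l then (1 : ℝ) else 0) ≤ 1 := by
  rw [Finset.sum_boole, Nat.cast_le_one, Finset.card_le_one]
  intro a ha a' ha'
  simp only [Finset.mem_filter, Finset.mem_univ, true_and] at ha ha'
  exact Fin.ext (by omega)

/-- A partial permutation matrix: each row and each column has at most one nonzero entry. -/
theorem opNorm_shiftPow_le (R : ℕ) (l : ℤ) : ‖shiftPow R l‖ ≤ 1 := by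
  refine opNorm_le_of_nsq_le zero_le_one fun x => ?_
  rw [one_pow, one_mul]
  have h1 : ∀ a : Fin R, ‖(shiftPow R l *ᵥ x) a‖ ^ 2 ≤
      ∑ b : Fin R, (if (b : ℤ) - (a : ℤ) = l then (1 : ℝ) else 0) * ‖x b‖ ^ 2 := fun a => by
    have h2 : ‖(shiftPow R l *ᵥ x) a‖ ≤
        ∑ b : Fin R, (if (b : ℤ) - (a : ℤ) = l then (1 : ℝ) else 0) *
          ((if (b : ℤ) - (a : ℤ) = l then (1 : ℝ) else 0) * ‖x b‖) := by
      rw [Matrix.mulVec, dotProduct]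
      refine (norm_sum_le _ _).trans (Finset.sum_le_sum fun b _ => ?_)
      simp only [shiftPow, Matrix.of_apply]
      split_ifs <;> simp
    have h3 := Finset.sum_mul_sq_le_sq_mul_sq Finset.univ
      (fun b : Fin R => if (b : ℤ) - (a : ℤ) = l then (1 : ℝ) else 0)
      (fun b : Fin R => (if (b : ℤ) - (a : ℤ) = l then (1 : ℝ) else 0) * ‖x b‖)
    refine (pow_le_pow_left₀ (norm_nonneg _) h2 2).trans (h3.trans ?_)
    have h4 := sum_ite_shift_le_one' a l
    have e : ∀ c : Fin R, (if (c : ℤ) - (a : ℤ) = l then (1 : ℝ) else 0) ^ 2 =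
        if (c : ℤ) - (a : ℤ) = l then (1 : ℝ) else 0 := fun c => by split_ifs <;> simp
    simp only [mul_pow, e]
    exact mul_le_of_le_one_left (Finset.sum_nonneg fun b _ => by positivity) h4
  refine (Finset.sum_le_sum fun a _ => h1 a).trans ?_
  rw [Finset.sum_comm]
  refine Finset.sum_le_sum fun b _ => ?_
  rw [← Finset.sum_mul]
  exact mul_le_of_le_one_left (by positivity) (sum_ite_shift_le_one b l)

theorem hs_shiftPow_le (R : ℕ) (l : ℤ) : hs (shiftPow R l) ≤ √R := by
  refine (hs_le_opNorm _).trans ?_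
  rw [Fintype.card_fin]
  exact mul_le_of_le_one_left (Real.sqrt_nonneg _) (opNorm_shiftPow_le R l)

/-- The projector on the `m`-th block. -/
def blockProj (L : ℕ) (m : Fin M) : Matrix (Fin M × Fin L) (Fin M × Fin L) ℂ :=
  Matrix.diagonal fun p => if p.1 = m then 1 else 0

theorem mul_blockProj_apply {κ : Type*} (B : Matrix κ (Fin M × Fin L) ℂ) (m : Fin M) (t : κ)
    (p : Fin M × Fin L) : (B * blockProj L m) t p = if p.1 = m then B t p else 0 := by
  simp [blockProj, Matrix.mul_diagonal]

theorem blockProj_mul_apply {κ : Type*} (B : Matrix (Fin M × Fin L) κ ℂ) (m : Fin M) (t : κ)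
    (p : Fin M × Fin L) : (blockProj L m * B) p t = if p.1 = m then B p t else 0 := by
  simp [blockProj, Matrix.diagonal_mul]

theorem hs_mul_blockProj_sq {κ : Type*} [Fintype κ] (B : Matrix κ (Fin M × Fin L) ℂ)
    (m : Fin M) : hs (B * blockProj L m) ^ 2 = ∑ t, ∑ i, ‖B t (m, i)‖ ^ 2 := by
  rw [hs_sq]
  refine Finset.sum_congr rfl fun t _ => ?_
  simp only [mul_blockProj_apply, Fintype.sum_prod_type]
  rw [Finset.sum_eq_single m]
  · simp
  · intro m' _ h
    simp [h]
  · simp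

theorem hs_sq_eq_sum_blockProj {κ : Type*} [Fintype κ] (B : Matrix κ (Fin M × Fin L) ℂ) :
    hs B ^ 2 = ∑ m : Fin M, hs (B * blockProj L m) ^ 2 := by
  rw [Finset.sum_congr rfl fun (m : Fin M) _ => hs_mul_blockProj_sq B m, hs_sq, Finset.sum_comm]
  simp only [Fintype.sum_prod_type]
  refine Finset.sum_congr rfl fun m _ => ?_
  rw [Finset.sum_comm]

theorem hs_le_of_blockProj {κ : Type*} [Fintype κ] {B : Matrix κ (Fin M × Fin L) ℂ} {β : ℝ}
    (hβ : 0 ≤ β) (h : ∀ m : Fin M, hs (B * blockProj L m) ≤ β) : hs B ≤ √M * β := by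
  rw [← sq_le_sq₀ (hs_nonneg _) (by positivity), hs_sq_eq_sum_blockProj, mul_pow,
    Real.sq_sqrt (by positivity)]
  refine (Finset.sum_le_sum fun m _ => pow_le_pow_left₀ (hs_nonneg _) (h m) 2).trans ?_
  simp

theorem hs_blockProj (m : Fin M) : hs (blockProj L m) = √L := by
  rw [← sq_eq_sq₀ (hs_nonneg _) (by positivity), Real.sq_sqrt (by positivity)]
  have := hs_mul_blockProj_sq (1 : Matrix (Fin M × Fin L) (Fin M × Fin L) ℂ) m
  rw [Matrix.one_mul] at this
  rw [this, Finset.sum_comm]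
  simp [Matrix.one_apply, apply_ite]

/-- The quadratic mean of the correlation coefficients. -/
def rho (S : ℕ → ℝ → ℝ) (M : ℕ) (n : ℤ) : ℝ :=
  √((1 / (M : ℝ)) * ∑ i ∈ Finset.range M, ‖corr (S i) n‖ ^ 2)

theorem rho_nonneg (n : ℤ) : 0 ≤ rho S M n := Real.sqrt_nonneg _

theorem sum_corr_sq (hM : M ≠ 0) (n : ℤ) :
    ∑ m : Fin M, ‖corr (S m) n‖ ^ 2 = M * rho S M n ^ 2 := by
  have hM' : (M : ℝ) ≠ 0 := by exact_mod_cast hM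
  rw [rho, Real.sq_sqrt (by positivity), ← Finset.sum_range fun i => ‖corr (S i) n‖ ^ 2]
  field_simp

/-- The Toeplitz blocks are split along their diagonals a, |a| < L. On one diagonal the block m is
multiplied by r_m at one index and by a partial shift. Since β bounds all the blocks of B uniformly,
the sum over m yields exactly M times the squared quadratic mean. -/
theorem hs_mul_shiftToep_le {κ : Type*} [Fintype κ] (hM : M ≠ 0) {B : Matrix κ (Fin M × Fin L) ℂ}
    {β : ℝ} (hβ : 0 ≤ β) (h : ∀ m : Fin M, hs (B * blockProj L m) ≤ β) (l : ℤ) :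
    hs (B * shiftToep S M L l) ≤
      √M * β * ∑ a ∈ Finset.Ioo (-(L : ℤ)) L, rho S M (a + l) := by
  have e1 : B * shiftToep S M L l = ∑ a ∈ Finset.Ioo (-(L : ℤ)) L,
      Matrix.of fun t (p : Fin M × Fin L) => corr (S p.1) (a + l) *
        ((Matrix.of fun t' i => B t' (p.1, i)) * shiftPow L (-a)) t p.2 := by
    ext t p
    simp only [Matrix.sum_apply, Matrix.of_apply, Matrix.mul_apply, shiftToep, shiftPow,
      Fintype.sum_prod_type, Finset.mul_sum]
    rw [Finset.sum_eq_single p.1, Finset.sum_comm]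
    · refine Finset.sum_congr rfl fun i _ => ?_
      have hm : (i : ℤ) - p.2 ∈ Finset.Ioo (-(L : ℤ)) L := by
        rw [Finset.mem_Ioo]; omega
      rw [Finset.sum_eq_single ((i : ℤ) - p.2)]
      · simp [mul_comm]
      · intro a _ ha
        rw [if_neg (by omega)]
        simp
      · exact fun h => absurd hm h
    · intro m' _ h
      simp [h]
    · simp
  rw [e1, Finset.mul_sum]
  refine (hs_sum_le _ _).trans (Finset.sum_le_sum fun a _ => ?_)
  have hr := rho_nonneg (S := S) (M := M) (a + l)
  rw [← sq_le_sq₀ (hs_nonneg _) (by positivity), hs_sq]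
  have e2 : ∀ m : Fin M, ∑ t, ∑ i, ‖((Matrix.of fun t' i => B t' (m, i)) *
      shiftPow L (-a)) t i‖ ^ 2 ≤ β ^ 2 := fun m => by
    rw [← hs_sq]
    refine pow_le_pow_left₀ (hs_nonneg _) ?_ 2
    refine (hs_mul_le_mul_opNorm _ _).trans ?_
    refine (mul_le_of_le_one_right (hs_nonneg _) (opNorm_shiftPow_le _ _)).trans (le_trans ?_ (h m))
    rw [← sq_le_sq₀ (hs_nonneg _) (hs_nonneg _), hs_mul_blockProj_sq B m, hs_sq]
    rfl
  simp only [Matrix.of_apply, Fintype.sum_prod_type, norm_mul, mul_pow]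
  rw [Finset.sum_comm]
  calc _ = ∑ m : Fin M, ‖corr (S m) (a + l)‖ ^ 2 *
        ∑ t, ∑ i, ‖((Matrix.of fun t' i => B t' (m, i)) * shiftPow L (-a)) t i‖ ^ 2 := by
        simp only [Finset.mul_sum]
    _ ≤ ∑ m : Fin M, ‖corr (S m) (a + l)‖ ^ 2 * β ^ 2 := by
        gcongr with m
        exact e2 m
    _ = _ := by
        rw [← Finset.sum_mul, sum_corr_sq hM, Real.sq_sqrt (by positivity)]
        ring

theorem sum_rho_le {K : ℝ} (hs : Summable (rho S M)) (hK : ∑' n, rho S M n ≤ K) (a : ℤ)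
    (s : Finset ℤ) : ∑ l ∈ s, rho S M (a + l) ≤ K := by
  have h1 : Summable fun l => rho S M (a + l) :=
    hs.comp_injective (add_right_injective a)
  refine (h1.sum_le_tsum s fun _ _ => rho_nonneg _).trans (le_trans (le_of_eq ?_) hK)
  exact (Equiv.addLeft a).tsum_eq (rho S M)

/-- Summing over l first, each of the 2L - 1 diagonals contributes at most K, however many shifts
there are. This is where the summability of the correlations is used: the cost is of order L instead
of N. -/
theorem sum_hs_mul_shiftToep_le {κ : Type*} [Fintype κ] (hM : M ≠ 0)
    {B : Matrix κ (Fin M × Fin L) ℂ} {β K : ℝ} (hβ : 0 ≤ β)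
    (h : ∀ m : Fin M, hs (B * blockProj L m) ≤ β) (hs' : Summable (rho S M))
    (hK : ∑' n, rho S M n ≤ K) (s : Finset ℤ) :
    ∑ l ∈ s, hs (B * shiftToep S M L l) ≤ √M * β * (2 * L * K) := by
  refine (Finset.sum_le_sum fun l _ => hs_mul_shiftToep_le hM hβ h l).trans ?_
  rw [← Finset.mul_sum, Finset.sum_comm]
  have hK0 : 0 ≤ K := (tsum_nonneg fun _ => rho_nonneg _).trans hK
  refine mul_le_mul_of_nonneg_left ?_ (by positivity)
  refine (Finset.sum_le_sum fun a _ => sum_rho_le hs' hK a s).trans ?_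
  rw [Finset.sum_const, nsmul_eq_mul, Int.card_Ioo]
  refine mul_le_mul_of_nonneg_right ?_ hK0
  have : (((L : ℤ) - -(L : ℤ) - 1).toNat : ℤ) ≤ 2 * L := by omega
  exact_mod_cast this

variable {μ : Measure (Fin M × Fin (N + L - 1) → ℂ)} {ζ : ℂ} {b K : ℝ}

theorem IsNoise.norm_trace_mul_errRow_le_of_blockProj (h : IsNoise μ S)
    (hS : ∀ m, IntervalIntegrable (S m) volume 0 1) (hb0 : 0 ≤ b)
    (hb : ∀ m, ∀ ν ∈ Set.Icc (0 : ℝ) 1, S m ν ≤ b) (hζ : 0 < ζ.im) (hM : M ≠ 0)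
    (hs' : Summable (rho S M)) (hK : ∑' n, rho S M n ≤ K)
    {B : Matrix (Fin M × Fin L) (Fin M × Fin L) ℂ} {β : ℝ} (hβ : 0 ≤ β)
    (hB : ∀ m : Fin M, hs (B * blockProj L m) ≤ β) :
    ‖(B * errRow μ S ζ).trace‖ ≤
      Real.pi ^ 2 * b * K * (1 / ζ.im) ^ 4 * (L ^ 2 * √M / (N ^ 2) * √N * β) := by
  refine (h.norm_trace_mul_errRow_le hS hb0 hb hζ B).trans ?_
  have h1 : ∑ l ∈ Finset.Ioo (-(N : ℤ)) N, hs (shiftPow N l) * hs (B * shiftToep S M L l) ≤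
      √N * (√M * β * (2 * L * K)) := by
    refine le_trans ?_ (mul_le_mul_of_nonneg_left
      (sum_hs_mul_shiftToep_le hM hβ hB hs' hK (Finset.Ioo (-(N : ℤ)) N)) (Real.sqrt_nonneg _))
    rw [Finset.mul_sum]
    exact Finset.sum_le_sum fun l _ =>
      mul_le_mul_of_nonneg_right (hs_shiftPow_le N l) (hs_nonneg _)
  refine (mul_le_mul_of_nonneg_left h1 (by positivity)).trans (le_of_eq ?_)
  ring

theorem IsNoise.norm_trace_mul_errCol_le_hs (h : IsNoise μ S)
    (hS : ∀ m, IntervalIntegrable (S m) volume 0 1) (hb0 : 0 ≤ b)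
    (hb : ∀ m, ∀ ν ∈ Set.Icc (0 : ℝ) 1, S m ν ≤ b) (hζ : 0 < ζ.im) (hM : M ≠ 0)
    (hs' : Summable (rho S M)) (hK : ∑' n, rho S M n ≤ K) (B : Matrix (Fin N) (Fin N) ℂ) :
    ‖(B * errCol (L := L) μ S ζ).trace‖ ≤
      Real.pi ^ 2 * b * K * (1 / ζ.im) ^ 4 * (L ^ 2 / N ^ 2 * (√M * √L) * hs B) := by
  refine (h.norm_trace_mul_errCol_le hS hb0 hb hζ B).trans ?_
  have h1 : ∑ l ∈ Finset.Ioo (-(N : ℤ)) N, hs (shiftToep S M L l) * hs (B * shiftPow N l) ≤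
      (√M * √L * (2 * L * K)) * hs B := by
    have h2 := sum_hs_mul_shiftToep_le (L := L) hM
      (B := (1 : Matrix (Fin M × Fin L) (Fin M × Fin L) ℂ))
      (Real.sqrt_nonneg L) (fun m => (congrArg hs (Matrix.one_mul (blockProj L m))).trans_le (hs_blockProj m).le) hs' hK
      (Finset.Ioo (-(N : ℤ)) N)
    simp only [Matrix.one_mul] at h2
    refine le_trans ?_ (mul_le_mul_of_nonneg_right h2 (hs_nonneg _))
    rw [Finset.sum_mul]
    refine Finset.sum_le_sum fun l _ => mul_le_mul_of_nonneg_left ?_ (hs_nonneg _)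
    exact (hs_mul_le_mul_opNorm _ _).trans
      (mul_le_of_le_one_right (hs_nonneg _) (opNorm_shiftPow_le _ _))
  refine (mul_le_mul_of_nonneg_left h1 (by positivity)).trans (le_of_eq ?_)
  ring

end ErrorSize

/-! ### Comparison of the mean resolvent with the solution of the canonical equation -/

section Comparison

theorem trace_vecMulVec_star_mul {n : Type*} [Fintype n] (x y : n → ℂ) (X : Matrix n n ℂ) :
    (Matrix.vecMulVec y (star x) * X).trace = star x ⬝ᵥ (X *ᵥ y) := by
  rw [Matrix.vecMulVec_mul, Matrix.trace_vecMulVec, dotProduct_comm, Matrix.dotProduct_mulVec]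

theorem star_dotProduct_toBlocks₁₁ {p q : Type*} [Fintype p] [Fintype q]
    (G : Matrix (p ⊕ q) (p ⊕ q) ℂ) (x y : p → ℂ) :
    star x ⬝ᵥ (G.toBlocks₁₁ *ᵥ y) =
      star (Sum.elim x (0 : q → ℂ)) ⬝ᵥ (G *ᵥ Sum.elim y (0 : q → ℂ)) := by
  simp [dotProduct, Matrix.mulVec, Matrix.toBlocks₁₁]

theorem star_dotProduct_toBlocks₂₂ {p q : Type*} [Fintype p] [Fintype q]
    (G : Matrix (p ⊕ q) (p ⊕ q) ℂ) (x y : q → ℂ) :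
    star x ⬝ᵥ (G.toBlocks₂₂ *ᵥ y) =
      star (Sum.elim (0 : p → ℂ) x) ⬝ᵥ (G *ᵥ Sum.elim (0 : p → ℂ) y) := by
  simp [dotProduct, Matrix.mulVec, Matrix.toBlocks₂₂]

theorem nsq_sumElim_zero {p q : Type*} [Fintype p] [Fintype q] (x : p → ℂ) :
    nsq (Sum.elim x (0 : q → ℂ)) = nsq x := by
  simp [nsq]

theorem imq_toBlocks₁₁_nonneg {p q : Type*} [Fintype p] [Fintype q]
    {G : Matrix (p ⊕ q) (p ⊕ q) ℂ} (h : ∀ x, 0 ≤ imq G x) (x : p → ℂ) :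
    0 ≤ imq G.toBlocks₁₁ x := by
  rw [imq, star_dotProduct_toBlocks₁₁]
  exact h _

theorem imq_toBlocks₂₂_nonneg {p q : Type*} [Fintype p] [Fintype q]
    {G : Matrix (p ⊕ q) (p ⊕ q) ℂ} (h : ∀ x, 0 ≤ imq G x) (x : q → ℂ) :
    0 ≤ imq G.toBlocks₂₂ x := by
  rw [imq, star_dotProduct_toBlocks₂₂]
  exact h _

variable {M L N : ℕ} {S : ℕ → ℝ → ℝ} {μ : Measure (Fin M × Fin (N + L - 1) → ℂ)} {ζ : ℂ}

theorem IsNoise.star_dotProduct_meanRow (h : IsNoise μ S) (hζ : 0 < ζ.im)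
    (x y : Fin M × Fin L → ℂ) : star x ⬝ᵥ (meanRow μ ζ *ᵥ y) =
      ∫ v, star x ⬝ᵥ ((gres (hermCLM M L N v) ζ).toBlocks₁₁ *ᵥ y) ∂μ := by
  rw [← trace_vecMulVec_star_mul, ← h.integral_trace_row hζ]
  simp only [trace_vecMulVec_star_mul]

theorem IsNoise.imq_meanRow_nonneg (h : IsNoise μ S) (hζ : 0 < ζ.im) (x : Fin M × Fin L → ℂ) :
    0 ≤ imq (meanRow μ ζ) x := by
  have hi : Integrable (fun v => star x ⬝ᵥ ((gres (hermCLM M L N v) ζ).toBlocks₁₁ *ᵥ x)) μ := by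
    have := h.gaussian
    have := (memLp_trace_mul_gres (μ := μ) (L := L) (M := M) (N := N) hζ
      (Matrix.fromBlocks (Matrix.vecMulVec x (star x)) 0 0 0)).integrable (by norm_num)
    refine this.congr (ae_of_all _ fun v => ?_)
    simp only [← trace_mul_toBlocks₁₁, trace_vecMulVec_star_mul]
  rw [imq, h.star_dotProduct_meanRow hζ]
  have h1 := integral_im (𝕜 := ℂ) hi
  simp only [RCLike.im_eq_complex_im] at h1
  rw [← h1]
  exact integral_nonneg fun v =>
    imq_toBlocks₁₁_nonneg (imq_gres_nonneg (hermCLM_isHermitian v) hζ) x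

theorem IsNoise.opNorm_meanRow_le (h : IsNoise μ S) (hζ : 0 < ζ.im) :
    ‖meanRow (L := L) μ ζ‖ ≤ 1 / ζ.im := by
  have := h.gaussian
  refine opNorm_le_of_bilin (by positivity) fun x y => ?_
  rw [h.star_dotProduct_meanRow hζ]
  refine (norm_integral_le_of_norm_le_const (C := 1 / ζ.im * √(nsq x) * √(nsq y))
    (ae_of_all _ fun v => ?_)).trans (by simp)
  rw [star_dotProduct_toBlocks₁₁]
  refine (norm_bilin_le _ _ _).trans ?_
  rw [nsq_sumElim_zero, nsq_sumElim_zero]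
  gcongr
  exact opNorm_gres_le (hermCLM_isHermitian v) hζ

variable {A : Fin M × Fin (N + L - 1) → Matrix (Fin M × Fin L) (Fin N) ℂ}

/-- The approximate solution built from the mean resolvent, columns. -/
def auxCol (μ : Measure (Fin M × Fin (N + L - 1) → ℂ)) (S : ℕ → ℝ → ℝ) (ζ : ℂ) :
    Matrix (Fin N) (Fin N) ℂ :=
  negInv ζ (etaCol S N (meanRow (L := L) μ ζ))

/-- The approximate solution built from the mean resolvent, rows. -/
def auxRow (μ : Measure (Fin M × Fin (N + L - 1) → ℂ)) (S : ℕ → ℝ → ℝ) (ζ : ℂ) :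
    Matrix (Fin M × Fin L) (Fin M × Fin L) ℂ :=
  negInv ζ (etaRow S M L (auxCol (L := L) μ S ζ))

theorem IsNoise.imq_etaCol_meanRow_nonneg (h : IsNoise μ S) (hζ : 0 < ζ.im)
    (hA' : ∀ C, kmap (adj A) C = etaCol S N C) (x : Fin N → ℂ) :
    0 ≤ imq (etaCol S N (meanRow (L := L) μ ζ)) x := by
  rw [← hA']
  exact imq_kmap_nonneg _ (h.imq_meanRow_nonneg hζ) x

theorem IsNoise.imq_etaRow_auxCol_nonneg (h : IsNoise μ S) (hζ : 0 < ζ.im)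
    (hA : ∀ B, kmap A B = etaRow S M L B) (hA' : ∀ C, kmap (adj A) C = etaCol S N C)
    (x : Fin M × Fin L → ℂ) : 0 ≤ imq (etaRow S M L (auxCol (L := L) μ S ζ)) x := by
  rw [← hA]
  exact imq_kmap_nonneg _ (imq_negInv_nonneg hζ (h.imq_etaCol_meanRow_nonneg hζ hA')) x

/-- As R' and R are negatives of exact inverses, R' times the column error is F' - R', where F' is
the mean column block, and R times the row error is F - R - R η(F' - R') F. Adjunction then isolates
the column error in the trace. -/
theorem IsNoise.trace_mul_meanRow_sub (h : IsNoise μ S) (hζ : 0 < ζ.im)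
    (hA : ∀ B, kmap A B = etaRow S M L B) (hA' : ∀ C, kmap (adj A) C = etaCol S N C)
    (B : Matrix (Fin M × Fin L) (Fin M × Fin L) ℂ) :
    (B * (meanRow μ ζ - auxRow μ S ζ)).trace =
      (B * auxRow μ S ζ * errRow μ S ζ).trace +
        (etaCol S N (meanRow μ ζ * B * auxRow μ S ζ) * auxCol (L := L) μ S ζ *
          errCol (L := L) μ S ζ).trace := by
  set F := meanRow (L := L) μ ζ with hF
  set F' := meanCol (L := L) μ ζ with hF'
  set R := auxRow (L := L) μ S ζ with hR
  set R' := auxCol (L := L) μ S ζ with hR'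
  have h1 : R' * (ζ • 1 + etaCol S N F) = -1 :=
    negInv_mul_smul_one_add hζ (h.imq_etaCol_meanRow_nonneg hζ hA')
  have h2 : R * (ζ • 1 + etaRow S M L R') = -1 :=
    negInv_mul_smul_one_add hζ (h.imq_etaRow_auxCol_nonneg hζ hA hA')
  have h3 : R' * errCol (L := L) μ S ζ = F' - R' := by
    rw [errCol, ← hF, ← hF', Matrix.mul_neg, Matrix.mul_add, ← Matrix.mul_assoc, h1,
      Matrix.mul_one, Matrix.neg_mul, Matrix.one_mul]
    abel
  have h4 : R * errRow μ S ζ + R * etaRow S M L (R' * errCol (L := L) μ S ζ) * F = F - R := by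
    have e1 : etaRow S M L F' = etaRow S M L R' + etaRow S M L (F' - R') := by
      rw [← hA, ← hA, ← hA, ← kmap_add, add_sub_cancel]
    rw [h3, errRow, ← hF, ← hF', e1, ← add_assoc, Matrix.mul_neg, Matrix.mul_add,
      ← Matrix.mul_assoc, Matrix.mul_add, h2]
    simp only [Matrix.add_mul, Matrix.mul_one, Matrix.neg_mul, Matrix.one_mul]
    abel
  rw [← h4, Matrix.mul_add, Matrix.trace_add, Matrix.mul_assoc B]
  congr 1
  rw [Matrix.mul_assoc (etaCol S N _), ← hA', ← trace_mul_kmap, hA, ← Matrix.mul_assoc,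
    Matrix.trace_mul_comm]
  simp only [Matrix.mul_assoc]

theorem blockProj_mul_etaRow (m : Fin M) (B : Matrix (Fin N) (Fin N) ℂ) :
    blockProj L m * etaRow S M L B = etaRow S M L B * blockProj L m := by
  ext p q
  rw [mul_blockProj_apply, blockProj_mul_apply, etaRow, Matrix.of_apply]
  by_cases h : p.1 = q.1
  · rw [h]
  · simp [h]

/-- R inverts a block diagonal matrix up to sign, so it commutes with the block projectors; bounds
on the blocks of B therefore pass to B R. -/
theorem IsNoise.blockProj_mul_auxRow (h : IsNoise μ S) (hζ : 0 < ζ.im)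
    (hA : ∀ B, kmap A B = etaRow S M L B) (hA' : ∀ C, kmap (adj A) C = etaCol S N C)
    (m : Fin M) : blockProj L m * auxRow μ S ζ = auxRow μ S ζ * blockProj L m := by
  set R := auxRow (L := L) μ S ζ with hR
  set H := ζ • (1 : Matrix (Fin M × Fin L) (Fin M × Fin L) ℂ) +
    etaRow S M L (auxCol (L := L) μ S ζ) with hH
  have h1 : R * H = -1 := negInv_mul_smul_one_add hζ (h.imq_etaRow_auxCol_nonneg hζ hA hA')
  have h2 : H * R = -1 := smul_one_add_mul_negInv hζ (h.imq_etaRow_auxCol_nonneg hζ hA hA')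
  have h3 : blockProj L m * H = H * blockProj L m := by
    rw [hH, Matrix.mul_add, Matrix.add_mul, blockProj_mul_etaRow]
    simp
  calc blockProj L m * R = -(R * H) * (blockProj L m * R) := by rw [h1]; simp
    _ = -(R * (blockProj L m * H) * R) := by rw [h3]; simp only [Matrix.neg_mul, Matrix.mul_assoc]
    _ = -(R * blockProj L m * (H * R)) := by simp only [Matrix.mul_assoc]
    _ = R * blockProj L m := by rw [h2]; simp

theorem KrausBound.mono {p q κ : Type*} [Fintype p] [Fintype q] [Fintype κ]
    {A : κ → Matrix p q ℂ} {s s' : ℝ} (h : KrausBound A s) (hs : s ≤ s') : KrausBound A s' :=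
  fun x => (h x).trans (mul_le_mul_of_nonneg_right hs (nsq_nonneg x))

theorem hs_vecMulVec_star {n : Type*} [Fintype n] (v : n → ℂ) :
    hs (Matrix.vecMulVec v (star v)) = nsq v := by
  rw [← sq_eq_sq₀ (hs_nonneg _) (nsq_nonneg _), hs_sq]
  simp only [Matrix.vecMulVec_apply, norm_mul, mul_pow, Pi.star_apply, norm_star, nsq, sq (∑ i, _),
    Finset.sum_mul_sum]

/-- η(x xᴴ) is a sum of rank one positive matrices. Cut down to block m, their norms add up to the
trace of that block, that is, L times its constant diagonal entry, which is 1/N times a Toeplitz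
form at the conjugate of x. -/
theorem hs_etaRow_vecMulVec_mul_blockProj_le
    (hS : ∀ m, IntervalIntegrable (S m) volume 0 1) {b : ℝ}
    (hb : ∀ m, ∀ ν ∈ Set.Icc (0 : ℝ) 1, S m ν ≤ b)
    (hA : ∀ B, kmap A B = etaRow S M L B) (x : Fin N → ℂ) (m : Fin M) :
    hs (etaRow S M L (Matrix.vecMulVec x (star x)) * blockProj L m) ≤ b * L / N * nsq x := by
  have hP : blockProj L m * blockProj L m = blockProj L m := by
    ext p q
    rw [mul_blockProj_apply]
    by_cases h : q.1 = m
    · simp [h]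
    · have : ¬ (p = q ∧ p.1 = m) := fun h1 => h (h1.1 ▸ h1.2)
      simp only [h, if_false, blockProj, Matrix.diagonal_apply]
      split_ifs <;> simp_all
  have hPh : (blockProj L m)ᴴ = blockProj L m := by
    rw [blockProj, Matrix.diagonal_conjTranspose]
    congr 1
    ext p
    simp [apply_ite]
  have h0 : ∀ k, A k * Matrix.vecMulVec x (star x) * (A k)ᴴ =
      Matrix.vecMulVec (A k *ᵥ x) (star (A k *ᵥ x)) := fun k => by
    rw [Matrix.mul_vecMulVec, Matrix.vecMulVec_mul, Matrix.star_mulVec]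
  have h1 : etaRow S M L (Matrix.vecMulVec x (star x)) * blockProj L m =
      ∑ k, Matrix.vecMulVec (blockProj L m *ᵥ (A k *ᵥ x))
        (star (blockProj L m *ᵥ (A k *ᵥ x))) := by
    have e : etaRow S M L (Matrix.vecMulVec x (star x)) * blockProj L m =
        blockProj L m * etaRow S M L (Matrix.vecMulVec x (star x)) * blockProj L m := by
      rw [blockProj_mul_etaRow, Matrix.mul_assoc, hP]
    rw [e, ← hA, kmap, Matrix.mul_sum, Matrix.sum_mul]
    refine Finset.sum_congr rfl fun k _ => ?_
    rw [h0, Matrix.mul_vecMulVec, Matrix.vecMulVec_mul, Matrix.star_mulVec (blockProj L m), hPh]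
  rw [h1]
  refine (hs_sum_le _ _).trans ?_
  simp only [hs_vecMulVec_star]
  have h2 : ∀ v : Fin M × Fin L → ℂ, nsq (blockProj L m *ᵥ v) = ∑ i, ‖v (m, i)‖ ^ 2 := fun v => by
    simp only [nsq, blockProj, Matrix.mulVec_diagonal, Fintype.sum_prod_type]
    rw [Finset.sum_eq_single m]
    · simp
    · intro m' _ h
      simp [h]
    · simp
  have h3 : ∀ i, ∑ k, ‖(A k *ᵥ x) (m, i)‖ ^ 2 = 1 / N *
      (star (star x) ⬝ᵥ (toep (corr (S m)) N *ᵥ star x)).re := fun i => by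
    have e := congrFun (congrFun (hA (Matrix.vecMulVec x (star x))) (m, i)) (m, i)
    rw [kmap, Finset.sum_congr rfl fun k _ => h0 k, Matrix.sum_apply] at e
    have e1 : ∀ k, Matrix.vecMulVec (A k *ᵥ x) (star (A k *ᵥ x)) (m, i) (m, i) =
        ((‖(A k *ᵥ x) (m, i)‖ ^ 2 : ℝ) : ℂ) := fun k => by
      rw [Matrix.vecMulVec_apply, Pi.star_apply, RCLike.star_def, Complex.mul_conj']
      push_cast
      rfl
    rw [Finset.sum_congr rfl fun k _ => e1 k, ← Complex.ofReal_sum] at e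
    rw [← Complex.ofReal_re (∑ k, _), e]
    simp only [etaRow, Matrix.of_apply, if_true]
    rw [show (1 / (N : ℂ)) = ((1 / N : ℝ) : ℂ) by push_cast; rfl, Complex.re_ofReal_mul]
    congr 2
    simp only [dotProduct, Matrix.mulVec, toep, Matrix.of_apply, star_star, Pi.star_apply,
      Finset.mul_sum, Matrix.vecMulVec_apply]
    refine Finset.sum_congr rfl fun j _ => Finset.sum_congr rfl fun j' _ => ?_
    rw [sub_self, zero_add]
    ring
  simp only [h2]
  rw [Finset.sum_comm, Finset.sum_congr rfl fun i _ => h3 i]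
  have h4 := toep_quad_le (hS m) (hb m) (star x)
  have h5 : nsq (star x) = nsq x := by simp [nsq]
  rw [h5] at h4
  rw [Finset.sum_const, Finset.card_univ, Fintype.card_fin, nsmul_eq_mul]
  calc (L : ℝ) * (1 / N * (star (star x) ⬝ᵥ (toep (corr (S m)) N *ᵥ star x)).re)
      ≤ L * (1 / N * (b * nsq x)) := by gcongr
    _ = _ := by ring

end Comparison

/-! ### The quantitative comparison -/

section Quantitative

variable {M L N : ℕ} {S : ℕ → ℝ → ℝ} {μ : Measure (Fin M × Fin (N + L - 1) → ℂ)} {ζ : ℂ}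
  {A : Fin M × Fin (N + L - 1) → Matrix (Fin M × Fin L) (Fin N) ℂ} {b K κ s u : ℝ}

/-- The standing assumptions on the dimensions, the spectral densities, and the point `ζ`. -/
structure Setting (μ : Measure (Fin M × Fin (N + L - 1) → ℂ)) (S : ℕ → ℝ → ℝ)
    (A : Fin M × Fin (N + L - 1) → Matrix (Fin M × Fin L) (Fin N) ℂ) (ζ : ℂ)
    (b K κ s u : ℝ) : Prop where
  noise : IsNoise μ S
  integrable : ∀ m, IntervalIntegrable (S m) volume 0 1
  pos_M : 0 < M
  pos_L : 0 < L
  pos_N : 0 < N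
  b_nonneg : 0 ≤ b
  le_b : ∀ m, ∀ ν ∈ Set.Icc (0 : ℝ) 1, S m ν ≤ b
  summable : Summable (rho S M)
  tsum_le : ∑' n, rho S M n ≤ K
  kmap_eq : ∀ B, kmap A B = etaRow S M L B
  kmap_adj_eq : ∀ C, kmap (adj A) C = etaCol S N C
  one_le_κ : 1 ≤ κ
  dim_le : (M : ℝ) * L ≤ κ * N
  s_pos : 0 < s
  kraus : KrausBound A s
  kraus_adj : KrausBound (adj A) s
  im_pos : 0 < ζ.im
  -- u stands for an upper bound of 1/Im ζ; being at least 1, it lets smaller powers be absorbed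
  -- into larger ones.
  one_le_u : 1 ≤ u
  inv_le_u : 1 / ζ.im ≤ u

namespace Setting

variable (h : Setting (L := L) μ S A ζ b K κ s u)
include h

theorem K_nonneg : 0 ≤ K := (tsum_nonneg fun _ => rho_nonneg _).trans h.tsum_le

theorem opNorm_auxCol_le : ‖auxCol (L := L) μ S ζ‖ ≤ u :=
  (opNorm_negInv_le h.im_pos (h.noise.imq_etaCol_meanRow_nonneg h.im_pos h.kmap_adj_eq)).trans
    h.inv_le_u

theorem opNorm_auxRow_le : ‖auxRow (L := L) μ S ζ‖ ≤ u :=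
  (opNorm_negInv_le h.im_pos
    (h.noise.imq_etaRow_auxCol_nonneg h.im_pos h.kmap_eq h.kmap_adj_eq)).trans h.inv_le_u

theorem opNorm_meanRow_le : ‖meanRow (L := L) μ ζ‖ ≤ u :=
  (h.noise.opNorm_meanRow_le h.im_pos).trans h.inv_le_u

theorem sqrt_dim_le : √M * √L ≤ κ * √N := by
  have hκ := h.one_le_κ
  rw [← sq_le_sq₀ (by positivity) (by positivity), mul_pow, mul_pow,
    Real.sq_sqrt (by positivity), Real.sq_sqrt (by positivity), Real.sq_sqrt (by positivity)]
  refine h.dim_le.trans ?_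
  have : κ ≤ κ ^ 2 := by nlinarith
  gcongr

theorem norm_trace_mul_meanRow_sub_le {B : Matrix (Fin M × Fin L) (Fin M × Fin L) ℂ} {β γ : ℝ}
    (hβ : 0 ≤ β) (hB : ∀ m : Fin M, hs (B * auxRow μ S ζ * blockProj L m) ≤ β)
    (hγ : hs (etaCol S N (meanRow μ ζ * B * auxRow μ S ζ) * auxCol (L := L) μ S ζ) ≤ γ) :
    ‖(B * (meanRow μ ζ - auxRow μ S ζ)).trace‖ ≤
      Real.pi ^ 2 * b * K * u ^ 4 *
        (L ^ 2 * √M / N ^ 2 * √N * β + L ^ 2 / N ^ 2 * (√M * √L) * γ) := by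
  have hM : M ≠ 0 := h.pos_M.ne'
  have hK := h.K_nonneg
  have hb := h.b_nonneg
  have hγ0 : 0 ≤ γ := (hs_nonneg _).trans hγ
  rw [h.noise.trace_mul_meanRow_sub h.im_pos h.kmap_eq h.kmap_adj_eq]
  refine (norm_add_le _ _).trans ((add_le_add
    (h.noise.norm_trace_mul_errRow_le_of_blockProj h.integrable h.b_nonneg h.le_b h.im_pos hM
      h.summable h.tsum_le hβ hB)
    (h.noise.norm_trace_mul_errCol_le_hs h.integrable h.b_nonneg h.le_b h.im_pos hM
      h.summable h.tsum_le _)).trans ?_)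
  rw [← mul_add]
  have h0 : 0 ≤ 1 / ζ.im := by have := h.im_pos; positivity
  have h1 := h.inv_le_u
  have h2 := hs_nonneg
    (etaCol S N (meanRow μ ζ * B * auxRow μ S ζ) * auxCol (L := L) μ S ζ)
  gcongr

/-- For a general B, the blocks of B R have Hilbert–Schmidt norm at most ‖B‖ u √L, and the column
term costs √N. In both contributions √(ML) ≤ κ √N leaves L²/N. -/
theorem norm_trace_mul_meanRow_sub_le_opNorm (B : Matrix (Fin M × Fin L) (Fin M × Fin L) ℂ) :
    ‖(B * (meanRow μ ζ - auxRow μ S ζ)).trace‖ ≤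
      Real.pi ^ 2 * b * K * κ * (1 + s) * u ^ 7 * (L ^ 2 / N) * ‖B‖ := by
  have hu := h.one_le_u
  have hu0 : 0 ≤ u := by linarith
  have hs0 := h.s_pos
  have hK := h.K_nonneg
  have hb := h.b_nonneg
  have hN : (0 : ℝ) < N := by exact_mod_cast h.pos_N
  have h1 := h.opNorm_auxRow_le
  have h2 := h.opNorm_auxCol_le
  have h3 := h.opNorm_meanRow_le
  have hB : ∀ m : Fin M, hs (B * auxRow μ S ζ * blockProj L m) ≤ ‖B‖ * u * √L := fun m => by
    refine (hs_mul_le_opNorm_mul _ _).trans ?_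
    rw [hs_blockProj]
    gcongr
    exact (norm_mul_le _ _).trans (by gcongr)
  have hγ : hs (etaCol S N (meanRow μ ζ * B * auxRow μ S ζ) * auxCol (L := L) μ S ζ) ≤
      s * (u * ‖B‖ * u) * u * √N := by
    refine (hs_le_opNorm _).trans ?_
    rw [Fintype.card_fin, ← h.kmap_adj_eq]
    gcongr
    refine (norm_mul_le _ _).trans ?_
    gcongr
    refine (opNorm_kmap_le hs0.le h.kraus_adj _).trans ?_
    gcongr
    refine (norm_mul_le _ _).trans ?_
    gcongr
    exact (norm_mul_le _ _).trans (by gcongr)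
  refine (h.norm_trace_mul_meanRow_sub_le (by positivity) hB hγ).trans ?_
  have e1 : Real.pi ^ 2 * b * K * u ^ 4 * (L ^ 2 * √M / N ^ 2 * √N * (‖B‖ * u * √L) +
      L ^ 2 / N ^ 2 * (√M * √L) * (s * (u * ‖B‖ * u) * u * √N)) =
      Real.pi ^ 2 * b * K * (u ^ 5 + s * u ^ 7) * (L ^ 2 / N ^ 2 * √N) * ‖B‖ * (√M * √L) := by ring
  rw [e1]
  have h4 := h.sqrt_dim_le
  have h5 : u ^ 5 ≤ u ^ 7 := pow_le_pow_right₀ hu (by norm_num)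
  calc _ ≤ Real.pi ^ 2 * b * K * (u ^ 7 + s * u ^ 7) * (L ^ 2 / N ^ 2 * √N) * ‖B‖ *
        (κ * √N) := by gcongr
    _ = Real.pi ^ 2 * b * K * κ * (1 + s) * u ^ 7 * (L ^ 2 / N ^ 2 * (√N * √N)) * ‖B‖ := by ring
    _ = _ := by
        rw [Real.mul_self_sqrt hN.le]
        field_simp

/-- By adjunction the form at x is the trace of F - R against η(x xᴴ). Its blocks have norm at most
bL/N times the squared norm of x, which turns the estimate into L^(3/2)/(MN) times powers of ML/N ≤
κ. -/
theorem abs_imq_etaCol_meanRow_sub_le (x : Fin N → ℂ) :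
    |imq (etaCol S N (meanRow μ ζ - auxRow (L := L) μ S ζ)) x| ≤
      Real.pi ^ 2 * b ^ 2 * K * κ ^ 2 * (1 + s) * u ^ 7 * (L * √L / (M * N)) * nsq x := by
  have hu := h.one_le_u
  have hu0 : 0 ≤ u := by linarith
  have hs0 := h.s_pos
  have hK := h.K_nonneg
  have hb := h.b_nonneg
  have hκ := h.one_le_κ
  have hN : (0 : ℝ) < N := by exact_mod_cast h.pos_N
  have hM : (0 : ℝ) < M := by exact_mod_cast h.pos_M
  have hL : (0 : ℝ) < L := by exact_mod_cast h.pos_L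
  have h1 := h.opNorm_auxRow_le
  have h2 := h.opNorm_auxCol_le
  have h3 := h.opNorm_meanRow_le
  have hx := nsq_nonneg x
  set B := etaRow S M L (Matrix.vecMulVec x (star x)) with hBdef
  have e0 : star x ⬝ᵥ (etaCol S N (meanRow μ ζ - auxRow (L := L) μ S ζ) *ᵥ x) =
      (B * (meanRow μ ζ - auxRow μ S ζ)).trace := by
    have e : adj (adj A) = A := by funext k; simp [adj]
    rw [← trace_vecMulVec_star_mul, ← h.kmap_adj_eq, trace_mul_kmap, e, h.kmap_eq]
  rw [imq, e0]
  refine (Complex.abs_im_le_norm _).trans ?_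
  set t := b * L / N * nsq x with ht
  have ht0 : 0 ≤ t := by positivity
  have hBm : ∀ m : Fin M, hs (B * blockProj L m) ≤ t := fun m =>
    hs_etaRow_vecMulVec_mul_blockProj_le h.integrable h.le_b h.kmap_eq x m
  have hB : ∀ m : Fin M, hs (B * auxRow μ S ζ * blockProj L m) ≤ t * u := fun m => by
    rw [Matrix.mul_assoc, ← h.noise.blockProj_mul_auxRow h.im_pos h.kmap_eq h.kmap_adj_eq,
      ← Matrix.mul_assoc]
    exact (hs_mul_le_mul_opNorm _ _).trans (mul_le_mul (hBm m) h1 (norm_nonneg _) ht0)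
  have hB2 : hs B ≤ √M * t := hs_le_of_blockProj ht0 hBm
  have hγ : hs (etaCol S N (meanRow μ ζ * B * auxRow μ S ζ) * auxCol (L := L) μ S ζ) ≤
      s * (u * (√M * t) * u) * u := by
    refine (hs_mul_le_mul_opNorm _ _).trans ?_
    refine mul_le_mul ?_ h2 (norm_nonneg _) (by positivity)
    rw [← h.kmap_adj_eq]
    have e : adj (adj A) = A := by funext k; simp [adj]
    refine (hs_kmap_le hs0.le h.kraus_adj (e.symm ▸ h.kraus) _).trans ?_
    refine mul_le_mul_of_nonneg_left ?_ hs0.le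
    refine (hs_mul_le_mul_opNorm _ _).trans (mul_le_mul ?_ h1 (norm_nonneg _) (by positivity))
    exact (hs_mul_le_opNorm_mul _ _).trans (mul_le_mul h3 hB2 (hs_nonneg _) hu0)
  refine (h.norm_trace_mul_meanRow_sub_le (by positivity) hB hγ).trans ?_
  have h4 := h.sqrt_dim_le
  have h5 : u ^ 5 ≤ u ^ 7 := pow_le_pow_right₀ hu (by norm_num)
  have hd := h.dim_le
  have sM := Real.mul_self_sqrt hM.le
  have sL := Real.mul_self_sqrt hL.le
  have sN := Real.mul_self_sqrt hN.le
  have k1 : L ^ 2 * √M / N ^ 2 * √N * (L / N) ≤ κ ^ 2 * (L * √L / (M * N)) := by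
    have : L ^ 2 * √M / N ^ 2 * √N * (L / N) =
        (L * √L / (M * N)) * ((M * L / N) * (√M * √L * √N / N)) := by
      field_simp
      rw [pow_two √L, sL]
    rw [this, mul_comm (κ ^ 2)]
    refine mul_le_mul_of_nonneg_left ?_ (by positivity)
    rw [pow_two]
    refine mul_le_mul ?_ ?_ (by positivity) (by positivity)
    · rwa [div_le_iff₀ hN]
    · rw [div_le_iff₀ hN]
      calc _ ≤ κ * √N * √N := by gcongr
        _ = κ * N := by rw [mul_assoc, sN]
  have k2 : L ^ 2 / N ^ 2 * (√M * √L) * √M * (L / N) ≤ κ ^ 2 * (L * √L / (M * N)) := by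
    have : L ^ 2 / N ^ 2 * (√M * √L) * √M * (L / N) =
        (L * √L / (M * N)) * ((M * L / N) * (M * L / N)) := by
      have : L ^ 2 / N ^ 2 * (√M * √L) * √M * (L / N) =
        L ^ 2 / N ^ 2 * (√M * √M) * √L * (L / N) := by ring
      rw [this, sM]
      field_simp
    rw [this, mul_comm (κ ^ 2)]
    refine mul_le_mul_of_nonneg_left ?_ (by positivity)
    rw [pow_two]
    have k3 : (M * L / N : ℝ) ≤ κ := by rwa [div_le_iff₀ hN]
    exact mul_le_mul k3 k3 (by positivity) (by positivity)
  calc Real.pi ^ 2 * b * K * u ^ 4 * (L ^ 2 * √M / N ^ 2 * √N * (t * u) +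
        L ^ 2 / N ^ 2 * (√M * √L) * (s * (u * (√M * t) * u) * u))
      = Real.pi ^ 2 * b ^ 2 * K * nsq x * (u ^ 5 * (L ^ 2 * √M / N ^ 2 * √N * (L / N)) +
          s * u ^ 7 * (L ^ 2 / N ^ 2 * (√M * √L) * √M * (L / N))) := by rw [ht]; ring
    _ ≤ Real.pi ^ 2 * b ^ 2 * K * nsq x * (u ^ 7 * (κ ^ 2 * (L * √L / (M * N))) +
          s * u ^ 7 * (κ ^ 2 * (L * √L / (M * N)))) := by gcongr
    _ = _ := by ring

/-- The comparison of the mean resolvent with the solution of the canonical equation. -/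
theorem norm_trace_mul_meanRow_sub_solution_le {T : Matrix (Fin M × Fin L) (Fin M × Fin L) ℂ}
    {T' : Matrix (Fin N) (Fin N) ℂ} (hT0 : ∀ x, 0 ≤ imq T x) (hT0' : ∀ x, 0 ≤ imq T' x)
    (hT : T = negInv ζ (etaRow S M L T')) (hT' : T' = negInv ζ (etaCol S N T))
    (hsmall : 2 * (Real.pi ^ 2 * b ^ 2 * K * κ ^ 2 * (1 + s)) * u ^ 8 * (L * √L / (M * N)) ≤ 1)
    (B : Matrix (Fin M × Fin L) (Fin M × Fin L) ℂ) :
    ‖(B * (meanRow μ ζ - T)).trace‖ ≤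
      Real.pi ^ 2 * b * K * κ * (1 + s) * (1 + 2 * s ^ 2) * u ^ 11 * (L ^ 2 / N) * ‖B‖ := by
  have hu := h.one_le_u
  have hu0 : 0 ≤ u := by linarith
  have hs0 := h.s_pos
  have hK := h.K_nonneg
  have hb := h.b_nonneg
  have hκ := h.one_le_κ
  have hy := h.im_pos
  have h1 := norm_trace_mul_sub_le hs0 h.kraus h.kraus_adj hy (T := T) (T' := T')
    (F := meanRow μ ζ) (R := auxRow μ S ζ) (R' := auxCol (L := L) μ S ζ) hT0 hT0'
    (h.noise.imq_meanRow_nonneg hy) (by rw [h.kmap_eq, ← hT]) (by rw [h.kmap_adj_eq, ← hT'])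
    (by rw [h.kmap_adj_eq, auxCol]) (by rw [h.kmap_eq, auxRow]) ?_
    (ε := Real.pi ^ 2 * b * K * κ * (1 + s) * u ^ 7 * (L ^ 2 / N)) (by positivity)
    h.norm_trace_mul_meanRow_sub_le_opNorm B
  · refine h1.trans ?_
    have h2 : 1 + 2 * s ^ 2 / ζ.im ^ 4 ≤ (1 + 2 * s ^ 2) * u ^ 4 := by
      have h3 : (1 / ζ.im) ^ 4 ≤ u ^ 4 := pow_le_pow_left₀ (by positivity) h.inv_le_u 4
      have h4 : 1 ≤ u ^ 4 := one_le_pow₀ hu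
      rw [one_div, inv_pow] at h3
      rw [div_eq_mul_inv, add_mul, one_mul]
      gcongr
    calc _ ≤ Real.pi ^ 2 * b * K * κ * (1 + s) * u ^ 7 * (L ^ 2 / N) * ‖B‖ *
          ((1 + 2 * s ^ 2) * u ^ 4) := by gcongr
      _ = _ := by ring
  · intro x
    rw [h.kmap_adj_eq]
    refine (h.abs_imq_etaCol_meanRow_sub_le x).trans ?_
    refine mul_le_mul_of_nonneg_right ?_ (nsq_nonneg x)
    -- The hypothesis `hsmall` has one power of u more than the estimate of the form; this power is
    -- traded for the threshold Im ζ/2 required by stability.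
    have h5 : 1 ≤ u * ζ.im := by
      have := h.inv_le_u
      rwa [div_le_iff₀ hy] at this
    set C := Real.pi ^ 2 * b ^ 2 * K * κ ^ 2 * (1 + s) with hC
    have h6 : 0 ≤ C * u ^ 7 * (L * √L / (M * N)) := by positivity
    calc C * u ^ 7 * (L * √L / (M * N)) ≤ C * u ^ 7 * (L * √L / (M * N)) * (u * ζ.im) :=
          le_mul_of_one_le_right h6 h5
      _ = (2 * C * u ^ 8 * (L * √L / (M * N))) * (ζ.im / 2) := by ring
      _ ≤ 1 * (ζ.im / 2) := by gcongr
      _ = _ := one_mul _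

end Setting

end Quantitative

/-! ### From the Hermitization back to the resolvent and the canonical equation -/

section Link

theorem isClosed_halfLine : IsClosed halfLine :=
  Complex.isometry_ofReal.isClosedEmbedding.isClosedMap _ isClosed_Ici

theorem delta_pos {z : ℂ} (hz : z ∉ halfLine) : 0 < delta z :=
  (isClosed_halfLine.notMem_iff_infDist_pos ⟨0, 0, by simp, by simp⟩).1 hz

theorem exists_sqrt {z : ℂ} (hz : z ∉ halfLine) : ∃ ζ : ℂ, ζ ^ 2 = z ∧ 0 < ζ.im := by
  obtain ⟨ζ, hζ⟩ := IsAlgClosed.exists_pow_nat_eq z (n := 2) two_pos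
  rcases lt_trichotomy ζ.im 0 with h | h | h
  · exact ⟨-ζ, by rw [neg_sq, hζ], by simpa using h⟩
  · refine absurd ⟨ζ.re ^ 2, by simp [sq_nonneg], ?_⟩ hz
    rw [← hζ, ← Complex.re_add_im ζ, h]
    simp
  · exact ⟨ζ, hζ, h⟩

theorem sq_notMem_halfLine {ζ : ℂ} (hζ : 0 < ζ.im) : ζ ^ 2 ∉ halfLine := by
  rintro ⟨t, ht, h⟩
  have h1 := congrArg Complex.im h
  have h2 := congrArg Complex.re h
  simp only [pow_two, Complex.ofReal_im, Complex.mul_im, Complex.ofReal_re, Complex.mul_re] at h1 h2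
  have h3 : ζ.re = 0 := by nlinarith
  rw [h3] at h2
  have : (0 : ℝ) ≤ t := ht
  nlinarith

/-- z is compared with the point (Re ζ)² of the half line: the difference is i Im ζ (Re ζ + ζ), and
2|ζ| ≤ 1 + |ζ|² = 1 + |z|. -/
theorem delta_le {z ζ : ℂ} (h : ζ ^ 2 = z) (hζ : 0 < ζ.im) :
    delta z ≤ ζ.im * (1 + ‖z‖) := by
  have h1 : delta z ≤ dist z ((ζ.re ^ 2 : ℝ) : ℂ) :=
    Metric.infDist_le_dist_of_mem ⟨ζ.re ^ 2, by simp [sq_nonneg], rfl⟩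
  refine h1.trans ?_
  have h2 : z - ((ζ.re ^ 2 : ℝ) : ℂ) = (ζ.im * Complex.I) * (ζ.re + ζ) := by
    rw [← h]
    apply Complex.ext <;> simp [pow_two] <;> ring
  rw [Complex.dist_eq, h2, norm_mul]
  have h3 : ‖(ζ.im * Complex.I : ℂ)‖ = ζ.im := by simp [abs_of_pos hζ]
  rw [h3]
  refine mul_le_mul_of_nonneg_left ?_ hζ.le
  have h4 : ‖(ζ.re : ℂ) + ζ‖ ≤ ‖ζ‖ + ‖ζ‖ := by
    refine (norm_add_le _ _).trans (add_le_add_left ?_ _)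
    rw [Complex.norm_real]
    exact Complex.abs_re_le_norm ζ
  have h5 : ‖z‖ = ‖ζ‖ ^ 2 := by rw [← h, norm_pow]
  rw [h5]
  nlinarith [sq_nonneg (‖ζ‖ - 1)]

theorem inv_im_le {z ζ : ℂ} (h : ζ ^ 2 = z) (hζ : 0 < ζ.im) :
    1 / ζ.im ≤ (1 + ‖z‖) * (1 + 1 / delta z) := by
  have h0 : 0 < delta z := delta_pos (h ▸ sq_notMem_halfLine hζ)
  have h1 := delta_le h hζ
  have h2 : 1 / ζ.im ≤ (1 + ‖z‖) * (1 / delta z) := by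
    rw [mul_one_div, div_le_div_iff₀ hζ h0]
    linarith
  have h3 : 0 ≤ ‖z‖ := norm_nonneg z
  linarith

variable {M L N : ℕ}

/-- The first block column of (X - ζ) G = 1 reads W G₂₁ - ζ G₁₁ = 1 and Wᴴ G₁₁ = ζ G₂₁; eliminating
G₂₁ gives the claim. -/
theorem resolvent_eq {x : Fin M × Fin (N + L - 1) → ℂ} {ζ : ℂ} (hζ : 0 < ζ.im) :
    resolvent (hank x : Matrix (Fin M × Fin L) (Fin N) ℂ) (ζ ^ 2) =
      ζ⁻¹ • (gres (herm (L := L) x) ζ).toBlocks₁₁ := by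
  have hζ0 : ζ ≠ 0 := fun h => by simp [h] at hζ
  set W := (hank x : Matrix (Fin M × Fin L) (Fin N) ℂ) with hW
  set G := gres (herm (L := L) x) ζ with hG
  have h1 : (herm (L := L) x - ζ • 1) * G = 1 := sub_smul_mul_gres (herm_isHermitian x) hζ
  have h2 : herm (L := L) x - ζ • 1 =
      Matrix.fromBlocks (-(ζ • 1)) W Wᴴ (-(ζ • (1 : Matrix (Fin N) (Fin N) ℂ))) := by
    rw [herm, ← Matrix.fromBlocks_one, Matrix.fromBlocks_smul, sub_eq_add_neg,
      Matrix.fromBlocks_neg, Matrix.fromBlocks_add]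
    simp [hW]
  rw [h2, ← Matrix.fromBlocks_toBlocks G, Matrix.fromBlocks_multiply, ← Matrix.fromBlocks_one,
    Matrix.fromBlocks_inj] at h1
  obtain ⟨h3, -, h4, -⟩ := h1
  simp only [Matrix.neg_mul, Matrix.smul_mul, Matrix.one_mul] at h3 h4
  have h5 : W * (Wᴴ * G.toBlocks₁₁) = ζ • (W * G.toBlocks₂₁) := by
    rw [← Matrix.mul_smul, add_neg_eq_zero.1 h4]
  rw [resolvent]
  refine Matrix.inv_eq_right_inv ?_
  have h6 : W * G.toBlocks₂₁ = 1 + ζ • G.toBlocks₁₁ := by rw [← h3]; abel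
  rw [Matrix.sub_mul, Matrix.mul_smul, Matrix.mul_assoc, h5, h6]
  simp only [Matrix.smul_mul, Matrix.one_mul, Matrix.mul_smul, smul_add, smul_smul]
  rw [show ζ⁻¹ * ζ = 1 from inv_mul_cancel₀ hζ0, one_smul,
    show ζ⁻¹ * ζ ^ 2 = ζ by field_simp]
  rw [show ζ⁻¹ * (ζ * ζ) = ζ by field_simp]
  abel

/-! ### Transfer from the random family to its law. -/

section Family

variable {Ω : Type*} [MeasurableSpace Ω] {P : Measure Ω} {S : ℕ → ℝ → ℝ}
  {w : Fin M → Fin (N + L - 1) → Ω → ℂ}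

/-- The law of an input family. -/
def law (P : Measure Ω) (w : Fin M → Fin (N + L - 1) → Ω → ℂ) :
    Measure (Fin M × Fin (N + L - 1) → ℂ) :=
  P.map fun ω p => w p.1 p.2 ω

theorem IsInputFamily.isNoise (h : IsInputFamily P S M L N w) : IsNoise (law P w) S := by
  have hm := h.gaussian.aemeasurable
  have hg : IsGaussian (law P w) := h.gaussian.isGaussian_map
  refine ⟨hg, ?_, fun a b => ?_, fun a b => ?_⟩
  · have hi : Integrable id (law P w) := IsGaussian.integrable_id
    ext p
    have h1 := (ContinuousLinearMap.proj (R := ℂ) (φ := fun _ => ℂ) p).integral_comp_comm hi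
    simp only [ContinuousLinearMap.proj_apply, id] at h1
    rw [Pi.zero_apply, ← h.mean p.1 p.2]
    simp only [id]
    rw [← h1, law, integral_map hm (continuous_apply p).aestronglyMeasurable]
  · rw [law, integral_map hm (Continuous.aestronglyMeasurable (by fun_prop)), h.cov]
  · rw [law, integral_map hm (Continuous.aestronglyMeasurable (by fun_prop)), h.pseudoCov]

theorem IsInputFamily.meanResolvent_eq (h : IsInputFamily P S M L N w) {ζ : ℂ} (hζ : 0 < ζ.im) :
    meanResolvent P w (ζ ^ 2) = ζ⁻¹ • meanRow (L := L) (law P w) ζ := by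
  have hm := h.gaussian.aemeasurable
  ext p q
  simp only [meanResolvent, meanRow, Matrix.of_apply, Matrix.smul_apply, smul_eq_mul]
  have h1 : ∀ ω, resolvent (hankel (L := L) fun m n => w m n ω) (ζ ^ 2) p q = ζ⁻¹ *
      gres (hermCLM M L N fun p => w p.1 p.2 ω) ζ (Sum.inl p) (Sum.inl q) := fun ω => by
    have := resolvent_eq (L := L) (x := fun p : Fin M × Fin (N + L - 1) => w p.1 p.2 ω) hζ
    exact congrFun (congrFun this p) q
  simp only [h1]
  rw [integral_const_mul, law, integral_map hm]
  exact ((entryCLM _ _).continuous.comp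
    (continuous_gres hermCLM_isHermitian hζ)).aestronglyMeasurable

end Family

/-! ### The canonical pair in the variable ζ. -/

theorem quad_apply {ι : Type*} [Fintype ι] (ν : PosMatrixMeasure ι) (x : ι → ℂ) {s : Set ℝ}
    (hs : MeasurableSet s) :
    ν.quad x s = ENNReal.ofReal (star x ⬝ᵥ (ν.toVectorMeasure s *ᵥ x)).re := by
  rw [PosMatrixMeasure.quad, SignedMeasure.toMeasureOfZeroLE_apply _ _ _ hs]
  rw [ENNReal.ofReal, Real.toNNReal_of_nonneg]
  · simp [quadForm]
  · exact (Complex.nonneg_iff.1 ((ν.posSemidef s).dotProduct_mulVec_nonneg x)).1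

theorem im_mul_inv_sub_sq_nonneg {ζ : ℂ} (hζ : 0 < ζ.im) {t : ℝ} (ht : 0 ≤ t) :
    0 ≤ (ζ * ((t : ℂ) - ζ ^ 2)⁻¹).im := by
  rw [Complex.inv_def, ← mul_assoc, Complex.im_mul_ofReal]
  refine mul_nonneg ?_ (inv_nonneg.2 (Complex.normSq_nonneg _))
  simp only [Complex.mul_im, map_sub, map_pow, Complex.conj_ofReal, pow_two, Complex.sub_im,
    Complex.sub_re, Complex.ofReal_re, Complex.ofReal_im, Complex.mul_re, Complex.conj_re,
    Complex.conj_im]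
  have : 0 ≤ ζ.im * (t + ζ.re ^ 2 + ζ.im ^ 2) := by positivity
  linarith

/-- For t ≥ 0 the function ζ/(t - ζ²) maps the upper half plane to itself. This provides the
dissipativity that the stability estimate asks of a solution. -/
theorem IsStieltjes.imq_smul_nonneg {ι : Type*} [Fintype ι] [DecidableEq ι]
    {F : ℂ → Matrix ι ι ℂ} (h : IsStieltjes F) {ζ : ℂ} (hζ : 0 < ζ.im) (x : ι → ℂ) :
    0 ≤ imq (ζ • F (ζ ^ 2)) x := by
  obtain ⟨ν, -, h0, h1⟩ := h
  rw [imq, Matrix.smul_mulVec, dotProduct_smul, smul_eq_mul, h1 _ (sq_notMem_halfLine hζ),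
    ← integral_const_mul]
  by_cases hi : Integrable (fun t : ℝ => ζ * ((t : ℂ) - ζ ^ 2)⁻¹) (ν.quad x)
  · have h2 := integral_im (𝕜 := ℂ) hi
    simp only [RCLike.im_eq_complex_im] at h2
    rw [← h2]
    refine integral_nonneg_of_ae ?_
    have h3 : ν.quad x (Set.Iio 0) = 0 := by
      rw [quad_apply ν x measurableSet_Iio, h0]
      simp
    have h4 : ∀ᵐ t ∂ν.quad x, 0 ≤ t := by
      rw [ae_iff]
      simp only [not_le]
      exact h3
    filter_upwards [h4] with t ht
    exact im_mul_inv_sub_sq_nonneg hζ ht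
  -- Without integrability the integral is 0 by convention, and the inequality is still true.
  · rw [integral_undef hi]
    simp

/-- Multiplication by ζ puts the equation in the form -(ζ + η(·))⁻¹. Dissipativity forces 1 + Y to
be invertible, so the inverse in the canonical equation is a genuine one. -/
theorem smul_eq_negInv {n : Type*} [Fintype n] [DecidableEq n] {ζ : ℂ} (hζ : 0 < ζ.im)
    {Y T : Matrix n n ℂ} (hY : ∀ x, 0 ≤ imq (ζ • Y) x) (hT : T = (-(ζ ^ 2)⁻¹) • (1 + Y)⁻¹) :
    ζ • T = negInv ζ (ζ • Y) := by
  have hζ0 : ζ ≠ 0 := fun h => by simp [h] at hζ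
  have h1 := isUnit_det_smul_one_add hζ hY
  rw [← smul_add] at h1
  have h2 : IsUnit (1 + Y).det := by
    rw [Matrix.det_smul] at h1
    exact isUnit_of_mul_isUnit_right h1
  rw [negInv, ← smul_add, eq_neg_iff_add_eq_zero, ← neg_neg (ζ • T), neg_add_eq_zero]
  symm
  refine Matrix.inv_eq_left_inv ?_
  rw [hT, Matrix.neg_mul, Matrix.smul_mul, Matrix.smul_mul, Matrix.mul_smul,
    Matrix.nonsing_inv_mul _ h2, smul_smul, smul_smul, ← neg_smul]
  rw [show -(ζ * -(ζ ^ 2)⁻¹ * ζ) = 1 by field_simp, one_smul]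

theorem etaRow_smul (S : ℕ → ℝ → ℝ) (c : ℂ) (B : Matrix (Fin N) (Fin N) ℂ) :
    etaRow S M L (c • B) = c • etaRow S M L B := by
  ext p q
  simp only [etaRow, Matrix.of_apply, Matrix.smul_apply, smul_eq_mul, mul_ite, mul_zero]
  split_ifs
  · rw [mul_left_comm, Finset.mul_sum]
    simp only [Finset.mul_sum, mul_assoc]
  · rfl

theorem etaCol_smul (S : ℕ → ℝ → ℝ) (c : ℂ) (C : Matrix (Fin M × Fin L) (Fin M × Fin L) ℂ) :
    etaCol S N (c • C) = c • etaCol S N C := by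
  ext p q
  simp only [etaCol, Matrix.of_apply, Matrix.smul_apply, smul_eq_mul]
  rw [mul_left_comm, Finset.mul_sum]
  simp only [Finset.mul_sum, mul_assoc]

variable {S : ℕ → ℝ → ℝ} {T : ℂ → Matrix (Fin M × Fin L) (Fin M × Fin L) ℂ}
  {T' : ℂ → Matrix (Fin N) (Fin N) ℂ}
  {A : Fin M × Fin (N + L - 1) → Matrix (Fin M × Fin L) (Fin N) ℂ}

theorem IsCanonicalPair.row_eq (h : IsCanonicalPair S M L N T T')
    (hA : ∀ B, kmap A B = etaRow S M L B) {ζ : ℂ} (hζ : 0 < ζ.im) :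
    ζ • T (ζ ^ 2) = negInv ζ (etaRow S M L (ζ • T' (ζ ^ 2))) := by
  rw [etaRow_smul]
  refine smul_eq_negInv hζ (fun x => ?_) ?_
  · rw [← etaRow_smul, ← hA]
    exact imq_kmap_nonneg A (h.stieltjes'.imq_smul_nonneg hζ) x
  · rw [← Psi_transpose]
    exact h.eq _ (sq_notMem_halfLine hζ)

theorem IsCanonicalPair.col_eq (h : IsCanonicalPair S M L N T T') (hM : M ≠ 0) (hL : L ≠ 0)
    (hA' : ∀ C, kmap (adj A) C = etaCol S N C) {ζ : ℂ} (hζ : 0 < ζ.im) :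
    ζ • T' (ζ ^ 2) = negInv ζ (etaCol S N (ζ • T (ζ ^ 2))) := by
  rw [etaCol_smul]
  refine smul_eq_negInv hζ (fun x => ?_) ?_
  · rw [← etaCol_smul, ← hA']
    exact imq_kmap_nonneg _ (h.stieltjes.imq_smul_nonneg hζ) x
  · rw [← smul_PsiBar_transpose hM hL]
    exact h.eq' _ (sq_notMem_halfLine hζ)

end Link

/-! ### The fixed point equation for a completely positive map -/

section FixedPoint

variable {ι κ : Type*} [Fintype ι] [DecidableEq ι] [Fintype κ]

/-- The iterates of `B ↦ -(ζ + ∑ₖ Aₖ B Aₖᴴ)⁻¹`. -/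
def iterM (A : κ → Matrix ι ι ℂ) (ζ : ℂ) : ℕ → Matrix ι ι ℂ
  | 0 => negInv ζ 0
  | n + 1 => negInv ζ (kmap A (iterM A ζ n))

variable {A : κ → Matrix ι ι ℂ} {ζ : ℂ} {s : ℝ}

theorem imq_zero (x : ι → ℂ) : imq (0 : Matrix ι ι ℂ) x = 0 := by simp [imq]

theorem imq_iterM_nonneg (hζ : 0 < ζ.im) (n : ℕ) (x : ι → ℂ) : 0 ≤ imq (iterM A ζ n) x := by
  induction n generalizing x with
  | zero => exact imq_negInv_nonneg hζ (fun x => (imq_zero x).ge) x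
  | succ n ih => exact imq_negInv_nonneg hζ (imq_kmap_nonneg A ih) x

theorem opNorm_iterM_le (hζ : 0 < ζ.im) (n : ℕ) : ‖iterM A ζ n‖ ≤ 1 / ζ.im := by
  cases n with
  | zero => exact opNorm_negInv_le hζ fun x => (imq_zero x).ge
  | succ n => exact opNorm_negInv_le hζ (imq_kmap_nonneg A (imq_iterM_nonneg hζ n))

theorem inv_neg_matrix (X : Matrix ι ι ℂ) : (-X)⁻¹ = -X⁻¹ := by
  by_cases h : IsUnit X.det
  · refine Matrix.inv_eq_left_inv ?_
    rw [Matrix.neg_mul, Matrix.mul_neg, neg_neg, Matrix.nonsing_inv_mul _ h]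
  · have h' : ¬ IsUnit (-X).det := by
      rwa [← Matrix.isUnit_iff_isUnit_det, IsUnit.neg_iff, Matrix.isUnit_iff_isUnit_det]
    rw [Matrix.nonsing_inv_apply_not_isUnit _ h, Matrix.nonsing_inv_apply_not_isUnit _ h', neg_zero]

/-- The reflection ζ ↦ -ζ̄ is a symmetry of the iteration. It later replaces λ by λ² and so produces
a measure on [0, ∞). -/
theorem iterM_neg_conj (n : ℕ) :
    iterM A (-(starRingEnd ℂ) ζ) n = -(iterM A ζ n)ᴴ := by
  have h1 : ∀ B : Matrix ι ι ℂ, negInv (-(starRingEnd ℂ) ζ) (-Bᴴ) = -(negInv ζ B)ᴴ := fun B => by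
    have e : (-(starRingEnd ℂ) ζ) • (1 : Matrix ι ι ℂ) + -Bᴴ = -(ζ • 1 + B)ᴴ := by
      simp [Matrix.conjTranspose_add, Matrix.conjTranspose_smul]
      abel
    rw [negInv, negInv, e, Matrix.conjTranspose_neg, Matrix.conjTranspose_nonsing_inv,
      inv_neg_matrix]
  have h2 : ∀ B : Matrix ι ι ℂ, kmap A (-Bᴴ) = -(kmap A B)ᴴ := fun B => by
    simp [kmap, Matrix.conjTranspose_sum, Matrix.conjTranspose_mul, Matrix.mul_assoc]
  induction n with
  | zero =>
    have := h1 0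
    simpa [iterM] using this
  | succ n ih => rw [iterM, ih, h2, h1, iterM]

/-- The contraction used for stability, with the imaginary parts of two consecutive iterates as
weights. The identities are exact here, so the whole of Im ζ enters the ratio. -/
theorem dom_iterM_sub (hs : 0 < s) (hA : KrausBound A s) (hζ : 0 < ζ.im) (n : ℕ) :
    Dom (iterM A ζ (n + 1) - iterM A ζ n) (imq (iterM A ζ (n + 1))) (imq (iterM A ζ n))
      ((s / ζ.im / (ζ.im + s / ζ.im)) ^ n * (s / ζ.im / ζ.im)) := by
  have hstep : ∀ n, ∀ x, ζ.im * nsq (iterM A ζ (n + 1) *ᵥ x) +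
      ∑ k, imq (iterM A ζ n) ((A k)ᴴ *ᵥ (iterM A ζ (n + 1) *ᵥ x)) ≤
        imq (iterM A ζ (n + 1)) x := fun n x => by
    rw [iterM, imq_negInv_right hζ (imq_kmap_nonneg A (imq_iterM_nonneg hζ n)), imq_kmap]
  have hstep' : ∀ n, ∀ x, ζ.im * nsq ((iterM A ζ (n + 1))ᴴ *ᵥ x) +
      ∑ k, imq (iterM A ζ n) ((A k)ᴴ *ᵥ ((iterM A ζ (n + 1))ᴴ *ᵥ x)) ≤
        imq (iterM A ζ (n + 1)) x := fun n x => by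
    rw [iterM, imq_negInv_left hζ (imq_kmap_nonneg A (imq_iterM_nonneg hζ n)), imq_kmap]
  have hσ : ∀ n, ∀ x, ∑ k, imq (iterM A ζ n) ((A k)ᴴ *ᵥ x) ≤ s / ζ.im * nsq x := fun n x => by
    have := sum_imq_le hA (by positivity) (opNorm_iterM_le (A := A) hζ n) x
    rwa [mul_one_div] at this
  induction n with
  | zero =>
    intro x z
    have h1 : iterM A ζ 1 - iterM A ζ 0 =
        iterM A ζ 1 * kmap A (iterM A ζ 0) * iterM A ζ 0 := by
      have := negInv_sub_negInv hζ (imq_kmap_nonneg A (imq_iterM_nonneg (A := A) hζ 0))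
        (C := 0) (fun x => (imq_zero x).ge)
      rwa [sub_zero] at this
    have h2 : ‖kmap A (iterM A ζ 0)‖ ≤ s / ζ.im := by
      refine (opNorm_kmap_le hs.le hA _).trans ?_
      rw [div_eq_mul_one_div]
      exact mul_le_mul_of_nonneg_left (opNorm_iterM_le hζ 0) hs.le
    have h3 : ζ.im * nsq ((iterM A ζ 1)ᴴ *ᵥ x) ≤ imq (iterM A ζ 1) x := by
      refine le_trans ?_ (hstep' 0 x)
      exact le_add_of_nonneg_right (Finset.sum_nonneg fun _ _ => imq_iterM_nonneg hζ 0 _)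
    have h4 : ζ.im * nsq (iterM A ζ 0 *ᵥ z) ≤ imq (iterM A ζ 0) z := by
      rw [iterM, imq_negInv_right hζ (fun x => (imq_zero x).ge), imq_zero, add_zero]
    rw [h1, star_dotProduct_mul_mul]
    refine (norm_bilin_le _ _ _).trans ?_
    have h5 : √(nsq ((iterM A ζ 1)ᴴ *ᵥ x)) ≤ √(imq (iterM A ζ 1) x) / √ζ.im := by
      rw [← Real.sqrt_div' _ hζ.le]
      exact Real.sqrt_le_sqrt (by rw [le_div_iff₀ hζ]; linarith)
    have h6 : √(nsq (iterM A ζ 0 *ᵥ z)) ≤ √(imq (iterM A ζ 0) z) / √ζ.im := by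
      rw [← Real.sqrt_div' _ hζ.le]
      exact Real.sqrt_le_sqrt (by rw [le_div_iff₀ hζ]; linarith)
    have h7 := Real.mul_self_sqrt hζ.le
    calc _ ≤ s / ζ.im * (√(imq (iterM A ζ 1) x) / √ζ.im) * (√(imq (iterM A ζ 0) z) / √ζ.im) := by
          gcongr
      _ = s / ζ.im / (√ζ.im * √ζ.im) * √(imq (iterM A ζ 1) x) * √(imq (iterM A ζ 0) z) := by
          field_simp
      _ = _ := by rw [h7]; ring
  | succ n ih =>
    have h1 : iterM A ζ (n + 2) - iterM A ζ (n + 1) =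
        iterM A ζ (n + 2) * kmap A (iterM A ζ (n + 1) - iterM A ζ n) * iterM A ζ (n + 1) := by
      have := negInv_sub_negInv hζ (imq_kmap_nonneg A (imq_iterM_nonneg (A := A) hζ (n + 1)))
        (imq_kmap_nonneg A (imq_iterM_nonneg (A := A) hζ n))
      rwa [← kmap_sub] at this
    have h2 := ih.step (T := iterM A ζ (n + 2)) (R := iterM A ζ (n + 1))
      (v' := imq (iterM A ζ (n + 2))) (w' := imq (iterM A ζ (n + 1))) (by positivity)
      (imq_iterM_nonneg hζ (n + 1)) (imq_iterM_nonneg hζ n) A hζ (by positivity)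
      (hσ (n + 1)) (hσ n) (hstep' (n + 1)) (hstep n)
    rw [← h1] at h2
    rw [pow_succ', mul_assoc]
    exact h2

theorem exists_tendsto_iterM (hs : 0 < s) (hA : KrausBound A s) (hζ : 0 < ζ.im) :
    ∃ M, Tendsto (iterM A ζ) atTop (𝓝 M) := by
  set q := s / ζ.im / (ζ.im + s / ζ.im) with hq
  have hq0 : 0 ≤ q := by positivity
  have hq1 : q < 1 := by
    rw [hq, div_lt_one (by positivity)]
    linarith
  have h1 : ∀ n, dist (iterM A ζ n) (iterM A ζ (n + 1)) ≤
      (s / ζ.im / ζ.im) * (1 / ζ.im) * q ^ n := fun n => by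
    rw [dist_comm, dist_eq_norm]
    refine opNorm_le_of_bilin (by positivity) fun x z => ?_
    refine (dom_iterM_sub hs hA hζ n x z).trans ?_
    rw [← hq]
    have h2 : ∀ m y, √(imq (iterM A ζ m) y) ≤ √(1 / ζ.im) * √(nsq y) := fun m y => by
      rw [← Real.sqrt_mul (by positivity)]
      refine Real.sqrt_le_sqrt ((le_abs_self _).trans ((imq_le _ _).trans ?_))
      exact mul_le_mul_of_nonneg_right (opNorm_iterM_le hζ m) (nsq_nonneg y)
    have h3 := Real.mul_self_sqrt (show 0 ≤ 1 / ζ.im by positivity)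
    have h4 := h2 (n + 1) x
    have h5 := h2 n z
    generalize √(imq (iterM A ζ (n + 1)) x) = α at h4 ⊢
    have h6 : 0 ≤ √(imq (iterM A ζ n) z) := Real.sqrt_nonneg _
    generalize √(imq (iterM A ζ n) z) = β at h5 h6 ⊢
    clear_value q
    calc _ ≤ q ^ n * (s / ζ.im / ζ.im) * (√(1 / ζ.im) * √(nsq x)) * (√(1 / ζ.im) * √(nsq z)) := by
          gcongr
      _ = (s / ζ.im / ζ.im) * (√(1 / ζ.im) * √(1 / ζ.im)) * q ^ n * √(nsq x) * √(nsq z) := by ring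
      _ = _ := by rw [h3]
  exact cauchySeq_tendsto_of_complete (cauchySeq_of_le_geometric q _ hq1 h1)

theorem continuous_kmap {p q κ : Type*} [Fintype p] [Fintype q] [DecidableEq q] [DecidableEq p]
    [Fintype κ] (A : κ → Matrix p q ℂ) : Continuous (kmap A) := by
  unfold kmap
  fun_prop

theorem eq_negInv_of_tendsto_iterM (hζ : 0 < ζ.im) {M : Matrix ι ι ℂ}
    (h : Tendsto (iterM A ζ) atTop (𝓝 M)) :
    (∀ x, 0 ≤ imq M x) ∧ M = negInv ζ (kmap A M) := by
  have h0 : ∀ x, 0 ≤ imq M x := fun x => by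
    have hc : Continuous fun B : Matrix ι ι ℂ => imq B x := by
      unfold imq
      fun_prop
    exact ge_of_tendsto' ((hc.tendsto M).comp h) fun n => imq_iterM_nonneg hζ n x
  refine ⟨h0, ?_⟩
  -- The limit is taken in (ζ + η(Mₙ)) Mₙ₊₁ = -1, which involves only continuous operations and no
  -- inverse.
  have h1 : Tendsto (fun n => (ζ • 1 + kmap A (iterM A ζ n)) * iterM A ζ (n + 1)) atTop
      (𝓝 ((ζ • 1 + kmap A M) * M)) :=
    (tendsto_const_nhds.add (((continuous_kmap A).tendsto M).comp h)).mul
      (h.comp (tendsto_add_atTop_nat 1))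
  have h2 : ∀ n, (ζ • 1 + kmap A (iterM A ζ n)) * iterM A ζ (n + 1) = -1 := fun n =>
    smul_one_add_mul_negInv hζ (imq_kmap_nonneg A (imq_iterM_nonneg hζ n))
  simp only [h2] at h1
  have h3 := tendsto_nhds_unique h1 tendsto_const_nhds
  have h4 := negInv_mul_smul_one_add hζ (imq_kmap_nonneg A h0)
  calc M = -(negInv ζ (kmap A M) * (ζ • 1 + kmap A M)) * M := by rw [h4]; simp
    _ = _ := by rw [Matrix.neg_mul, Matrix.mul_assoc, h3]; simp

end FixedPoint

/-! ### Finite dimensional realizations of the iterates -/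

section Realization

theorem mul_blockDiagonal_const_comm {τ κ : Type*} [Fintype τ] [DecidableEq τ] [Fintype κ]
    [DecidableEq κ] {X Y : Matrix τ τ ℂ} (h : X * Y = 1) :
    Matrix.blockDiagonal (fun _ : κ => X) * Matrix.blockDiagonal (fun _ : κ => Y) = 1 := by
  rw [← Matrix.blockDiagonal_mul, h]
  exact Matrix.blockDiagonal_one

theorem hs_mul_of_conjTranspose_mul_self {τ ι κ : Type*} [Fintype τ] [Fintype ι] [DecidableEq ι]
    [Fintype κ] {C : Matrix τ ι ℂ} (hC : Cᴴ * C = 1) (X : Matrix ι κ ℂ) : hs (C * X) = hs X := by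
  rw [← sq_eq_sq₀ (hs_nonneg _) (hs_nonneg _), hs_sq_eq_sum_col, hs_sq_eq_sum_col]
  refine Finset.sum_congr rfl fun j _ => ?_
  have h1 : (fun i => (C * X) i j) = C *ᵥ fun i => X i j := rfl
  have h2 : ((nsq (C *ᵥ fun i => X i j) : ℝ) : ℂ) = (nsq fun i => X i j : ℝ) := by
    rw [← star_dotProduct_self, ← star_dotProduct_self, Matrix.star_mulVec,
      Matrix.dotProduct_mulVec, Matrix.vecMul_vecMul, hC, Matrix.vecMul_one]
  rw [h1]
  exact_mod_cast h2

/-- The iterates are compressions of resolvents of Hermitian matrices with a uniformly bounded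
second moment. -/
theorem exists_realization {ι κ : Type} [Fintype ι] [DecidableEq ι] [Fintype κ] [DecidableEq κ]
    (A : κ → Matrix ι ι ℂ) (n : ℕ) :
    ∃ (τ : Type) (_ : Fintype τ) (_ : DecidableEq τ) (H : Matrix τ τ ℂ) (C : Matrix τ ι ℂ),
      H.IsHermitian ∧ Cᴴ * C = 1 ∧ (∀ ζ : ℂ, 0 < ζ.im → Cᴴ * gres H ζ * C = iterM A ζ n) ∧
      hs (H * C) ^ 2 ≤ ∑ k, hs (A k) ^ 2 := by
  induction n with
  | zero =>
    refine ⟨ι, inferInstance, inferInstance, 0, 1, Matrix.isHermitian_zero, by simp,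
      fun ζ _ => ?_, ?_⟩
    · simp [gres, iterM, negInv]
    · rw [Matrix.zero_mul, hs_zero]
      exact (by norm_num : ((0 : ℝ) ^ 2 = 0)).trans_le (Finset.sum_nonneg fun _ _ => sq_nonneg _)
  | succ n ih =>
    obtain ⟨τ, _, _, H, C, hH, hC, hM, -⟩ := ih
    -- Schur complement: ι is coupled by B to one copy of H for each Kraus operator. The ι-block of
    -- the new resolvent is -(ζ + Bᴴ G B)⁻¹, with G the resolvent of the copies, and Bᴴ G B is the
    -- image of the previous iterate.
    set B : Matrix (τ × κ) ι ℂ := Matrix.of fun p i => (C * (A p.2)ᴴ) p.1 i with hB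
    set D := Matrix.blockDiagonal (fun _ : κ => H) with hD
    have hDh : D.IsHermitian := by
      rw [Matrix.IsHermitian, hD, Matrix.blockDiagonal_conjTranspose]
      congr 1
      funext _
      exact hH
    have hH' : (Matrix.fromBlocks (0 : Matrix ι ι ℂ) Bᴴ B D).IsHermitian := by
      rw [Matrix.IsHermitian, Matrix.fromBlocks_conjTranspose, hDh]
      simp
    obtain ⟨E, hE⟩ : ∃ E : Matrix (ι ⊕ (τ × κ)) ι ℂ, E = Matrix.fromRows 1 0 := ⟨_, rfl⟩
    refine ⟨ι ⊕ (τ × κ), inferInstance, inferInstance, Matrix.fromBlocks 0 Bᴴ B D,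
      E, hH', ?_, fun ζ hζ => ?_, ?_⟩
    · rw [hE, Matrix.conjTranspose_fromRows_eq_fromCols_conjTranspose, Matrix.fromCols_mul_fromRows]
      simp
    · set G := gres (Matrix.fromBlocks 0 Bᴴ B D) ζ with hG
      have h1 := sub_smul_mul_gres hH' hζ
      rw [← hG] at h1
      have h0 : Matrix.fromBlocks 0 Bᴴ B D - ζ • (1 : Matrix (ι ⊕ (τ × κ)) (ι ⊕ (τ × κ)) ℂ) =
          Matrix.fromBlocks (-(ζ • 1)) Bᴴ B (D - ζ • 1) := by
        rw [← Matrix.fromBlocks_one, Matrix.fromBlocks_smul, sub_eq_add_neg,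
          Matrix.fromBlocks_neg, Matrix.fromBlocks_add]
        simp [sub_eq_add_neg]
      rw [h0, ← Matrix.fromBlocks_toBlocks G, Matrix.fromBlocks_multiply, ← Matrix.fromBlocks_one,
        Matrix.fromBlocks_inj] at h1
      obtain ⟨h2, -, h3, -⟩ := h1
      have h4 : Matrix.blockDiagonal (fun _ : κ => gres H ζ) * (D - ζ • 1) = 1 := by
        have e : D - ζ • 1 = Matrix.blockDiagonal (fun _ : κ => H - ζ • 1) := by
          rw [hD]
          ext ⟨i, k⟩ ⟨j, l⟩
          simp only [Matrix.sub_apply, Matrix.smul_apply, Matrix.blockDiagonal_apply,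
            Matrix.one_apply, Prod.mk.injEq]
          by_cases hk : k = l <;> simp [hk]
        rw [e]
        refine mul_blockDiagonal_const_comm ?_
        exact mul_eq_one_comm.1 (sub_smul_mul_gres hH hζ)
      have h5 : G.toBlocks₂₁ =
          -(Matrix.blockDiagonal (fun _ : κ => gres H ζ) * B * G.toBlocks₁₁) := by
        have := congrArg (Matrix.blockDiagonal (fun _ : κ => gres H ζ) * ·) h3
        simp only [Matrix.mul_add, Matrix.mul_zero] at this
        rw [← Matrix.mul_assoc, ← Matrix.mul_assoc, h4, Matrix.one_mul] at this
        exact eq_neg_of_add_eq_zero_right this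
      have h6 : Bᴴ * (Matrix.blockDiagonal (fun _ : κ => gres H ζ) * B) =
          kmap A (iterM A ζ n) := by
        rw [← hM ζ hζ, kmap]
        ext i j
        rw [Matrix.sum_apply]
        have e : ∀ p, (Matrix.blockDiagonal (fun _ : κ => gres H ζ) * B) p j =
            (gres H ζ * (C * (A p.2)ᴴ)) p.1 j := fun p => by
          simp [Matrix.mul_apply, Fintype.sum_prod_type, Matrix.blockDiagonal_apply, hB]
        rw [Matrix.mul_apply]
        simp only [e, Fintype.sum_prod_type]
        rw [Finset.sum_comm]
        refine Finset.sum_congr rfl fun k _ => ?_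
        have e2 : A k * (Cᴴ * gres H ζ * C) * (A k)ᴴ =
            (C * (A k)ᴴ)ᴴ * (gres H ζ * (C * (A k)ᴴ)) := by
          simp only [Matrix.conjTranspose_mul, Matrix.conjTranspose_conjTranspose,
            Matrix.mul_assoc]
        rw [e2, Matrix.mul_apply]
        rfl
      have h7 : Eᴴ * G * E = G.toBlocks₁₁ := by
        ext i j
        simp [Matrix.mul_apply, hE, Matrix.one_apply, Matrix.toBlocks₁₁, apply_ite]
      rw [h7, iterM, negInv, ← neg_eq_iff_eq_neg]
      symm
      refine Matrix.inv_eq_right_inv ?_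
      rw [h5, Matrix.mul_neg, ← Matrix.mul_assoc, h6] at h2
      refine Eq.trans ?_ h2
      simp only [Matrix.add_mul, Matrix.mul_neg, Matrix.neg_mul]
      abel
    -- Applied to the block ι, the new matrix gives B alone. The second moment is therefore bounded
    -- by the Kraus operators at each stage, without accumulating along the induction.
    · have h9 : hs (Matrix.fromBlocks 0 Bᴴ B D * E) ^ 2 = ∑ k, hs (C * (A k)ᴴ) ^ 2 := by
        have h8 : Matrix.fromBlocks 0 Bᴴ B D * E = Matrix.fromRows 0 B := by
          ext (i | i) j <;> simp [Matrix.mul_apply, hE, Matrix.one_apply]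
        simp only [h8, hs_sq, Fintype.sum_sum_type, Matrix.fromRows_apply_inl,
          Matrix.fromRows_apply_inr, Fintype.sum_prod_type]
        rw [Finset.sum_comm (s := (Finset.univ : Finset τ))]
        simp only [Matrix.zero_apply, norm_zero, hB, Matrix.of_apply]
        simp only [ne_eq, OfNat.ofNat_ne_zero, not_false_eq_true, zero_pow,
          Finset.sum_const_zero, zero_add]
      rw [h9]
      refine Finset.sum_le_sum fun k _ => ?_
      rw [hs_mul_of_conjTranspose_mul_self hC, hs_conjTranspose]

/-- The iterates are Stieltjes transforms of finitely supported matrix measures with a uniformly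
bounded second moment. -/
theorem exists_atoms {ι κ : Type} [Fintype ι] [DecidableEq ι] [Fintype κ] [DecidableEq κ]
    (A : κ → Matrix ι ι ℂ) (n : ℕ) :
    ∃ (τ : Type) (_ : Fintype τ) (lam : τ → ℝ) (w : τ → ι → ℂ),
      (∀ ζ : ℂ, 0 < ζ.im → ∀ i j,
        ∑ t, ((lam t : ℂ) - ζ)⁻¹ * (w t i * star (w t j)) = iterM A ζ n i j) ∧
      (∀ i j, ∑ t, w t i * star (w t j) = (1 : Matrix ι ι ℂ) i j) ∧
      ∑ t, lam t ^ 2 * nsq (w t) ≤ ∑ k, hs (A k) ^ 2 := by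
  obtain ⟨τ, _, _, H, C, hH, hC, hM, hm⟩ := exists_realization A n
  set U : Matrix τ τ ℂ := ↑hH.eigenvectorUnitary with hU
  have hU1 : U * Uᴴ = 1 := Unitary.mul_star_self_of_mem hH.eigenvectorUnitary.2
  have hU2 : Uᴴ * U = 1 := Unitary.star_mul_self_of_mem hH.eigenvectorUnitary.2
  set lam := hH.eigenvalues
  have hsp : H = U * Matrix.diagonal (fun t => (lam t : ℂ)) * Uᴴ := by
    have := hH.spectral_theorem
    rw [Unitary.conjStarAlgAut_apply] at this
    exact this
  have hent : ∀ (d : τ → ℂ) i j, (Cᴴ * (U * Matrix.diagonal d * Uᴴ) * C) i j =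
      ∑ t, d t * ((Cᴴ * U) i t * star ((Cᴴ * U) j t)) := fun d i j => by
    have e : Cᴴ * (U * Matrix.diagonal d * Uᴴ) * C =
        (Cᴴ * U) * Matrix.diagonal d * (Cᴴ * U)ᴴ := by
      simp only [Matrix.conjTranspose_mul, Matrix.conjTranspose_conjTranspose, Matrix.mul_assoc]
    rw [e, Matrix.mul_apply]
    refine Finset.sum_congr rfl fun t _ => ?_
    rw [Matrix.mul_diagonal, Matrix.conjTranspose_apply]
    ring
  refine ⟨τ, inferInstance, lam, fun t i => (Cᴴ * U) i t, fun ζ hζ i j => ?_, fun i j => ?_, ?_⟩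
  · rw [← hent, ← hM ζ hζ]
    have hne : ∀ t, (lam t : ℂ) - ζ ≠ 0 := fun t h => by
      have := congrArg Complex.im h
      simp at this
      exact hζ.ne' this
    have h1 : gres H ζ = U * Matrix.diagonal (fun t => ((lam t : ℂ) - ζ)⁻¹) * Uᴴ := by
      have h2 : (H - ζ • 1) * (U * Matrix.diagonal (fun t => ((lam t : ℂ) - ζ)⁻¹) * Uᴴ) = 1 := by
        have h3 : H - ζ • 1 = U * Matrix.diagonal (fun t => (lam t : ℂ) - ζ) * Uᴴ := by
          have h4 : ζ • (1 : Matrix τ τ ℂ) = U * Matrix.diagonal (fun _ => ζ) * Uᴴ := by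
            have : Matrix.diagonal (fun _ : τ => ζ) = ζ • (1 : Matrix τ τ ℂ) := by
              rw [Matrix.smul_one_eq_diagonal]
            rw [this, Matrix.mul_smul, Matrix.mul_one, Matrix.smul_mul, hU1]
          have h5 : Matrix.diagonal (fun t => (lam t : ℂ) - ζ) =
              Matrix.diagonal (fun t => (lam t : ℂ)) - Matrix.diagonal (fun _ => ζ) := by
            rw [Matrix.diagonal_sub]
          rw [h4, h5, Matrix.mul_sub, Matrix.sub_mul, ← hsp]
        rw [h3]
        calc _ = U * Matrix.diagonal (fun t => (lam t : ℂ) - ζ) * (Uᴴ * U) *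
              Matrix.diagonal (fun t => ((lam t : ℂ) - ζ)⁻¹) * Uᴴ := by
              simp only [Matrix.mul_assoc]
          _ = U * (Matrix.diagonal (fun t => (lam t : ℂ) - ζ) *
              Matrix.diagonal (fun t => ((lam t : ℂ) - ζ)⁻¹)) * Uᴴ := by
              rw [hU2]; simp only [Matrix.mul_assoc, Matrix.one_mul]
          _ = 1 := by
              rw [Matrix.diagonal_mul_diagonal]
              simp only [mul_inv_cancel₀ (hne _)]
              rw [Matrix.diagonal_one, Matrix.mul_one, hU1]
      have h6 := mul_eq_one_comm.1 (sub_smul_mul_gres hH hζ)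
      calc gres H ζ = gres H ζ * ((H - ζ • 1) *
            (U * Matrix.diagonal (fun t => ((lam t : ℂ) - ζ)⁻¹) * Uᴴ)) := by
            rw [h2, Matrix.mul_one]
        _ = _ := by rw [← Matrix.mul_assoc, h6, Matrix.one_mul]
    rw [h1]
  · have h1 := hent (fun _ => 1) i j
    simp only [one_mul] at h1
    rw [← h1, Matrix.diagonal_one, Matrix.mul_one, hU1, Matrix.mul_one, hC]
  · refine le_trans (le_of_eq ?_) hm
    have h1 : hs (H * C) = hs (Matrix.diagonal (fun t => (lam t : ℂ)) * (Uᴴ * C)) := by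
      rw [← hs_mul_of_conjTranspose_mul_self hU2 (Matrix.diagonal _ * (Uᴴ * C)),
        ← Matrix.mul_assoc, ← Matrix.mul_assoc, ← hsp]
    rw [h1, hs_sq]
    refine Finset.sum_congr rfl fun t _ => ?_
    rw [nsq, Finset.mul_sum]
    refine Finset.sum_congr rfl fun i _ => ?_
    rw [Matrix.diagonal_mul, norm_mul, mul_pow]
    congr 1
    · simp
    · have e : Uᴴ * C = (Cᴴ * U)ᴴ := by
        rw [Matrix.conjTranspose_mul, Matrix.conjTranspose_conjTranspose]
      rw [e, Matrix.conjTranspose_apply, norm_star]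

end Realization

/-! ### The limiting matrix measure -/

section LimitMeasure

variable {ι κ : Type} [Fintype ι] [DecidableEq ι] [Fintype κ] [DecidableEq κ]

/-- Atoms of a matrix measure: a position on the line, and a vector in a ball. -/
abbrev Atom (ι : Type) [Fintype ι] : Type :=
  ℝ × Metric.closedBall (0 : ι → ℂ) (√(Fintype.card ι))

theorem norm_coord_le (p : Atom ι) (i : ι) : ‖(p.2 : ι → ℂ) i‖ ≤ √(Fintype.card ι) :=
  (norm_le_pi_norm _ i).trans (mem_closedBall_zero_iff.1 p.2.2)

theorem norm_coord_mul_star_le (p : Atom ι) (i j : ι) :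
    ‖(p.2 : ι → ℂ) i * star ((p.2 : ι → ℂ) j)‖ ≤ Fintype.card ι := by
  rw [norm_mul, norm_star]
  refine (mul_le_mul (norm_coord_le p i) (norm_coord_le p j) (norm_nonneg _)
    (Real.sqrt_nonneg _)).trans ?_
  rw [Real.mul_self_sqrt (by positivity)]

theorem continuous_coord (i : ι) : Continuous fun p : Atom ι => (p.2 : ι → ℂ) i :=
  (continuous_apply i).comp (continuous_subtype_val.comp continuous_snd)

/-- The test function `(λ, v) ↦ vᵢ v̄ⱼ`. -/
def coordBCF (i j : ι) : BoundedContinuousFunction (Atom ι) ℂ :=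
  BoundedContinuousFunction.ofNormedAddCommGroup
    (fun p => (p.2 : ι → ℂ) i * star ((p.2 : ι → ℂ) j))
    ((continuous_coord i).mul (continuous_coord j).star) (Fintype.card ι)
    (fun p => norm_coord_mul_star_le p i j)

theorem sub_ne_zero_of_im_ne_zero {ζ : ℂ} (hζ : ζ.im ≠ 0) (t : ℝ) : (t : ℂ) - ζ ≠ 0 := fun h => by
  have := congrArg Complex.im h
  simp at this
  exact hζ this

theorem norm_inv_sub_le {ζ : ℂ} (hζ : 0 < ζ.im) (t : ℝ) : ‖((t : ℂ) - ζ)⁻¹‖ ≤ 1 / ζ.im := by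
  rw [norm_inv, ← one_div]
  refine one_div_le_one_div_of_le hζ ?_
  have := Complex.abs_im_le_norm ((t : ℂ) - ζ)
  simp only [Complex.sub_im, Complex.ofReal_im, zero_sub, abs_neg] at this
  exact (le_abs_self _).trans this

/-- The test function `(λ, v) ↦ vᵢ v̄ⱼ / (λ - ζ)`. -/
def stieltjesBCF (ζ : ℂ) (hζ : 0 < ζ.im) (i j : ι) : BoundedContinuousFunction (Atom ι) ℂ :=
  BoundedContinuousFunction.ofNormedAddCommGroup
    (fun p => ((p.1 : ℂ) - ζ)⁻¹ * ((p.2 : ι → ℂ) i * star ((p.2 : ι → ℂ) j)))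
    ((Continuous.inv₀ (by fun_prop) fun p => sub_ne_zero_of_im_ne_zero hζ.ne' _).mul
      ((continuous_coord i).mul (continuous_coord j).star)) (1 / ζ.im * Fintype.card ι)
    (fun p => by
      rw [norm_mul]
      exact mul_le_mul (norm_inv_sub_le hζ _) (norm_coord_mul_star_le p i j) (norm_nonneg _)
        (by positivity))

/-- The size of the vector is moved into a scalar mass. Since the identity has trace |ι|, these
masses will add up to 1; and since the ball is compact, tightness is a question about the position λ
only. -/
theorem exists_normalized (hι : 0 < Fintype.card ι) (w : ι → ℂ) :
    ∃ v : Metric.closedBall (0 : ι → ℂ) (√(Fintype.card ι)), ∀ i j,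
      ((nsq w / Fintype.card ι : ℝ) : ℂ) * ((v : ι → ℂ) i * star ((v : ι → ℂ) j)) =
        w i * star (w j) := by
  have hd : (0 : ℝ) < Fintype.card ι := by exact_mod_cast hι
  by_cases h : nsq w = 0
  · refine ⟨⟨0, by simp⟩, fun i j => ?_⟩
    simp [nsq_eq_zero h]
  · have h0 : 0 < nsq w := lt_of_le_of_ne (nsq_nonneg w) (Ne.symm h)
    set a : ℝ := √(Fintype.card ι / nsq w) with ha
    have ha2 : a * a = Fintype.card ι / nsq w := Real.mul_self_sqrt (by positivity)
    refine ⟨⟨fun i => (a : ℂ) * w i, ?_⟩, fun i j => ?_⟩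
    · rw [mem_closedBall_zero_iff, pi_norm_le_iff_of_nonneg (Real.sqrt_nonneg _)]
      intro i
      rw [norm_mul, Complex.norm_real, Real.norm_of_nonneg (Real.sqrt_nonneg _)]
      have h1 : ‖w i‖ ≤ √(nsq w) := by
        refine Real.le_sqrt_of_sq_le ?_
        exact Finset.single_le_sum (f := fun i => ‖w i‖ ^ 2) (fun _ _ => by positivity)
          (Finset.mem_univ i)
      calc a * ‖w i‖ ≤ a * √(nsq w) := mul_le_mul_of_nonneg_left h1 (Real.sqrt_nonneg _)
        _ = _ := by
          rw [ha, ← Real.sqrt_mul (by positivity), div_mul_cancel₀ _ h]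
    · have e : ((nsq w / Fintype.card ι : ℝ) : ℂ) * ((a * a : ℝ) : ℂ) = 1 := by
        rw [ha2, ← Complex.ofReal_mul, div_mul_div_comm, mul_comm, div_self (by positivity)]
        simp
      push_cast at e
      simp only [star_mul', RCLike.star_def, Complex.conj_ofReal]
      push_cast
      linear_combination (w i * (starRingEnd ℂ) (w j)) * e

/-- The iterates as integrals over atoms, with a uniform tail bound. -/
theorem exists_probabilityMeasure (hι : 0 < Fintype.card ι) (A : κ → Matrix ι ι ℂ) (n : ℕ) :
    ∃ ρ : ProbabilityMeasure (Atom ι),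
      (∀ ζ (hζ : 0 < ζ.im) i j, ∫ p, stieltjesBCF ζ hζ i j p ∂(ρ : Measure (Atom ι)) =
        iterM A ζ n i j) ∧
      (∀ i j, ∫ p, coordBCF i j p ∂(ρ : Measure (Atom ι)) = (1 : Matrix ι ι ℂ) i j) ∧
      ∀ R : ℝ, 0 < R → (ρ : Measure (Atom ι)) (Set.Icc (-R) R ×ˢ Set.univ)ᶜ ≤
        ENNReal.ofReal ((∑ k, hs (A k) ^ 2) / Fintype.card ι / R ^ 2) := by
  have hd : (0 : ℝ) < Fintype.card ι := by exact_mod_cast hι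
  obtain ⟨τ, _, lam, w, h1, h2, h3⟩ := exists_atoms A n
  choose v hv using fun t => exists_normalized hι (w t)
  set c : τ → ℝ := fun t => nsq (w t) / Fintype.card ι with hc
  have hc0 : ∀ t, 0 ≤ c t := fun t => div_nonneg (nsq_nonneg _) hd.le
  have hcsum : ∑ t, c t = 1 := by
    have e : ∑ t, (nsq (w t) : ℂ) = Fintype.card ι := by
      have : ∀ t, (nsq (w t) : ℂ) = ∑ i, w t i * star (w t i) := fun t => by
        rw [← star_dotProduct_self, dotProduct]
        exact Finset.sum_congr rfl fun i _ => by rw [Pi.star_apply, mul_comm]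
      simp only [this]
      rw [Finset.sum_comm]
      rw [Finset.sum_congr rfl fun i _ => h2 i i]
      simp
    have e' : ∑ t, nsq (w t) = Fintype.card ι := by exact_mod_cast e
    rw [hc, ← Finset.sum_div, e', div_self hd.ne']
  set ρ : Measure (Atom ι) := ∑ t, ENNReal.ofReal (c t) • Measure.dirac (lam t, v t) with hρ
  have hprob : IsProbabilityMeasure ρ := ⟨by
    rw [hρ, Measure.finsetSum_apply]
    simp only [Measure.smul_apply, measure_univ, smul_eq_mul, mul_one]
    rw [← ENNReal.ofReal_sum_of_nonneg fun t _ => hc0 t, hcsum, ENNReal.ofReal_one]⟩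
  have hint : ∀ f : BoundedContinuousFunction (Atom ι) ℂ,
      ∫ p, f p ∂ρ = ∑ t, (c t : ℂ) * f (lam t, v t) := fun f => by
    rw [hρ, integral_finsetSum_measure]
    · refine Finset.sum_congr rfl fun t _ => ?_
      rw [integral_smul_measure, integral_dirac, ENNReal.toReal_ofReal (hc0 t), Complex.real_smul]
    · intro t _
      exact (f.integrable _).smul_measure ENNReal.ofReal_ne_top
  refine ⟨⟨ρ, hprob⟩, fun ζ hζ i j => ?_, fun i j => ?_, fun R hR => ?_⟩
  · change ∫ p, stieltjesBCF ζ hζ i j p ∂ρ = _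
    rw [hint, ← h1 ζ hζ]
    refine Finset.sum_congr rfl fun t _ => ?_
    rw [← hv t i j]
    simp only [stieltjesBCF, BoundedContinuousFunction.coe_ofNormedAddCommGroup, hc]
    ring
  · change ∫ p, coordBCF i j p ∂ρ = _
    rw [hint, ← h2]
    refine Finset.sum_congr rfl fun t _ => ?_
    rw [← hv t i j]
    simp only [coordBCF, BoundedContinuousFunction.coe_ofNormedAddCommGroup, hc]
  · change ρ _ ≤ _
    rw [hρ, Measure.finsetSum_apply]
    -- Chebyshev, atom by atom.
    have e : ∀ t, (ENNReal.ofReal (c t) • Measure.dirac (lam t, v t))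
        ((Set.Icc (-R) R ×ˢ Set.univ)ᶜ : Set (Atom ι)) ≤
        ENNReal.ofReal (lam t ^ 2 * nsq (w t) / Fintype.card ι / R ^ 2) := fun t => by
      rw [Measure.smul_apply, smul_eq_mul,
        Measure.dirac_apply' _ (measurableSet_Icc.prod MeasurableSet.univ).compl]
      by_cases hm : lam t ∈ Set.Icc (-R) R
      · rw [Set.indicator_of_notMem (by simpa using hm)]
        simp
      · rw [Set.indicator_of_mem (by simpa using hm)]
        simp only [Pi.one_apply, mul_one]
        refine ENNReal.ofReal_le_ofReal ?_
        have h4 : R ^ 2 ≤ lam t ^ 2 := by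
          rw [sq_le_sq, abs_of_pos hR]
          by_contra hlt
          exact hm (abs_le.1 (not_le.1 hlt).le)
        rw [le_div_iff₀ (by positivity), hc]
        have h5 := nsq_nonneg (w t)
        calc nsq (w t) / Fintype.card ι * R ^ 2 ≤ nsq (w t) / Fintype.card ι * lam t ^ 2 := by
              gcongr
          _ = _ := by ring
    refine (Finset.sum_le_sum fun t _ => e t).trans ?_
    rw [← ENNReal.ofReal_sum_of_nonneg fun t _ => by have := nsq_nonneg (w t); positivity]
    refine ENNReal.ofReal_le_ofReal ?_
    rw [← Finset.sum_div, ← Finset.sum_div]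
    gcongr

/-- The limit of the iterates is the Stieltjes transform of a matrix measure. -/
theorem exists_limit_measure (hι : 0 < Fintype.card ι) {A : κ → Matrix ι ι ℂ} {s : ℝ} (hs0 : 0 < s)
    (hA : KrausBound A s) :
    ∃ ρ : ProbabilityMeasure (Atom ι),
      (∀ i j, ∫ p, coordBCF i j p ∂(ρ : Measure (Atom ι)) = (1 : Matrix ι ι ℂ) i j) ∧
      ∀ ζ (hζ : 0 < ζ.im), ∃ M, Tendsto (iterM A ζ) atTop (𝓝 M) ∧
        ∀ i j, ∫ p, stieltjesBCF ζ hζ i j p ∂(ρ : Measure (Atom ι)) = M i j := by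
  choose ρ h1 h2 h3 using exists_probabilityMeasure hι A
  have ht : IsTightMeasureSet
      {((μ : ProbabilityMeasure (Atom ι)) : Measure (Atom ι)) | μ ∈ Set.range ρ} := by
    rw [isTightMeasureSet_iff_exists_isCompact_measure_compl_le]
    intro ε hε
    have hlim : Tendsto (fun R : ℝ => ENNReal.ofReal
        ((∑ k, hs (A k) ^ 2) / Fintype.card ι / R ^ 2)) atTop (𝓝 0) := by
      rw [← ENNReal.ofReal_zero]
      refine ENNReal.tendsto_ofReal ?_
      exact Tendsto.const_div_atTop (tendsto_pow_atTop two_ne_zero) _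
    obtain ⟨R, hR, hR0⟩ := ((hlim.eventually_lt_const hε).and (eventually_gt_atTop 0)).exists
    refine ⟨Set.Icc (-R) R ×ˢ Set.univ, isCompact_Icc.prod ?_, ?_⟩
    · have : CompactSpace (Metric.closedBall (0 : ι → ℂ) (√(Fintype.card ι))) :=
        isCompact_iff_compactSpace.1 (isCompact_closedBall _ _)
      exact isCompact_univ
    · rintro _ ⟨_, ⟨n, rfl⟩, rfl⟩
      exact (h3 n R hR0).trans hR.le
  have hK := isCompact_closure_of_isTightMeasureSet ht
  -- Any cluster point will do, and an ultrafilter finer than `atTop` spares the extraction of a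
  -- subsequence. The iterates converge along the whole sequence, so the integrals against the
  -- cluster point are the expected limits.
  obtain ⟨ρ', -, hρ'⟩ := hK.ultrafilter_le_nhds' ((Filter.hyperfilter ℕ).map ρ)
    (Ultrafilter.mem_map.2 (Filter.univ_mem' fun n => subset_closure ⟨n, rfl⟩))
  have hT : Tendsto ρ (Filter.hyperfilter ℕ : Filter ℕ) (𝓝 ρ') := hρ'
  rw [ProbabilityMeasure.tendsto_iff_forall_integral_rclike_tendsto ℂ] at hT
  refine ⟨ρ', fun i j => ?_, fun ζ hζ => ?_⟩
  · have h4 := hT (coordBCF i j)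
    simp only [h2] at h4
    exact tendsto_nhds_unique h4 tendsto_const_nhds
  · obtain ⟨M, hM⟩ := exists_tendsto_iterM hs0 hA hζ
    refine ⟨M, hM, fun i j => ?_⟩
    have h4 := hT (stieltjesBCF ζ hζ i j)
    simp only [h1] at h4
    have h5 : Tendsto (fun n => iterM A ζ n i j) atTop (𝓝 (M i j)) :=
      ((entryCLM i j).continuous.tendsto M).comp hM
    exact tendsto_nhds_unique h4 (h5.mono_left Nat.hyperfilter_le_atTop)

end LimitMeasure

/-! ### Matrix measures from densities, and existence of the canonical pair -/

section Moment

variable {E ι : Type*} [MeasurableSpace E] [Fintype ι] {ρ : Measure E} [IsFiniteMeasure ρ]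
  {φ : E → ℝ} {v : E → ι → ℂ} {C : ℝ}

theorem integrable_coord_mul_star_of_bound (hv : ∀ i, Measurable fun p => v p i)
    (hC : ∀ p i, ‖v p i‖ ≤ C) (i j : ι) : Integrable (fun p => v p i * star (v p j)) ρ := by
  refine Integrable.of_bound ((hv i).mul (continuous_star.measurable.comp (hv j))).aestronglyMeasurable (C * C)
    (ae_of_all _ fun p => ?_)
  rw [norm_mul, norm_star]
  exact mul_le_mul (hC p i) (hC p j) (norm_nonneg _) ((norm_nonneg _).trans (hC p i))

theorem star_dotProduct_integral_mulVec {μ : Measure E} {g : E → ℂ} (x : ι → ℂ)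
    (hi : ∀ i j, Integrable (fun p => g p * (v p i * star (v p j))) μ) :
    star x ⬝ᵥ ((Matrix.of fun i j => ∫ p, g p * (v p i * star (v p j)) ∂μ) *ᵥ x) =
      ∫ p, g p * ((‖star x ⬝ᵥ v p‖ ^ 2 : ℝ) : ℂ) ∂μ := by
  have h1 : ∀ p, g p * ((‖star x ⬝ᵥ v p‖ ^ 2 : ℝ) : ℂ) =
      ∑ i, ∑ j, star (x i) * (g p * (v p i * star (v p j)) * x j) := fun p => by
    rw [← Complex.normSq_eq_norm_sq, ← Complex.mul_conj, dotProduct, map_sum, Finset.sum_mul_sum,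
      Finset.mul_sum]
    refine Finset.sum_congr rfl fun i _ => ?_
    rw [Finset.mul_sum]
    refine Finset.sum_congr rfl fun j _ => ?_
    simp only [Pi.star_apply, RCLike.star_def, map_mul, Complex.conj_conj]
    ring
  simp only [h1]
  rw [integral_finsetSum _ fun i _ => integrable_finsetSum _ fun j _ =>
    ((hi i j).mul_const _).const_mul _, dotProduct]
  refine Finset.sum_congr rfl fun i _ => ?_
  rw [integral_finsetSum _ fun j _ => ((hi i j).mul_const _).const_mul _, Matrix.mulVec,
    dotProduct, Finset.mul_sum]
  refine Finset.sum_congr rfl fun j _ => ?_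
  rw [integral_const_mul, integral_mul_const, Pi.star_apply, Matrix.of_apply]

/-- The image under `φ` of the matrix measure with density `v vᴴ`. -/
theorem exists_posMatrixMeasure (hφ : Measurable φ) (hv : ∀ i, Measurable fun p => v p i)
    (hC : ∀ p i, ‖v p i‖ ≤ C) :
    ∃ ν : PosMatrixMeasure ι,
      (∀ s, MeasurableSet s → ν.toVectorMeasure s =
        Matrix.of fun i j => ∫ p in φ ⁻¹' s, v p i * star (v p j) ∂ρ) ∧
      ∀ (g : ℝ → ℂ), Measurable g → ∀ x : ι → ℂ,
        ∫ t, g t ∂(ν.quad x) = ∫ p, g (φ p) * ((‖star x ⬝ᵥ v p‖ ^ 2 : ℝ) : ℂ) ∂ρ := by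
  classical
  have hi : ∀ i j, Integrable (fun p => v p i * star (v p j)) ρ :=
    integrable_coord_mul_star_of_bound hv hC
  let V : VectorMeasure ℝ (Matrix ι ι ℂ) :=
    -- A vector measure must vanish on non-measurable sets, hence the case distinction.
    { measureOf' := fun s => if MeasurableSet s then
        Matrix.of fun i j => ∫ p in φ ⁻¹' s, v p i * star (v p j) ∂ρ else 0
      empty' := by
        ext i j
        simp
      not_measurable' := fun s h => if_neg h
      m_iUnion' := fun f hf hd => by
        simp only [hf, MeasurableSet.iUnion hf, if_true]
        refine Pi.hasSum.2 fun i => Pi.hasSum.2 fun j => ?_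
        simp only [Matrix.of_apply, Set.preimage_iUnion]
        exact hasSum_integral_iUnion (fun k => hφ (hf k))
          (fun k l hkl => (hd hkl).preimage φ) (hi i j).integrableOn }
  have hV : ∀ s, MeasurableSet s → V s =
      Matrix.of fun i j => ∫ p in φ ⁻¹' s, v p i * star (v p j) ∂ρ := fun s h => if_pos h
  have hq : ∀ s, MeasurableSet s → ∀ x : ι → ℂ, star x ⬝ᵥ (V s *ᵥ x) =
      ((∫ p in φ ⁻¹' s, ‖star x ⬝ᵥ v p‖ ^ 2 ∂ρ : ℝ) : ℂ) := fun s h x => by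
    rw [hV s h]
    have := star_dotProduct_integral_mulVec (μ := ρ.restrict (φ ⁻¹' s)) (g := fun _ => 1) (v := v)
      x fun i j => by simpa only [one_mul] using (hi i j).restrict
    simp only [one_mul] at this
    rw [this, integral_complex_ofReal]
  let ν : PosMatrixMeasure ι := ⟨V, fun s => by
    by_cases h : MeasurableSet s
    · refine Matrix.PosSemidef.of_dotProduct_mulVec_nonneg ?_ fun x => ?_
      · rw [hV s h]
        ext i j
        rw [Matrix.conjTranspose_apply, Matrix.of_apply, Matrix.of_apply, RCLike.star_def,
          ← integral_conj]
        simp [mul_comm]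
      · rw [hq s h]
        exact_mod_cast integral_nonneg fun p => by positivity
    · rw [V.not_measurable h]
      exact Matrix.PosSemidef.zero⟩
  have hm : ∀ x : ι → ℂ, Measurable fun p => ‖star x ⬝ᵥ v p‖ ^ 2 := fun x => by
    unfold dotProduct
    fun_prop
  have hb : ∀ x : ι → ℂ, Integrable (fun p => ‖star x ⬝ᵥ v p‖ ^ 2) ρ := fun x => by
    refine Integrable.of_bound (hm x).aestronglyMeasurable ((∑ i, ‖x i‖ * C) ^ 2)
      (ae_of_all _ fun p => ?_)
    rw [norm_pow, norm_norm]
    refine pow_le_pow_left₀ (norm_nonneg _) ((norm_sum_le _ _).trans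
      (Finset.sum_le_sum fun i _ => ?_)) 2
    rw [norm_mul, Pi.star_apply, norm_star]
    exact mul_le_mul_of_nonneg_left (hC p i) (norm_nonneg _)
  refine ⟨ν, hV, fun g hg x => ?_⟩
  have h1 : ν.quad x =
      (ρ.withDensity fun p => ENNReal.ofReal (‖star x ⬝ᵥ v p‖ ^ 2)).map φ := by
    ext s h
    rw [quad_apply ν x h, Measure.map_apply hφ h, withDensity_apply _ (hφ h), hq s h,
      Complex.ofReal_re, ofReal_integral_eq_lintegral_ofReal (hb x).integrableOn
        (ae_of_all _ fun p => by positivity)]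
  rw [h1, integral_map hφ.aemeasurable hg.aestronglyMeasurable,
    integral_withDensity_eq_integral_toReal_smul (hm x).ennreal_ofReal (by simp)]
  refine integral_congr_ae (ae_of_all _ fun p => ?_)
  simp only
  rw [ENNReal.toReal_ofReal (by positivity), Complex.real_smul, mul_comm]

theorem norm_inv_sub_le_delta {z : ℂ} (hz : z ∉ halfLine) {t : ℝ} (ht : 0 ≤ t) :
    ‖((t : ℂ) - z)⁻¹‖ ≤ (delta z)⁻¹ := by
  rw [norm_inv]
  refine inv_anti₀ (delta_pos hz) ?_
  rw [← dist_eq_norm, dist_comm]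
  exact Metric.infDist_le_dist_of_mem ⟨t, ht, rfl⟩

theorem isStieltjes_integral [DecidableEq ι] (hφ : Measurable φ) (hφ0 : ∀ p, 0 ≤ φ p)
    (hv : ∀ i, Measurable fun p => v p i) (hC : ∀ p i, ‖v p i‖ ≤ C)
    (h1 : ∀ i j, ∫ p, v p i * star (v p j) ∂ρ = (1 : Matrix ι ι ℂ) i j) :
    IsStieltjes fun z => Matrix.of fun i j =>
      ∫ p, ((φ p : ℂ) - z)⁻¹ * (v p i * star (v p j)) ∂ρ := by
  obtain ⟨ν, hν, hq⟩ := exists_posMatrixMeasure (ρ := ρ) hφ hv hC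
  refine ⟨ν, ?_, ?_, fun z hz x => ?_⟩
  · rw [hν _ MeasurableSet.univ]
    ext i j
    rw [Matrix.of_apply, Set.preimage_univ, Measure.restrict_univ, h1]
  · rw [hν _ measurableSet_Iio]
    have : φ ⁻¹' Set.Iio 0 = ∅ := by
      ext p
      simpa using hφ0 p
    ext i j
    simp [this]
  · have hg : Measurable fun t : ℝ => ((t : ℂ) - z)⁻¹ :=
      (Complex.measurable_ofReal.sub_const z).inv
    rw [hq _ hg]
    refine star_dotProduct_integral_mulVec (g := fun p => ((φ p : ℂ) - z)⁻¹) x fun i j => ?_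
    exact (integrable_coord_mul_star_of_bound hv hC i j).bdd_mul
      (hg.comp hφ).aestronglyMeasurable
      (ae_of_all _ fun p => norm_inv_sub_le_delta hz (hφ0 p))

end Moment

/-! ### Solvability of the canonical equation. -/

section Existence

theorem negInv_smul_eq {n : Type*} [Fintype n] [DecidableEq n] {ζ : ℂ} (hζ : 0 < ζ.im)
    {Y T : Matrix n n ℂ} (hY : ∀ x, 0 ≤ imq (ζ • Y) x) (hT : ζ • T = negInv ζ (ζ • Y)) :
    T = (-(ζ ^ 2)⁻¹) • (1 + Y)⁻¹ := by
  have hζ0 : ζ ≠ 0 := fun h => by simp [h] at hζ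
  have h1 := smul_eq_negInv hζ hY (T := (-(ζ ^ 2)⁻¹) • (1 + Y)⁻¹) rfl
  rw [← hT] at h1
  exact (smul_right_injective _ hζ0 h1).symm

/-- The Hermitization of a family of rectangular matrices. -/
def hermKraus {p q κ : Type*} (A : κ → Matrix p q ℂ) : κ ⊕ κ → Matrix (p ⊕ q) (p ⊕ q) ℂ :=
  Sum.elim (fun k => Matrix.fromBlocks 0 (A k) 0 0) fun k => Matrix.fromBlocks 0 0 (A k)ᴴ 0

variable {p q κ : Type*} [Fintype p] [Fintype q] [DecidableEq p] [DecidableEq q] [Fintype κ]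

/-- The coupled system becomes a single fixed point equation for one completely positive map, whose
images are block diagonal with the two covariance maps as blocks. -/
theorem kmap_hermKraus (A : κ → Matrix p q ℂ) (B : Matrix (p ⊕ q) (p ⊕ q) ℂ) :
    kmap (hermKraus A) B =
      Matrix.fromBlocks (kmap A B.toBlocks₂₂) 0 0 (kmap (adj A) B.toBlocks₁₁) := by
  rw [kmap, Fintype.sum_sum_type]
  have h1 : ∀ k, hermKraus A (Sum.inl k) * B * (hermKraus A (Sum.inl k))ᴴ =
      Matrix.fromBlocks (A k * B.toBlocks₂₂ * (A k)ᴴ) 0 0 0 := fun k => by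
    conv_lhs => rw [← Matrix.fromBlocks_toBlocks B]
    simp [hermKraus, Matrix.fromBlocks_conjTranspose, Matrix.fromBlocks_multiply]
  have h2 : ∀ k, hermKraus A (Sum.inr k) * B * (hermKraus A (Sum.inr k))ᴴ =
      Matrix.fromBlocks 0 0 0 ((A k)ᴴ * B.toBlocks₁₁ * A k) := fun k => by
    conv_lhs => rw [← Matrix.fromBlocks_toBlocks B]
    simp [hermKraus, Matrix.fromBlocks_conjTranspose, Matrix.fromBlocks_multiply]
  simp only [h1, h2]
  ext (i | i) (j | j) <;> simp [Matrix.sum_apply, kmap, adj]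

theorem krausBound_hermKraus {A : κ → Matrix p q ℂ} {s : ℝ} (hA : KrausBound A s)
    (hA' : KrausBound (adj A) s) : KrausBound (hermKraus A) s := fun x => by
  obtain ⟨y, z, rfl⟩ : ∃ y z, x = Sum.elim y z :=
    ⟨x ∘ Sum.inl, x ∘ Sum.inr, (Sum.elim_comp_inl_inr x).symm⟩
  have h0 : ∀ (a : p → ℂ) (b : q → ℂ), nsq (Sum.elim a b) = nsq a + nsq b := fun a b => by
    simp [nsq]
  have h1 := hA y
  have h2 := hA' z
  rw [Fintype.sum_sum_type, h0, mul_add]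
  refine add_le_add (le_of_eq_of_le ?_ h1) (le_of_eq_of_le ?_ h2)
  · refine Finset.sum_congr rfl fun k _ => ?_
    simp only [hermKraus, Sum.elim_inl, Matrix.fromBlocks_conjTranspose,
      Matrix.fromBlocks_mulVec, Sum.elim_comp_inl, Sum.elim_comp_inr, Matrix.conjTranspose_zero, Matrix.zero_mulVec, add_zero, h0]
    simp [nsq]
  · refine Finset.sum_congr rfl fun k _ => ?_
    simp only [hermKraus, Sum.elim_inr, Matrix.fromBlocks_conjTranspose, adj,
      Matrix.fromBlocks_mulVec, Sum.elim_comp_inl, Sum.elim_comp_inr, Matrix.conjTranspose_zero, Matrix.zero_mulVec, zero_add, h0]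
    simp [nsq]

theorem negInv_fromBlocks {ζ : ℂ} (hζ : 0 < ζ.im) {X : Matrix p p ℂ} {Y : Matrix q q ℂ}
    (hX : ∀ x, 0 ≤ imq X x) (hY : ∀ x, 0 ≤ imq Y x) :
    negInv ζ (Matrix.fromBlocks X 0 0 Y) = Matrix.fromBlocks (negInv ζ X) 0 0 (negInv ζ Y) := by
  have h1 := negInv_mul_smul_one_add hζ hX
  have h2 := negInv_mul_smul_one_add hζ hY
  rw [negInv, neg_eq_iff_eq_neg]
  refine Matrix.inv_eq_left_inv ?_
  rw [← Matrix.fromBlocks_one, Matrix.fromBlocks_smul, Matrix.fromBlocks_add, Matrix.neg_mul,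
    Matrix.fromBlocks_multiply]
  simp [h1, h2, Matrix.fromBlocks_neg]

/-- The limit of the iterates, in terms of the squared position of the atoms. -/
theorem exists_limit_measure_sq {ι κ : Type} [Fintype ι] [DecidableEq ι] [Fintype κ]
    [DecidableEq κ] (hι : 0 < Fintype.card ι) {A : κ → Matrix ι ι ℂ} {s : ℝ} (hs0 : 0 < s)
    (hA : KrausBound A s) :
    ∃ ρ : ProbabilityMeasure (Atom ι),
      (∀ i j, ∫ p : Atom ι, (p.2 : ι → ℂ) i * star ((p.2 : ι → ℂ) j) ∂(ρ : Measure (Atom ι)) =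
        (1 : Matrix ι ι ℂ) i j) ∧
      ∀ ζ : ℂ, 0 < ζ.im → ∃ M : Matrix ι ι ℂ, (∀ x, 0 ≤ imq M x) ∧ M = negInv ζ (kmap A M) ∧
        ∀ i j, ζ * ∫ p : Atom ι, (((p.1 ^ 2 : ℝ) : ℂ) - ζ ^ 2)⁻¹ *
          ((p.2 : ι → ℂ) i * star ((p.2 : ι → ℂ) j)) ∂(ρ : Measure (Atom ι)) = M i j := by
  obtain ⟨ρ, h1, h2⟩ := exists_limit_measure hι hs0 hA
  refine ⟨ρ, h1, fun ζ hζ => ?_⟩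
  obtain ⟨M, hM, hMi⟩ := h2 ζ hζ
  have hζ' : 0 < (-(starRingEnd ℂ) ζ).im := by simpa using hζ
  obtain ⟨M', hM', hMi'⟩ := h2 _ hζ'
  obtain ⟨h3, h4⟩ := eq_negInv_of_tendsto_iterM hζ hM
  refine ⟨M, h3, h4, fun i j => ?_⟩
  -- The values at ζ and -ζ̄ are linked by the symmetry of the iterates.
  have h5 : M' = -Mᴴ := by
    refine tendsto_nhds_unique hM' ?_
    rw [show iterM A (-(starRingEnd ℂ) ζ) = fun n => -(iterM A ζ n)ᴴ from
      funext fun n => iterM_neg_conj n]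
    exact ((continuous_id.matrix_conjTranspose.tendsto M).comp hM).neg
  have h6 := congrArg (starRingEnd ℂ) (hMi' j i)
  rw [← integral_conj, h5] at h6
  simp only [Matrix.neg_apply, Matrix.conjTranspose_apply, map_neg, RCLike.star_def,
    Complex.conj_conj] at h6
  have hi := (stieltjesBCF ζ hζ i j).integrable (ρ : Measure (Atom ι))
  have hi' := ((Complex.conjCLE : ℂ →L[ℝ] ℂ).integrable_comp
    ((stieltjesBCF _ hζ' j i).integrable (ρ : Measure (Atom ι))))
  have h7 := integral_sub hi hi'
  simp only [ContinuousLinearEquiv.coe_coe, Complex.conjCLE_apply] at h7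
  rw [hMi, h6, sub_neg_eq_add] at h7
  -- Both 1/(λ - ζ) and -1/(λ + ζ) integrate to M, and their sum is 2ζ/(λ² - ζ²).
  have h8 : (2 : ℂ) * (ζ * ∫ p : Atom ι, (((p.1 ^ 2 : ℝ) : ℂ) - ζ ^ 2)⁻¹ *
      ((p.2 : ι → ℂ) i * star ((p.2 : ι → ℂ) j)) ∂(ρ : Measure (Atom ι))) = M i j + M i j := by
    rw [← h7, ← integral_const_mul, ← integral_const_mul]
    refine integral_congr_ae (ae_of_all _ fun p => ?_)
    simp only [stieltjesBCF, BoundedContinuousFunction.coe_ofNormedAddCommGroup, map_mul, map_inv₀,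
      map_add, Complex.conj_ofReal, Complex.conj_conj, RCLike.star_def, sub_neg_eq_add]
    have e1 : (p.1 : ℂ) - ζ ≠ 0 := sub_ne_zero_of_im_ne_zero hζ.ne' _
    have e2 : (p.1 : ℂ) + ζ ≠ 0 := by
      have := sub_ne_zero_of_im_ne_zero (ζ := -ζ) (by simpa using hζ.ne') p.1
      rwa [sub_neg_eq_add] at this
    have e3 : (((p.1 ^ 2 : ℝ) : ℂ) - ζ ^ 2) = ((p.1 : ℂ) - ζ) * ((p.1 : ℂ) + ζ) := by
      push_cast
      ring
    rw [e3]
    field_simp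
    ring
  linear_combination h8 / 2

theorem exists_isCanonicalPair {S : ℕ → ℝ → ℝ} {M L N : ℕ} (hM : 1 ≤ M) (hL : 1 ≤ L) (hN : 1 ≤ N)
    (hS : ∀ m, IntervalIntegrable (S m) volume 0 1) {b : ℝ}
    (hb : ∀ m, ∀ ν ∈ Set.Icc (0 : ℝ) 1, S m ν ≤ b) (hS0 : ∀ m, ∀ ν ∈ Set.Icc (0 : ℝ) 1, 0 ≤ S m ν) :
    ∃ T T', IsCanonicalPair S M L N T T' := by
  obtain ⟨A, hA, hA'⟩ := exists_kraus hS hS0 M L N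
  have hb0 : 0 ≤ b := (hS0 0 0 (by simp)).trans (hb 0 0 (by simp))
  have hc0 : (0 : ℝ) ≤ (M : ℝ) * L / N * b := by positivity
  -- A common bound for the two maps; the added 1 only makes it strictly positive.
  have hK := krausBound_hermKraus
    ((krausBound_etaRow hS hb (by omega) hA).mono (s' := b + (M : ℝ) * L / N * b + 1) (by linarith))
    ((krausBound_etaCol hS hb hA').mono (s' := b + (M : ℝ) * L / N * b + 1) (by linarith))
  have hcard : 0 < Fintype.card ((Fin M × Fin L) ⊕ Fin N) := by
    simp only [Fintype.card_sum, Fintype.card_fin]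
    omega
  obtain ⟨ρ, h1, h2⟩ := exists_limit_measure_sq hcard (by linarith) hK
  have hφ : Measurable fun a : Atom ((Fin M × Fin L) ⊕ Fin N) => a.1 ^ 2 :=
    measurable_fst.pow_const 2
  have hv : ∀ i, Measurable fun a : Atom ((Fin M × Fin L) ⊕ Fin N) =>
      (a.2 : (Fin M × Fin L) ⊕ Fin N → ℂ) i := fun i => (continuous_coord i).measurable
  let T : ℂ → Matrix (Fin M × Fin L) (Fin M × Fin L) ℂ := fun z => Matrix.of fun i j =>
    ∫ a : Atom ((Fin M × Fin L) ⊕ Fin N), (((a.1 ^ 2 : ℝ) : ℂ) - z)⁻¹ *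
      ((a.2 : (Fin M × Fin L) ⊕ Fin N → ℂ) (Sum.inl i) *
        star ((a.2 : (Fin M × Fin L) ⊕ Fin N → ℂ) (Sum.inl j))) ∂(ρ : Measure _)
  let T' : ℂ → Matrix (Fin N) (Fin N) ℂ := fun z => Matrix.of fun i j =>
    ∫ a : Atom ((Fin M × Fin L) ⊕ Fin N), (((a.1 ^ 2 : ℝ) : ℂ) - z)⁻¹ *
      ((a.2 : (Fin M × Fin L) ⊕ Fin N → ℂ) (Sum.inr i) *
        star ((a.2 : (Fin M × Fin L) ⊕ Fin N → ℂ) (Sum.inr j))) ∂(ρ : Measure _)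
  have hTT' : ∀ ζ : ℂ, 0 < ζ.im →
      (T (ζ ^ 2) = (-(ζ ^ 2)⁻¹) • (1 + etaRow S M L (T' (ζ ^ 2)))⁻¹) ∧
      (T' (ζ ^ 2) = (-(ζ ^ 2)⁻¹) • (1 + etaCol S N (T (ζ ^ 2)))⁻¹) := fun ζ hζ => by
    obtain ⟨G, hG, hG', hGi⟩ := h2 ζ hζ
    have e1 : ζ • T (ζ ^ 2) = G.toBlocks₁₁ := by
      ext i j
      exact hGi (Sum.inl i) (Sum.inl j)
    have e2 : ζ • T' (ζ ^ 2) = G.toBlocks₂₂ := by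
      ext i j
      exact hGi (Sum.inr i) (Sum.inr j)
    have p1 := imq_kmap_nonneg A (imq_toBlocks₂₂_nonneg hG)
    have p2 := imq_kmap_nonneg (adj A) (imq_toBlocks₁₁_nonneg hG)
    rw [kmap_hermKraus, negInv_fromBlocks hζ p1 p2] at hG'
    have g1 := congrArg Matrix.toBlocks₁₁ hG'
    have g2 := congrArg Matrix.toBlocks₂₂ hG'
    rw [Matrix.toBlocks_fromBlocks₁₁, hA, ← e1, ← e2, etaRow_smul] at g1
    rw [Matrix.toBlocks_fromBlocks₂₂, hA', ← e1, ← e2, etaCol_smul] at g2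
    rw [hA, ← e2, etaRow_smul] at p1
    rw [hA', ← e1, etaCol_smul] at p2
    exact ⟨negInv_smul_eq hζ p1 g1, negInv_smul_eq hζ p2 g2⟩
  refine ⟨T, T', ?_, ?_, fun z hz => ?_, fun z hz => ?_⟩
  · refine isStieltjes_integral (φ := fun a : Atom ((Fin M × Fin L) ⊕ Fin N) => a.1 ^ 2)
      (v := fun a i => (a.2 : (Fin M × Fin L) ⊕ Fin N → ℂ) (Sum.inl i)) hφ
      (fun a => by positivity) (fun i => hv _) (fun a i => norm_coord_le a _) fun i j => ?_
    rw [h1]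
    simp [Matrix.one_apply]
  · refine isStieltjes_integral (φ := fun a : Atom ((Fin M × Fin L) ⊕ Fin N) => a.1 ^ 2)
      (v := fun a i => (a.2 : (Fin M × Fin L) ⊕ Fin N → ℂ) (Sum.inr i)) hφ
      (fun a => by positivity) (fun i => hv _) (fun a i => norm_coord_le a _) fun i j => ?_
    rw [h1]
    simp [Matrix.one_apply]
  -- Every point off the half line is a square from the upper half plane, so the identities in ζ
  -- cover the whole domain.
  · obtain ⟨ζ, rfl, hζ⟩ := exists_sqrt hz
    rw [Psi_transpose]
    exact (hTT' ζ hζ).1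
  · obtain ⟨ζ, rfl, hζ⟩ := exists_sqrt hz
    rw [smul_PsiBar_transpose (by omega) (by omega)]
    exact (hTT' ζ hζ).2

end Existence

/-! ### Conclusion -/

section Conclusion

open Polynomial in
/-- The polynomial `C (1 + X) ^ n`. -/
def shiftedMonomial (C : ℝ) (n : ℕ) : Polynomial ℝ := Polynomial.C C * (1 + X) ^ n

theorem eval_shiftedMonomial (C : ℝ) (n : ℕ) (x : ℝ) :
    (shiftedMonomial C n).eval x = C * (1 + x) ^ n := by
  simp [shiftedMonomial]

theorem isNice_shiftedMonomial {C : ℝ} (hC : 0 < C) (n : ℕ) : IsNice (shiftedMonomial C n) := by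
  intro i hi
  have h1 : (shiftedMonomial C n).natDegree ≤ n := by
    refine (Polynomial.natDegree_C_mul_le _ _).trans ((Polynomial.natDegree_pow_le).trans ?_)
    have : ((1 : Polynomial ℝ) + Polynomial.X).natDegree ≤ 1 := by
      refine (Polynomial.natDegree_add_le _ _).trans ?_
      simp
    calc n * _ ≤ n * 1 := Nat.mul_le_mul_left n this
      _ = n := mul_one n
  rw [shiftedMonomial, Polynomial.coeff_C_mul, Polynomial.coeff_one_add_X_pow]
  have : 0 < n.choose i := Nat.choose_pos (hi.trans h1)
  positivity

theorem rpow_three_halves {x : ℝ} (hx : 0 < x) : x ^ (3 / 2 : ℝ) = x * √x := by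
  rw [Real.sqrt_eq_rpow, ← Real.rpow_one_add' hx.le (by norm_num)]
  norm_num

theorem specNorm_eq {ι : Type*} [Fintype ι] [DecidableEq ι] (A : Matrix ι ι ℂ) :
    specNorm A = ‖A‖ := rfl

theorem specNorm_nonneg {ι : Type*} [Fintype ι] [DecidableEq ι] (A : Matrix ι ι ℂ) :
    0 ≤ specNorm A := norm_nonneg A

/-- The bound on the bias of linear statistics of the resolvent. -/
theorem norm_trace_mul_meanResolvent_sub_le {Ω : Type*} [MeasurableSpace Ω] {P : Measure Ω}
    {S : ℕ → ℝ → ℝ} {M L N : ℕ} (hM : 1 ≤ M) (hL : 1 ≤ L) (hN : 1 ≤ N)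
    {w : Fin M → Fin (N + L - 1) → Ω → ℂ} (hw : IsInputFamily P S M L N w)
    (hS : ∀ m, IntervalIntegrable (S m) volume 0 1) {b K κ : ℝ} (hb0 : 0 < b)
    (hb : ∀ m, ∀ ν ∈ Set.Icc (0 : ℝ) 1, S m ν ≤ b) (hS0 : ∀ m, ∀ ν ∈ Set.Icc (0 : ℝ) 1, 0 ≤ S m ν)
    (hsum : Summable (rho S M)) (hK : ∑' n, rho S M n ≤ K) (hκ : 1 ≤ κ)
    (hdim : (M : ℝ) * L / N ≤ κ)
    {T : ℂ → Matrix (Fin M × Fin L) (Fin M × Fin L) ℂ} {T' : ℂ → Matrix (Fin N) (Fin N) ℂ}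
    (hT : IsCanonicalPair S M L N T T') {z : ℂ} (hz : z ∉ halfLine)
    (hsmall : (L : ℝ) ^ (3 / 2 : ℝ) / ((M : ℝ) * N) *
      (2 * (Real.pi ^ 2 * b ^ 2 * K * κ ^ 2 * (1 + κ * b)) *
        ((1 + ‖z‖) * (1 + 1 / delta z)) ^ 8) ≤ 1)
    (A : Matrix (Fin M × Fin L) (Fin M × Fin L) ℂ) :
    ‖(1 / ((M : ℂ) * (L : ℂ))) * (A * (meanResolvent P w z - T z)).trace‖ ≤
      specNorm A * (Real.pi ^ 2 * b * K * κ * (1 + κ * b) * (1 + 2 * (κ * b) ^ 2) *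
        ((1 + ‖z‖) * (1 + 1 / delta z)) ^ 12) * ((L : ℝ) / ((M : ℝ) * N)) := by
  rw [specNorm_eq]
  obtain ⟨B, hB, hB'⟩ := exists_kraus hS hS0 M L N
  obtain ⟨ζ, rfl, hζ⟩ := exists_sqrt hz
  set u := (1 + ‖ζ ^ 2‖) * (1 + 1 / delta (ζ ^ 2)) with hu
  have hM' : (0 : ℝ) < M := by exact_mod_cast hM
  have hL' : (0 : ℝ) < L := by exact_mod_cast hL
  have hN' : (0 : ℝ) < N := by exact_mod_cast hN
  have hδ := delta_pos hz
  have hu1 : 1 ≤ u := by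
    have h1 : 1 ≤ 1 + ‖ζ ^ 2‖ := by linarith [norm_nonneg (ζ ^ 2)]
    have h2 : 1 ≤ 1 + 1 / delta (ζ ^ 2) := by
      have : 0 ≤ 1 / delta (ζ ^ 2) := by positivity
      linarith
    exact one_le_mul_of_one_le_of_one_le h1 h2
  have hbκ : b ≤ κ * b := le_mul_of_one_le_left hb0.le hκ
  have hset : Setting (L := L) (law P w) S B ζ b K κ (κ * b) u :=
    { noise := hw.isNoise
      integrable := hS
      pos_M := hM
      pos_L := hL
      pos_N := hN
      b_nonneg := hb0.le
      le_b := hb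
      summable := hsum
      tsum_le := hK
      kmap_eq := hB
      kmap_adj_eq := hB'
      one_le_κ := hκ
      dim_le := by rwa [div_le_iff₀ hN'] at hdim
      s_pos := by positivity
      kraus := (krausBound_etaRow hS hb (by omega) hB).mono hbκ
      kraus_adj := (krausBound_etaCol hS hb hB').mono (mul_le_mul_of_nonneg_right hdim hb0.le)
      im_pos := hζ
      one_le_u := hu1
      inv_le_u := inv_im_le rfl hζ }
  have hζ0 : ζ ≠ 0 := fun h => by simp [h] at hζ
  have h1 := hset.norm_trace_mul_meanRow_sub_solution_le
    (hT.stieltjes.imq_smul_nonneg hζ) (hT.stieltjes'.imq_smul_nonneg hζ)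
    (hT.row_eq hB hζ) (hT.col_eq (by omega) (by omega) hB' hζ)
    (by rw [rpow_three_halves hL'] at hsmall; linarith) A
  have h2 : meanResolvent P w (ζ ^ 2) - T (ζ ^ 2) =
      ζ⁻¹ • (meanRow (law P w) ζ - ζ • T (ζ ^ 2)) := by
    rw [smul_sub, smul_smul, inv_mul_cancel₀ hζ0, one_smul, hw.meanResolvent_eq hζ]
  rw [h2, Matrix.mul_smul, Matrix.trace_smul, smul_eq_mul, norm_mul, norm_mul]
  have h3 : ‖(1 / ((M : ℂ) * (L : ℂ)))‖ = 1 / (M * L) := by simp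
  -- The factor ζ⁻¹ between the two resolvents accounts for the twelfth power of u.
  have h4 : ‖ζ⁻¹‖ ≤ u := by
    rw [norm_inv]
    refine le_trans ?_ hset.inv_le_u
    rw [← one_div]
    exact one_div_le_one_div_of_le hζ ((le_abs_self _).trans (Complex.abs_im_le_norm ζ))
  rw [h3]
  have hK0 := hset.K_nonneg
  calc _ ≤ 1 / (M * L : ℝ) * (u * (Real.pi ^ 2 * b * K * κ * (1 + κ * b) *
        (1 + 2 * (κ * b) ^ 2) * u ^ 11 * (L ^ 2 / N) * ‖A‖)) := by
        gcongr
    _ = _ := by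
        field_simp

end Conclusion

end BlockHankel

end

/-! ### Uniform constants and the asymptotic regime. -/

theorem mainTheorem2 {Ω : Type*} [MeasurableSpace Ω] (P : Measure Ω) [IsProbabilityMeasure P]
    (M L N : ℕ → ℕ) (hMpos : ∀ k, 1 ≤ M k) (hLpos : ∀ k, 1 ≤ L k) (hNpos : ∀ k, 1 ≤ N k)
    (hM : Tendsto M atTop atTop) (hN : Tendsto N atTop atTop)
    (c : ℝ) (hc : 0 < c)
    (hcN : Tendsto (fun k => (M k : ℝ) * (L k : ℝ) / (N k : ℝ)) atTop (𝓝 c))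
    (S : ℕ → ℝ → ℝ) (hSint : ∀ m, IntervalIntegrable (S m) volume 0 1)
    (hSupper : ∃ b : ℝ, ∀ m, ∀ ν ∈ Set.Icc (0 : ℝ) 1, S m ν ≤ b)
    (hSlower : ∃ a : ℝ, 0 < a ∧ ∀ m, ∀ ν ∈ Set.Icc (0 : ℝ) 1, a ≤ S m ν)
    (hr : ∃ K : ℝ, ∀ m : ℕ, 1 ≤ m →
      Summable (fun n : ℤ =>
        Real.sqrt ((1 / (m : ℝ)) * ∑ i ∈ Finset.range m, ‖BlockHankel.corr (S i) n‖ ^ 2)) ∧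
      ∑' n : ℤ,
        Real.sqrt ((1 / (m : ℝ)) * ∑ i ∈ Finset.range m, ‖BlockHankel.corr (S i) n‖ ^ 2) ≤ K)
    (w : ∀ k, Fin (M k) → Fin (N k + L k - 1) → Ω → ℂ)
    (hw : ∀ k, BlockHankel.IsInputFamily P S (M k) (L k) (N k) (w k))
    (hextra : Tendsto (fun k => (L k : ℝ) ^ (3 / 2 : ℝ) / ((M k : ℝ) * (N k : ℝ))) atTop (𝓝 0)) :
    -- the canonical equation is solvable for all dimensions
    (∀ k, ∃ T T', BlockHankel.IsCanonicalPair S (M k) (L k) (N k) T T') ∧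
    ∃ P₁ P₂ Q₁ Q₂ : Polynomial ℝ,
      BlockHankel.IsNice P₁ ∧ BlockHankel.IsNice P₂ ∧
      BlockHankel.IsNice Q₁ ∧ BlockHankel.IsNice Q₂ ∧
      ∀ (T : ∀ k, ℂ → Matrix (Fin (M k) × Fin (L k)) (Fin (M k) × Fin (L k)) ℂ)
        (T' : ∀ k, ℂ → Matrix (Fin (N k)) (Fin (N k)) ℂ),
        (∀ k, BlockHankel.IsCanonicalPair S (M k) (L k) (N k) (T k) (T' k)) →
        -- the bound on the sets `E_N`, uniformly in the dimensions, in `z` and in `A`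
        (∀ k, ∀ z ∉ BlockHankel.halfLine,
          (L k : ℝ) ^ (3 / 2 : ℝ) / ((M k : ℝ) * (N k : ℝ)) *
              (Q₁.eval ‖z‖ * Q₂.eval (1 / BlockHankel.delta z)) < 1 →
          ∀ A : Matrix (Fin (M k) × Fin (L k)) (Fin (M k) × Fin (L k)) ℂ,
            ‖(1 / ((M k : ℂ) * (L k : ℂ))) *
                (A * (BlockHankel.meanResolvent P (w k) z - T k z)).trace‖ ≤
              BlockHankel.specNorm A * (P₁.eval ‖z‖ * P₂.eval (1 / BlockHankel.delta z)) *
                ((L k : ℝ) / ((M k : ℝ) * (N k : ℝ)))) ∧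
        -- the same bound at every `z`, from some rank on that depends on `z` only
        (∀ z ∉ BlockHankel.halfLine, ∃ k₀, ∀ k ≥ k₀,
          ∀ A : Matrix (Fin (M k) × Fin (L k)) (Fin (M k) × Fin (L k)) ℂ,
            ‖(1 / ((M k : ℂ) * (L k : ℂ))) *
                (A * (BlockHankel.meanResolvent P (w k) z - T k z)).trace‖ ≤
              BlockHankel.specNorm A * (P₁.eval ‖z‖ * P₂.eval (1 / BlockHankel.delta z)) *
                ((L k : ℝ) / ((M k : ℝ) * (N k : ℝ)))) ∧
        -- the rate at every `z`, for every uniformly bounded sequence of matrices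
        (∀ z ∉ BlockHankel.halfLine,
          ∀ A : ∀ k, Matrix (Fin (M k) × Fin (L k)) (Fin (M k) × Fin (L k)) ℂ,
            (∃ a : ℝ, ∀ k, BlockHankel.specNorm (A k) ≤ a) →
            (fun k => (1 / ((M k : ℂ) * (L k : ℂ))) *
                (A k * (BlockHankel.meanResolvent P (w k) z - T k z)).trace) =O[atTop]
              (fun k => (L k : ℝ) / ((M k : ℝ) * (N k : ℝ)))) := by
  obtain ⟨b, hb⟩ := hSupper
  obtain ⟨a, ha0, ha⟩ := hSlower
  obtain ⟨K, hK⟩ := hr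
  have hS0 : ∀ m, ∀ ν ∈ Set.Icc (0 : ℝ) 1, 0 ≤ S m ν := fun m ν hν => ha0.le.trans (ha m ν hν)
  have hb0 : 0 < b :=
    ha0.trans_le ((ha 0 0 (by simp)).trans (hb 0 0 (by simp)))
  -- A convergent sequence is bounded from its first term, so κ bounds c_N for every k; this makes
  -- the first claim valid for all dimensions, not only for large ones.
  obtain ⟨κ₀, hκ₀⟩ := hcN.bddAbove_range
  set κ := max 1 κ₀ with hκdef
  have hκ : 1 ≤ κ := le_max_left _ _
  have hdim : ∀ k, (M k : ℝ) * L k / N k ≤ κ := fun k =>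
    (hκ₀ ⟨k, rfl⟩).trans (le_max_right _ _)
  have hK0 : 0 ≤ K := (tsum_nonneg fun _ => Real.sqrt_nonneg _).trans (hK 1 le_rfl).2
  refine ⟨fun k => BlockHankel.exists_isCanonicalPair (hMpos k) (hLpos k) (hNpos k) hSint hb hS0, ?_⟩
  set C₁ := Real.pi ^ 2 * b * K * κ * (1 + κ * b) * (1 + 2 * (κ * b) ^ 2) with hC₁
  set C₂ := 2 * (Real.pi ^ 2 * b ^ 2 * K * κ ^ 2 * (1 + κ * b)) with hC₂
  have hC₁0 : 0 ≤ C₁ := by positivity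
  have hC₂0 : 0 ≤ C₂ := by positivity
  -- Only C₁, C₂ ≥ 0 are known; adding 1 makes the coefficients positive. The exponents are the
  -- powers of u in the bound and in the smallness condition.
  refine ⟨BlockHankel.shiftedMonomial (C₁ + 1) 12, BlockHankel.shiftedMonomial 1 12,
    BlockHankel.shiftedMonomial (C₂ + 1) 8, BlockHankel.shiftedMonomial 1 8,
    BlockHankel.isNice_shiftedMonomial (by positivity) _,
    BlockHankel.isNice_shiftedMonomial one_pos _,
    BlockHankel.isNice_shiftedMonomial (by positivity) _,
    BlockHankel.isNice_shiftedMonomial one_pos _, fun T T' hT => ?_⟩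
  have key : ∀ k, ∀ z ∉ BlockHankel.halfLine,
      (L k : ℝ) ^ (3 / 2 : ℝ) / ((M k : ℝ) * (N k : ℝ)) *
        ((BlockHankel.shiftedMonomial (C₂ + 1) 8).eval ‖z‖ *
          (BlockHankel.shiftedMonomial 1 8).eval (1 / BlockHankel.delta z)) < 1 →
      ∀ A : Matrix (Fin (M k) × Fin (L k)) (Fin (M k) × Fin (L k)) ℂ,
        ‖(1 / ((M k : ℂ) * (L k : ℂ))) *
            (A * (BlockHankel.meanResolvent P (w k) z - T k z)).trace‖ ≤
          BlockHankel.specNorm A * ((BlockHankel.shiftedMonomial (C₁ + 1) 12).eval ‖z‖ *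
            (BlockHankel.shiftedMonomial 1 12).eval (1 / BlockHankel.delta z)) *
            ((L k : ℝ) / ((M k : ℝ) * (N k : ℝ))) := by
    intro k z hz hlt A
    have hδ := BlockHankel.delta_pos hz
    simp only [BlockHankel.eval_shiftedMonomial, one_mul] at hlt ⊢
    refine (BlockHankel.norm_trace_mul_meanResolvent_sub_le (hMpos k) (hLpos k) (hNpos k) (hw k)
      hSint hb0 hb hS0 (hK (M k) (hMpos k)).1 (hK (M k) (hMpos k)).2 hκ (hdim k) (hT k) hz ?_
      A).trans ?_
    · refine le_trans ?_ hlt.le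
      rw [mul_pow (1 + ‖z‖), ← mul_assoc C₂]
      gcongr
      linarith
    · have hA := BlockHankel.specNorm_nonneg A
      rw [mul_pow (1 + ‖z‖), ← mul_assoc C₁]
      gcongr
      linarith
  have key₂ : ∀ z ∉ BlockHankel.halfLine, ∃ k₀, ∀ k ≥ k₀,
      ∀ A : Matrix (Fin (M k) × Fin (L k)) (Fin (M k) × Fin (L k)) ℂ,
        ‖(1 / ((M k : ℂ) * (L k : ℂ))) *
            (A * (BlockHankel.meanResolvent P (w k) z - T k z)).trace‖ ≤
          BlockHankel.specNorm A * ((BlockHankel.shiftedMonomial (C₁ + 1) 12).eval ‖z‖ *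
            (BlockHankel.shiftedMonomial 1 12).eval (1 / BlockHankel.delta z)) *
            ((L k : ℝ) / ((M k : ℝ) * (N k : ℝ))) := by
    intro z hz
    -- At a fixed z the polynomial factor is constant, so z satisfies the smallness condition from
    -- some rank on, and that rank does not involve A.
    have h1 := hextra.mul_const ((BlockHankel.shiftedMonomial (C₂ + 1) 8).eval ‖z‖ *
      (BlockHankel.shiftedMonomial 1 8).eval (1 / BlockHankel.delta z))
    rw [zero_mul] at h1
    obtain ⟨k₀, hk₀⟩ := Filter.eventually_atTop.1 (h1.eventually_lt_const one_pos)
    exact ⟨k₀, fun k hk => key k z hz (hk₀ k hk)⟩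
  refine ⟨key, key₂, fun z hz A hA => ?_⟩
  obtain ⟨α, hα⟩ := hA
  obtain ⟨k₀, hk₀⟩ := key₂ z hz
  have hδ := BlockHankel.delta_pos hz
  refine Asymptotics.IsBigO.of_bound (α * ((BlockHankel.shiftedMonomial (C₁ + 1) 12).eval ‖z‖ *
    (BlockHankel.shiftedMonomial 1 12).eval (1 / BlockHankel.delta z)))
    (Filter.eventually_atTop.2 ⟨k₀, fun k hk => (hk₀ k hk (A k)).trans ?_⟩)
  rw [Real.norm_of_nonneg (by positivity)]
  simp only [BlockHankel.eval_shiftedMonomial, one_mul]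
  gcongr
  exact hα k
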